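/- For $N\ge 0$ let $\mathcal{CM}_N$ be the set of quadruples $\mathcal X=(X,Z,\vec a,\vec b)$ of two complex $N\times N$ matrices and two vectors in $\mathbb C^N$ with $[X,Z]-I=\vec b\,\vec a^{\top}$; put $\mathcal X^\flat=(Z^\top,X^\top,\vec b,\vec a)\in\mathcal{CM}_N$ and $$\psi_{\mathcal X}(x,y,z)=\bigl(1+\vec a^\top(xI+2yZ-X)^{-1}(zI-Z)^{-1}\vec b\bigr)e^{xz+yz^2},$$ $$\tau_{\mathcal X}(x,y)=\det(xI+2yZ-X),\quad q_{\mathcal X}(z)=\det(zI-Z),\quad \hat\psi_{\mathcal X}=q_{\mathcal X}\psi_{\mathcal X},\quad \hat{\hat\psi}_{\mathcal X}=\tau_{\mathcal X}q_{\mathcal X}\psi_{\mathcal X}.$$ Define $\hat f_n^{\mathcal X}$ and $\hat g_n^{\mathcal X}$ by $\hat\psi_{\mathcal X^\flat}(x,-\tfrac12,w)=\sum_{n\ge0}\hat f_n^{\mathcal X}(x)w^n$ and $\hat\psi_{\mathcal X}(x,-\tfrac12,z)=\sum_{n\ge0}\hat g_n^{\mathcal X}(x)z^n$. Write $\hat{\hat\psi}_{\mathcal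 X}(x,0,z)=e^{xz}\sum_{i,j}c_{ij}x^iz^j$ (a finite sum) and $B_{\mathcal X}=\{i-j : c_{ij}\ne0\}\subset\mathbb Z$. Let $\lambda=(\lambda_1\ge\dots\ge\lambda_N\ge0)$ be a partition with $\lambda_1+\dots+\lambda_N=N$, and let $m_i=N+\lambda_i-i$. Let $h_n$ be the Hermite polynomials with $e^{xz-z^2/2}=\sum_{n\ge0} h_n(x)z^n$, and define the exceptional Hermite functions $$\hat h_n^\lambda=\frac{\mathrm{Wr}(h_{m_1},\dots,h_{m_N},h_n)}{\mathrm{Wr}(h_{m_1},\dots,h_{m_N})}.$$ With $\psi_0=e^{xz+yz^2}$, $\kappa_i(x,y)=\partial_z^{m_i}\psi_0|_{z=0}$ and Wronskians with respect to $x$, let $$\psi_\lambda(x,y,z)=\frac{\mathrm{Wr}(\kappa_1,\dots,\kappa_N,\psi_0)}{z^N\,\mathrm{Wr}(\kappa_1,\dots,\kappa_N)}.$$ An $\mathcal X\in\mathcal{CM}_N$ is called Calogero–Moser data attached to $\lambda$, written $\mathcal X=\mathcal X_\lambda$, if $\psi_{\mathcal X}(x,y,z)=\psi_\lambda(x,y,z)$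 (wherever no denominator vanishes). Then: 1. Calogero–Moser data $\mathcal X_\lambda\in\mathcal{CM}_N$ attached to $\lambda$ exist. 2. If $\mathcal X=\mathcal X_\lambda$, then the three sequences of rational functions coincide, $\hat f_n^{\mathcal X}=\hat g_n^{\mathcal X}=\hat h_n^\lambda$ for all $n\ge0$, and $B_{\mathcal X}=\{0\}$. 3. The exceptional Hermite functions are orthogonal with respect to the Hermite product: there are constants $\nu_n$ with $$\langle\hat h_m^\lambda,\hat h_n^\lambda\rangle_H=\int_{-\infty}^{\infty}\hat h_m^\lambda(x)\,\hat h_n^\lambda(x)\,e^{-x^2/2}\,dx=\nu_n\delta_{mn}\qquad(m,n\ge0),$$ where the integral is taken along any $C^1$ path in $\mathbb C$ that avoids the zeros of $\mathrm{Wr}(h_{m_1},\dots,h_{m_N})$, whose real part goes from $-\infty$ to $\infty$, and whose imaginary part tends to $0$ at both ends; the improper integral converges along each such path, and its value does not depend on the path. -/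

import Mathlib

open Filter Topology Matrix

noncomputable section

namespace XHermite

/-! ### Calogero-Moser matrices and their wave functions -/

/-- The set of quadruples `(X, Z, a, b)` of two complex `N × N` matrices and two `N`-vectors
with `[X, Z] - I = b aᵀ`. -/
@[ext] structure CM (N : ℕ) where
  X : Matrix (Fin N) (Fin N) ℂ
  Z : Matrix (Fin N) (Fin N) ℂ
  a : Fin N → ℂ
  b : Fin N → ℂ
  rank_one : (X * Z - Z * X) - 1 = Matrix.vecMulVec b a

namespace CM

variable {N : ℕ}

/-- The bispectral involution `(X, Z, a, b) ↦ (Zᵀ, Xᵀ, b, a)`. -/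
def flat (𝒳 : CM N) : CM N where
  X := 𝒳.Zᵀ
  Z := 𝒳.Xᵀ
  a := 𝒳.b
  b := 𝒳.a
  rank_one := by
    have h := congrArg Matrix.transpose 𝒳.rank_one
    simpa [Matrix.transpose_sub, Matrix.transpose_mul, Matrix.transpose_vecMulVec] using h

/-- The matrix `x I + 2 y Z - X`. -/
def Xt (𝒳 : CM N) (x y : ℂ) : Matrix (Fin N) (Fin N) ℂ :=
  x • (1 : Matrix (Fin N) (Fin N) ℂ) + (2 * y) • 𝒳.Z - 𝒳.X

/-- The matrix `z I - Z`. -/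
def Zt (𝒳 : CM N) (z : ℂ) : Matrix (Fin N) (Fin N) ℂ :=
  z • (1 : Matrix (Fin N) (Fin N) ℂ) - 𝒳.Z

/-- `τ(x, y) = det (x I + 2 y Z - X)`. -/
def tau (𝒳 : CM N) (x y : ℂ) : ℂ := (𝒳.Xt x y).det

/-- `q(z) = det (z I - Z)`. -/
def q (𝒳 : CM N) (z : ℂ) : ℂ := (𝒳.Zt z).det

/-- The wave function
`ψ(x, y, z) = (1 + aᵀ (x I + 2 y Z - X)⁻¹ (z I - Z)⁻¹ b) exp (x z + y z²)`.
It is only meaningful where `τ(x, y) ≠ 0` and `q(z) ≠ 0`. -/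
def wave (𝒳 : CM N) (x y z : ℂ) : ℂ :=
  (1 + 𝒳.a ⬝ᵥ ((𝒳.Xt x y)⁻¹ *ᵥ ((𝒳.Zt z)⁻¹ *ᵥ 𝒳.b))) * Complex.exp (x * z + y * z ^ 2)

/-- The normalized wave function `q(z) ψ(x, y, z)`, where `q(z) (z I - Z)⁻¹` is written as the
adjugate of `z I - Z`; so this is the extension of the product that is holomorphic in `z`
(see `hatWave_eq`). It is only meaningful where `τ(x, y) ≠ 0`. -/
def hatWave (𝒳 : CM N) (x y z : ℂ) : ℂ :=
  (𝒳.q z + 𝒳.a ⬝ᵥ ((𝒳.Xt x y)⁻¹ *ᵥ ((𝒳.Zt z).adjugate *ᵥ 𝒳.b))) *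
    Complex.exp (x * z + y * z ^ 2)

theorem hatWave_eq (𝒳 : CM N) (x y z : ℂ) (hz : 𝒳.q z ≠ 0) :
    𝒳.hatWave x y z = 𝒳.q z * 𝒳.wave x y z := by
  have h : (𝒳.Zt z).adjugate = 𝒳.q z • (𝒳.Zt z)⁻¹ := by
    rw [Matrix.inv_def, smul_smul, Ring.inverse_eq_inv', q,
      mul_inv_cancel₀ (show (𝒳.Zt z).det ≠ 0 from hz), one_smul]
  rw [hatWave, wave, h, Matrix.smul_mulVec, Matrix.mulVec_smul, dotProduct_smul, smul_eq_mul]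
  ring

/-- The doubly normalized wave function `τ(x, y) q(z) ψ(x, y, z)`, holomorphic in all variables
(see `hatHatWave_eq`). -/
def hatHatWave (𝒳 : CM N) (x y z : ℂ) : ℂ :=
  (𝒳.tau x y * 𝒳.q z + 𝒳.a ⬝ᵥ ((𝒳.Xt x y).adjugate *ᵥ ((𝒳.Zt z).adjugate *ᵥ 𝒳.b))) *
    Complex.exp (x * z + y * z ^ 2)

theorem hatHatWave_eq (𝒳 : CM N) (x y z : ℂ) (hx : 𝒳.tau x y ≠ 0) (hz : 𝒳.q z ≠ 0) :
    𝒳.hatHatWave x y z = 𝒳.tau x y * 𝒳.q z * 𝒳.wave x y z := by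
  have h : (𝒳.Xt x y).adjugate = 𝒳.tau x y • (𝒳.Xt x y)⁻¹ := by
    rw [Matrix.inv_def, smul_smul, Ring.inverse_eq_inv', tau,
      mul_inv_cancel₀ (show (𝒳.Xt x y).det ≠ 0 from hx), one_smul]
  rw [mul_assoc, ← hatWave_eq 𝒳 x y z hz, hatWave, hatHatWave, h, Matrix.smul_mulVec,
    dotProduct_smul, smul_eq_mul]
  ring

/-- The polynomial `∑ c_ij x^i z^j` with `τ(x,0) q(z) ψ(x,0,z) = exp (x z) ∑ c_ij x^i z^j`
(see `hatHatWave_zero`); the variable `0` is `x` and the variable `1` is `z`. -/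
def normPoly (𝒳 : CM N) : MvPolynomial (Fin 2) ℂ :=
  let A : Matrix (Fin N) (Fin N) (MvPolynomial (Fin 2) ℂ) :=
    (MvPolynomial.X 0 : MvPolynomial (Fin 2) ℂ) • 1 - 𝒳.X.map MvPolynomial.C
  let B : Matrix (Fin N) (Fin N) (MvPolynomial (Fin 2) ℂ) :=
    (MvPolynomial.X 1 : MvPolynomial (Fin 2) ℂ) • 1 - 𝒳.Z.map MvPolynomial.C
  A.det * B.det +
    (fun i => MvPolynomial.C (𝒳.a i)) ⬝ᵥ
      (A.adjugate *ᵥ (B.adjugate *ᵥ (fun i => MvPolynomial.C (𝒳.b i))))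

theorem hatHatWave_zero (𝒳 : CM N) (x z : ℂ) :
    𝒳.hatHatWave x 0 z =
      Complex.exp (x * z) * MvPolynomial.eval ![x, z] 𝒳.normPoly := by
  set φ : MvPolynomial (Fin 2) ℂ →+* ℂ := MvPolynomial.eval ![x, z] with hφ
  have key : ∀ (k : Fin 2) (M : Matrix (Fin N) (Fin N) ℂ),
      φ.mapMatrix ((MvPolynomial.X k : MvPolynomial (Fin 2) ℂ) • 1 - M.map MvPolynomial.C) =
        (![x, z] k) • (1 : Matrix (Fin N) (Fin N) ℂ) - M := by
    intro k M
    ext i j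
    by_cases hij : i = j
    · subst hij; simp [hφ]
    · simp [hφ, Matrix.one_apply_ne hij]
  have hv : ∀ (v w : Fin N → MvPolynomial (Fin 2) ℂ),
      φ (v ⬝ᵥ w) = (fun i => φ (v i)) ⬝ᵥ (fun i => φ (w i)) := by
    intro v w; simp [dotProduct, map_sum]
  have hm : ∀ (M : Matrix (Fin N) (Fin N) (MvPolynomial (Fin 2) ℂ))
      (w : Fin N → MvPolynomial (Fin 2) ℂ),
      (fun i => φ ((M *ᵥ w) i)) = (φ.mapMatrix M) *ᵥ (fun i => φ (w i)) := by
    intro M w; ext i; simp [Matrix.mulVec, dotProduct, map_sum]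
  simp only [normPoly, map_add, map_mul, RingHom.map_det, hv, hm, RingHom.map_adjugate, key]
  simp [hatHatWave, tau, q, Xt, Zt, hφ, mul_comm]

/-- The set of the differences `i - j` over the monomials `x^i z^j` of `normPoly` with a non-zero
coefficient. -/
def B (𝒳 : CM N) : Set ℤ :=
  {d | ∃ s : Fin 2 →₀ ℕ, MvPolynomial.coeff s 𝒳.normPoly ≠ 0 ∧ d = (s 0 : ℤ) - (s 1 : ℤ)}

/-- `ĝ_n(x)`: the coefficient of `z^n` in the expansion at `z = 0` of the normalized wave function
of `𝒳` at `y = -1/2`. -/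
def gHat (𝒳 : CM N) (n : ℕ) (x : ℂ) : ℂ :=
  iteratedDeriv n (fun z => 𝒳.hatWave x (-1 / 2) z) 0 / (n.factorial : ℂ)

/-- `f̂_n(x)`: the coefficient of `w^n` in the expansion at `w = 0` of the normalized wave function
of the image of `𝒳` under the bispectral involution, at `y = -1/2`. -/
def fHat (𝒳 : CM N) (n : ℕ) (x : ℂ) : ℂ :=
  iteratedDeriv n (fun w => 𝒳.flat.hatWave x (-1 / 2) w) 0 / (n.factorial : ℂ)

theorem differentiable_hatWave (𝒳 : CM N) (x y : ℂ) :
    Differentiable ℂ (fun z => 𝒳.hatWave x y z) := by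
  have h1 : ∀ M : ℂ → Matrix (Fin N) (Fin N) ℂ,
      (∀ i j, Differentiable ℂ (fun z => M z i j)) → Differentiable ℂ (fun z => (M z).det) := by
    intro M hM
    simp only [Matrix.det_apply]
    fun_prop
  have h2 : ∀ i j, Differentiable ℂ (fun z => 𝒳.Zt z i j) := by
    intro i j
    simp only [Zt, Matrix.sub_apply, Matrix.smul_apply, smul_eq_mul]
    fun_prop
  have h3 : ∀ i j, Differentiable ℂ (fun z => (𝒳.Zt z).adjugate i j) := by
    intro i j
    simp only [Matrix.adjugate_apply]
    refine h1 _ fun k l => ?_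
    by_cases hk : k = j
    · subst hk; simp
    · simpa [Matrix.updateRow_ne hk] using h2 k l
  have h4 : Differentiable ℂ (fun z => 𝒳.q z) := h1 _ h2
  simp only [hatWave, dotProduct, Matrix.mulVec]
  fun_prop

/-- The functions `ĝ_n` are generated by the normalized wave function, for every `z`. -/
theorem hasSum_gHat (𝒳 : CM N) (x z : ℂ) :
    HasSum (fun n => 𝒳.gHat n x * z ^ n) (𝒳.hatWave x (-1 / 2) z) := by
  have h := Complex.hasSum_taylorSeries_of_entire (𝒳.differentiable_hatWave x (-1 / 2)) 0 z
  have e : (fun n : ℕ => 𝒳.gHat n x * z ^ n) = fun n : ℕ => ((n.factorial : ℂ))⁻¹ •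
      (z - 0) ^ n • iteratedDeriv n (fun z => 𝒳.hatWave x (-1 / 2) z) 0 := by
    funext n
    simp only [gHat, sub_zero, smul_eq_mul]
    ring
  rw [e]
  exact h

/-- The functions `f̂_n` are generated by the normalized wave function of the image under the
bispectral involution, for every `w`. -/
theorem hasSum_fHat (𝒳 : CM N) (x w : ℂ) :
    HasSum (fun n => 𝒳.fHat n x * w ^ n) (𝒳.flat.hatWave x (-1 / 2) w) :=
  𝒳.flat.hasSum_gHat x w

end CM

/-! ### Exceptional Hermite quasi-polynomials -/

/-- The Wronskian `Wr(f_0, …, f_{n-1})` at `x`, the determinant of the matrix of the derivatives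
`f_j^(i)(x)`. -/
def wronskian {n : ℕ} (f : Fin n → ℂ → ℂ) (x : ℂ) : ℂ :=
  (Matrix.of fun i j : Fin n => iteratedDeriv (i : ℕ) (f j) x).det

/-- The trivial wave function `ψ₀(x, y, z) = exp (x z + y z²)`. -/
def psi0 (x y z : ℂ) : ℂ := Complex.exp (x * z + y * z ^ 2)

/-- The classical Hermite polynomial `h_n`, normalized by
`exp (x z - z²/2) = ∑ h_n(x) z^n`. -/
def h (n : ℕ) (x : ℂ) : ℂ :=
  iteratedDeriv n (fun z => Complex.exp (x * z - z ^ 2 / 2)) 0 / (n.factorial : ℂ)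

/-- The `N` exponents `N + λ_i - i`, `1 ≤ i ≤ N` (here the index `i` starts at `0`). -/
def expo {N : ℕ} (lam : Fin N → ℕ) (i : Fin N) : ℕ := N + lam i - ((i : ℕ) + 1)

/-- The denominator `Wr(h_{N+λ_1-1}, …, h_{N+λ_N-N})`. -/
def hDen {N : ℕ} (lam : Fin N → ℕ) (x : ℂ) : ℂ :=
  wronskian (fun i => h (expo lam i)) x

/-- The differential operator
`K_λ(f) = Wr(h_{N+λ_1-1}, …, h_{N+λ_N-N}, f) / Wr(h_{N+λ_1-1}, …, h_{N+λ_N-N})`. -/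
def K {N : ℕ} (lam : Fin N → ℕ) (f : ℂ → ℂ) (x : ℂ) : ℂ :=
  wronskian (Fin.snoc (α := fun _ => ℂ → ℂ) (fun i => h (expo lam i)) f) x / hDen lam x

/-- The exceptional Hermite quasi-polynomials `ĥ_n^λ = K_λ(h_n)`. -/
def hHat {N : ℕ} (lam : Fin N → ℕ) (n : ℕ) (x : ℂ) : ℂ := K lam (h n) x

/-- `κ_m(x, y)`, the `m`-th derivative of `ψ₀(x, y, z)` with respect to `z` at `z = 0`. -/
def kappa (m : ℕ) (x y : ℂ) : ℂ := iteratedDeriv m (fun z => psi0 x y z) 0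

/-- The Wronskian (with respect to `x`) of the functions `κ_{N+λ_i-i}(x, y)`. -/
def kappaWr {N : ℕ} (lam : Fin N → ℕ) (x y : ℂ) : ℂ :=
  wronskian (fun i x' => kappa (expo lam i) x' y) x

/-- The wave function `ψ_λ(x, y, z) = Wr(κ_1, …, κ_N, ψ₀) / (z^N Wr(κ_1, …, κ_N))`, with
Wronskians with respect to `x`. It is only meaningful where the denominator does not vanish. -/
def psiLam {N : ℕ} (lam : Fin N → ℕ) (x y z : ℂ) : ℂ :=
  wronskian (Fin.snoc (α := fun _ => ℂ → ℂ)
      (fun i x' => kappa (expo lam i) x' y) (fun x' => psi0 x' y z)) x /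
    (z ^ N * kappaWr lam x y)

/-- `𝒳` is Calogero-Moser data attached to `λ`: the functions `ψ_𝒳(x, y, z)` and `ψ_λ(x, y, z)`
coincide, that is, they are equal wherever no denominator vanishes. -/
def IsDataOf {N : ℕ} (lam : Fin N → ℕ) (𝒳 : CM N) : Prop :=
  ∀ x y z : ℂ, 𝒳.tau x y ≠ 0 → 𝒳.q z ≠ 0 → kappaWr lam x y ≠ 0 → z ≠ 0 →
    𝒳.wave x y z = psiLam lam x y z

/-! ### The Hermite product -/

/-- A `C¹` path in `ℂ` that avoids `S`, runs from `-∞` to `∞`, and approaches the real axis at both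
ends. -/
structure IsHermitePath (S : Set ℂ) (γ : ℝ → ℂ) : Prop where
  contDiff : ContDiff ℝ 1 γ
  avoids : ∀ t, γ t ∉ S
  re_atTop : Tendsto (fun t => (γ t).re) atTop atTop
  re_atBot : Tendsto (fun t => (γ t).re) atBot atBot
  im_atTop : Tendsto (fun t => (γ t).im) atTop (𝓝 0)
  im_atBot : Tendsto (fun t => (γ t).im) atBot (𝓝 0)

/-- Such paths exist for every finite set of singularities. -/
theorem exists_isHermitePath {S : Set ℂ} (hS : S.Finite) : ∃ γ, IsHermitePath S γ := by
  obtain ⟨c, hc⟩ := ((hS.image fun s : ℂ => s.im * (1 + s.re ^ 2)).exists_notMem)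
  have hpos : ∀ t : ℝ, 1 + t ^ 2 ≠ 0 := fun t => by positivity
  have hlim : ∀ l : Filter ℝ, Tendsto (fun t : ℝ => 1 + t ^ 2) l atTop →
      Tendsto (fun t : ℝ => c / (1 + t ^ 2)) l (𝓝 0) := fun l hl => hl.const_div_atTop c
  have hre : ∀ t : ℝ, ((t : ℂ) + ((c / (1 + t ^ 2) : ℝ) : ℂ) * Complex.I).re = t := fun t => by
    rw [Complex.add_re, Complex.re_ofReal_mul, Complex.I_re, Complex.ofReal_re, mul_zero, add_zero]
  have him : ∀ t : ℝ, ((t : ℂ) + ((c / (1 + t ^ 2) : ℝ) : ℂ) * Complex.I).im = c / (1 + t ^ 2) :=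
    fun t => by
      rw [Complex.add_im, Complex.im_ofReal_mul, Complex.I_im, Complex.ofReal_im, mul_one, zero_add]
  have hsq : ∀ t : ℝ, t ^ 2 ≤ 1 + t ^ 2 := fun t => by linarith
  refine ⟨fun t => (t : ℂ) + ((c / (1 + t ^ 2) : ℝ) : ℂ) * Complex.I, ?_, ?_, ?_, ?_, ?_, ?_⟩
  · have h1 : ContDiff ℝ 1 (fun t : ℝ => c / (1 + t ^ 2)) :=
      contDiff_const.div (contDiff_const.add (contDiff_id.pow 2)) hpos
    exact Complex.ofRealCLM.contDiff.add ((Complex.ofRealCLM.contDiff.comp h1).mul contDiff_const)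
  · intro t ht
    refine hc ⟨_, ht, ?_⟩
    simp only [hre, him]
    exact div_mul_cancel₀ c (hpos t)
  · simp only [hre]; exact tendsto_id
  · simp only [hre]; exact tendsto_id
  · simp only [him]
    exact hlim atTop (tendsto_atTop_mono hsq (tendsto_pow_atTop two_ne_zero))
  · simp only [him]
    refine hlim atBot (tendsto_atTop_mono hsq ?_)
    have := (tendsto_pow_atTop (α := ℝ) two_ne_zero).comp tendsto_neg_atBot_atTop
    refine this.congr fun t => ?_
    simp

/-- The Hermite product `∫ f(x) g(x) exp (-x²/2) dx` from `-∞` to `∞`, of functions whose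
singularities lie in `S`, is well-defined with value `v`: along every path as above that avoids
`S`, the improper integral converges to `v`. -/
def HasHermiteProduct (S : Set ℂ) (f g : ℂ → ℂ) (v : ℂ) : Prop :=
  ∀ γ : ℝ → ℂ, IsHermitePath S γ →
    Tendsto (fun p : ℝ × ℝ => ∫ t in p.1..p.2,
      f (γ t) * g (γ t) * Complex.exp (-(γ t) ^ 2 / 2) * deriv γ t) (atBot ×ˢ atTop) (𝓝 v)

end XHermite

end

noncomputable section

namespace XHermite

/-! ### Linear algebra -/

section LinearAlgebra

variable {N : ℕ}

/-! Everything is read off from the moments `aᵀ X^p Z^q b`. Call the data balanced if the moments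
with `p ≠ q` vanish.

Existence. The partition is cut into hooks (`exists_hooks`), and a model is written down with one
chain of basis vectors per arm and per leg, coupled by a Cauchy matrix (`model_commutator`). It
carries a grading in which `X` and `Z` have degrees `-1` and `1`, so it is balanced. For every
exponent `m` it contains a vector `d` on whose `Z`-orbit the action of `X` is explicit. The Hermite
recurrence then makes `∑ He_j Z^j d` solve a linear system for `x + 2yZ - X`
(`IsGenerator.Xt_mulVec`). Hence the monic operator in `∂_x` that produces `z^N ψ_𝒳` from `ψ₀` kills
each `κ_i`, and such an operator is a quotient of Wronskians (`psiNum_eq`).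

Arbitrary data. At `y = 0` the wave function is a double resolvent, whose expansion at infinity
recovers all the moments. So all data attached to `λ` share the moments of the model
(`IsDataOf.pair_eq`) and are balanced. Balance makes `X` and `Z` nilpotent by traces of powers, and
turns the doubly normalized wave function at `y = 0` into `exp (xz)` times a polynomial in `xz`,
which gives `B = {0}`. It also gives `𝒳` and `𝒳.flat` the same moments; since the commutation
relation reduces every word in `X` and `Z` to ordered ones, `f̂_n = ĝ_n` follows
(`Balanced.T_zero_right`). Taylor expansion in `z` of the Wronskian formula identifies `ĝ_n` with
`ĥ_n`.

Orthogonality. Write `ĥ_m ĥ_n` as `f̂_m ĝ_n` and expand in the resolvent moments `T p q`. The rank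
one relation turns each product `T p 0 * T 0 q` into moments `T`, a derivative, and a constant
(`T_mul_T`). After summation by parts, `f̂_m ĝ_n exp (-x²/2)` is the derivative of a function that
is single-valued off the poles and tends to `0` at both ends, plus constants times products of two
classical Hermite polynomials with the weight. By balance, only products whose indices differ by `m
- n` remain, and these are orthogonal. A single-valued primitive gives convergence and path
independence at once. Finally `τ` does not vanish where the Wronskian does not
(`tau_ne_zero_of_isGenerator`), so avoiding the zeros of the Wronskian suffices. -/

theorem isNilpotent_of_trace_pow_eq_zero {A : Matrix (Fin N) (Fin N) ℂ}
    (hA : ∀ n, 1 ≤ n → (A ^ n).trace = 0) : IsNilpotent A := by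
  classical
  open Polynomial in
  obtain ⟨g, hg, hdvd⟩ := A.charpoly.exists_eq_pow_rootMultiplicity_mul_and_not_dvd
    A.charpoly_monic.ne_zero 0
  set k := A.charpoly.rootMultiplicity 0
  rw [Polynomial.C_0, sub_zero] at hg hdvd
  have hcop : IsCoprime (Polynomial.X ^ (k + 1) : Polynomial ℂ) g :=
    ((Polynomial.irreducible_X.coprime_iff_not_dvd).2 hdvd).pow_left
  obtain ⟨u, v, huv⟩ := hcop
  have hCH : Polynomial.aeval A (Polynomial.X ^ k * g) = 0 := by
    rw [← hg]; exact Matrix.aeval_self_charpoly A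
  -- `e` is the Fitting projection onto the part where `A` is invertible. It is a polynomial in `A`
  -- without constant term, so its trace is `0`; in characteristic zero an idempotent of trace `0`
  -- vanishes.
  set e := Polynomial.aeval A (u * Polynomial.X ^ (k + 1)) with he
  have htr : ∀ p : Polynomial ℂ, (Polynomial.aeval A (p * Polynomial.X)).trace = 0 := by
    intro p
    induction p using Polynomial.induction_on' with
    | add p q hp hq => rw [add_mul, map_add, Matrix.trace_add, hp, hq, add_zero]
    | monomial n c =>
      rw [Polynomial.monomial_mul_X, Polynomial.aeval_monomial, ← Algebra.smul_def,
        Matrix.trace_smul, hA _ (Nat.le_add_left 1 n), smul_zero]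
  have hidem : IsIdempotentElem e := by
    have h1 : (u * Polynomial.X ^ (k + 1)) * (u * Polynomial.X ^ (k + 1)) =
        u * Polynomial.X ^ (k + 1) - (Polynomial.X ^ k * g) * (u * v * Polynomial.X) := by
      linear_combination u * Polynomial.X ^ (k + 1) * huv
    rw [IsIdempotentElem, he, ← map_mul, h1, map_sub, map_mul _ (Polynomial.X ^ k * g), hCH,
      zero_mul, sub_zero]
  have he0 : e = 0 := by
    have h2 : IsIdempotentElem (Matrix.toLin' e) := by
      rw [IsIdempotentElem, Module.End.mul_eq_comp, ← Matrix.toLin'_mul, hidem.eq]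
    have h3 : LinearMap.trace ℂ (Fin N → ℂ) (Matrix.toLin' e) = 0 := by
      rw [Matrix.trace_toLin'_eq, he, pow_succ, ← mul_assoc, htr]
    have h4 := (LinearMap.IsIdempotentElem.trace_eq_zero_iff h2).1 h3
    simpa using h4
  refine ⟨k, ?_⟩
  have h5 : (Polynomial.X ^ k : Polynomial ℂ) =
      Polynomial.X ^ k * (u * Polynomial.X ^ (k + 1)) + (Polynomial.X ^ k * g) * v := by
    linear_combination (-Polynomial.X ^ k) * huv
  have h6 := congrArg (Polynomial.aeval A) h5
  rw [map_add, map_mul, ← he, he0, mul_zero, map_mul, hCH, zero_mul, add_zero, map_pow,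
    Polynomial.aeval_X] at h6
  exact h6

theorem pow_eq_zero_of_isNilpotent {A : Matrix (Fin N) (Fin N) ℂ} (hA : IsNilpotent A) :
    A ^ N = 0 := by
  have h := Matrix.aeval_self_charpoly A
  have h1 := Matrix.isNilpotent_charpoly_sub_pow_of_isNilpotent hA
  have h2 := sub_eq_zero.1 h1.eq_zero
  rw [h2] at h
  simpa using h

/-- Replacing the last row by the combination leaves the determinant unchanged, since its own
coefficient is `1`, and leaves a single nonzero entry to expand along. For a Wronskian, `c` is a
monic differential operator that kills all functions but the last. -/
theorem det_eq_of_row_combination {n : ℕ} (A : Matrix (Fin (n + 1)) (Fin (n + 1)) ℂ)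
    (c : Fin (n + 1) → ℂ) (hc : c (Fin.last n) = 1)
    (h0 : ∀ j : Fin n, ∑ i, c i * A i j.castSucc = 0) :
    A.det = (∑ i, c i * A i (Fin.last n)) * (A.submatrix Fin.castSucc Fin.castSucc).det := by
  have h := Matrix.det_updateRow_sum A (Fin.last n) c
  rw [hc, one_smul] at h
  rw [← h, Matrix.det_succ_row _ (Fin.last n), Fin.sum_univ_castSucc]
  rw [Finset.sum_eq_zero, zero_add]
  · have hs : ((A.updateRow (Fin.last n) (∑ k, c k • A k)).submatrix (Fin.last n).succAbove
        (Fin.last n).succAbove) = A.submatrix Fin.castSucc Fin.castSucc := by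
      ext i j
      simp [Matrix.updateRow_apply, Fin.succAbove_last, (Fin.castSucc_lt_last i).ne]
    rw [hs]
    simp [Finset.sum_apply, ← two_mul]
  · intro j _
    simp only [Matrix.updateRow_self, Finset.sum_apply, Pi.smul_apply, smul_eq_mul, h0]
    simp

theorem adjugate_eq_of_mul_eq {R : Type*} [CommRing R] [IsDomain R] {n : Type*} [Fintype n]
    [DecidableEq n] {A S : Matrix n n R} (hA : A.det ≠ 0) (h : A * S = A.det • 1) :
    A.adjugate = S := by
  have h1 : A.det • A.adjugate = A.det • S := by
    calc A.det • A.adjugate = A.adjugate * (A.det • (1 : Matrix n n R)) := by simp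
      _ = A.det • S := by rw [← h, ← mul_assoc, Matrix.adjugate_mul, Matrix.smul_mul, one_mul]
  ext i j
  have h2 := congrFun (congrFun h1 i) j
  simpa [hA] using h2

theorem sub_mul_geom_sum {R : Type*} [CommRing R] {n : Type*} [Fintype n]
    [DecidableEq n] (Z : Matrix n n R) (z : R) (k : ℕ) :
    (z • (1 : Matrix n n R) - Z) * ∑ q ∈ Finset.range k, z ^ (k - 1 - q) • Z ^ q =
      z ^ k • (1 : Matrix n n R) - Z ^ k := by
  have hc : Commute (z • (1 : Matrix n n R)) Z := (Commute.one_left Z).smul_left z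
  have h := hc.mul_geom_sum₂ k
  rw [smul_pow, one_pow] at h
  rw [← h, ← Finset.sum_range_reflect]
  congr 1
  refine Finset.sum_congr rfl fun q hq => ?_
  have hq' := Finset.mem_range.1 hq
  rw [smul_pow, one_pow, Matrix.smul_mul, one_mul]
  congr 2
  omega

/-- Matrix coefficients of the resolvent. -/
def res (u : Fin N → ℂ) (A : Matrix (Fin N) (Fin N) ℂ) (v : Fin N → ℂ) (x : ℂ) : ℂ :=
  u ⬝ᵥ ((x • (1 : Matrix (Fin N) (Fin N) ℂ) - A)⁻¹ *ᵥ v)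

theorem continuousAt_res_aux (u v : Fin N → ℂ) (M : ℂ → Matrix (Fin N) (Fin N) ℂ)
    (hM : Continuous M) {x : ℂ} (hx : (M x).det ≠ 0) :
    ContinuousAt (fun s => u ⬝ᵥ ((M s)⁻¹ *ᵥ v)) x := by
  have h1 : (fun s => u ⬝ᵥ ((M s)⁻¹ *ᵥ v)) =
      fun s => (M s).det⁻¹ * (u ⬝ᵥ ((M s).adjugate *ᵥ v)) := by
    funext s
    rw [Matrix.inv_def, Ring.inverse_eq_inv', Matrix.smul_mulVec, dotProduct_smul, smul_eq_mul]
  rw [h1]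
  refine ContinuousAt.mul (ContinuousAt.inv₀ hM.matrix_det.continuousAt hx)
    (Continuous.continuousAt ?_)
  exact continuous_const.dotProduct (hM.matrix_adjugate.matrix_mulVec continuous_const)

theorem continuous_resolvent_arg (A : Matrix (Fin N) (Fin N) ℂ) :
    Continuous fun x : ℂ => x • (1 : Matrix (Fin N) (Fin N) ℂ) - A :=
  (continuous_id.smul continuous_const).sub continuous_const

theorem continuousAt_res (u v : Fin N → ℂ) (A : Matrix (Fin N) (Fin N) ℂ) {x : ℂ}
    (hx : (x • (1 : Matrix (Fin N) (Fin N) ℂ) - A).det ≠ 0) : ContinuousAt (res u A v) x :=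
  continuousAt_res_aux u v _ (continuous_resolvent_arg A) hx

/-! ### Resolvents near infinity -/

theorem eventually_det_ne_zero (A : Matrix (Fin N) (Fin N) ℂ) :
    ∀ᶠ x in Bornology.cobounded ℂ, (x • (1 : Matrix (Fin N) (Fin N) ℂ) - A).det ≠ 0 := by
  have hfin : {x : ℂ | (x • (1 : Matrix (Fin N) (Fin N) ℂ) - A).det = 0}.Finite := by
    refine (A.charpoly.roots.toFinset.finite_toSet).subset fun x hx => ?_
    simp only [Finset.mem_coe, Multiset.mem_toFinset, Polynomial.mem_roots
      A.charpoly_monic.ne_zero, Polynomial.IsRoot.def, Matrix.eval_charpoly]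
    rwa [Matrix.scalar_apply, ← Matrix.smul_one_eq_diagonal]
  exact Bornology.isBounded_def.1 hfin.isBounded

theorem eventually_cobounded_ne_zero : ∀ᶠ x in Bornology.cobounded ℂ, x ≠ 0 :=
  Bornology.isBounded_def.1 (Set.finite_singleton (0 : ℂ)).isBounded

/-- In the variable `s = x⁻¹` the expression is a matrix coefficient of `(1 - s A)⁻¹`, which is
continuous at `s = 0`. -/
theorem tendsto_mul_res (u v : Fin N → ℂ) (A : Matrix (Fin N) (Fin N) ℂ) :
    Tendsto (fun x => x * res u A v x) (Bornology.cobounded ℂ) (𝓝 (u ⬝ᵥ v)) := by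
  have hc : Continuous fun s : ℂ => (1 : Matrix (Fin N) (Fin N) ℂ) - s • A :=
    continuous_const.sub (continuous_id.smul continuous_const)
  have h1 := continuousAt_res_aux u v _ hc (x := 0) (by simp)
  have h2 := h1.tendsto.comp (tendsto_inv₀_cobounded (α := ℂ))
  simp only [zero_smul, sub_zero, inv_one, Matrix.one_mulVec] at h2
  refine h2.congr' ?_
  filter_upwards [eventually_cobounded_ne_zero] with x hx
  have : (x • (1 : Matrix (Fin N) (Fin N) ℂ) - A) = x • (1 - x⁻¹ • A) := by
    rw [smul_sub, smul_smul, mul_inv_cancel₀ hx, one_smul]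
  simp only [Function.comp, res, this]
  have hxu : IsUnit x := hx.isUnit
  lift x to ℂˣ using hxu
  have h3 : ((x : ℂ) • (1 - (x : ℂ)⁻¹ • A))⁻¹ = (x : ℂ)⁻¹ • (1 - (x : ℂ)⁻¹ • A)⁻¹ := by
    by_cases hd : IsUnit (1 - (x : ℂ)⁻¹ • A).det
    · have := Matrix.inv_smul' (1 - (x : ℂ)⁻¹ • A) x hd
      simpa [Units.smul_def] using this
    · rw [Matrix.nonsing_inv_apply_not_isUnit _ hd, Matrix.nonsing_inv_apply_not_isUnit, smul_zero]
      rw [Matrix.det_smul]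
      simpa using hd
  rw [h3, Matrix.smul_mulVec, dotProduct_smul, smul_eq_mul, mul_inv_cancel_left₀ hx]

theorem tendsto_res (u v : Fin N → ℂ) (A : Matrix (Fin N) (Fin N) ℂ) :
    Tendsto (res u A v) (Bornology.cobounded ℂ) (𝓝 0) := by
  have h := (tendsto_mul_res u v A).mul (tendsto_inv₀_cobounded (α := ℂ))
  rw [mul_zero] at h
  refine h.congr' ?_
  filter_upwards [eventually_cobounded_ne_zero] with x hx
  field_simp

theorem res_mulVec (u v : Fin N → ℂ) (A : Matrix (Fin N) (Fin N) ℂ) {x : ℂ}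
    (hx : (x • (1 : Matrix (Fin N) (Fin N) ℂ) - A).det ≠ 0) :
    res u A (A *ᵥ v) x = x * res u A v x - u ⬝ᵥ v := by
  have h : (x • (1 : Matrix (Fin N) (Fin N) ℂ) - A)⁻¹ * A =
      x • (x • (1 : Matrix (Fin N) (Fin N) ℂ) - A)⁻¹ - 1 := by
    have h1 := Matrix.nonsing_inv_mul _ (isUnit_iff_ne_zero.2 hx)
    rw [mul_sub, Matrix.mul_smul, mul_one] at h1
    rw [sub_eq_iff_eq_add.1 h1, add_sub_cancel_left]
  rw [res, Matrix.mulVec_mulVec, h, Matrix.sub_mulVec, dotProduct_sub, Matrix.smul_mulVec,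
    dotProduct_smul, Matrix.one_mulVec, smul_eq_mul, res]

/-- The leading coefficient at infinity is the zeroth moment. `res_mulVec` removes it and shifts the
remaining moments by one, so induction runs through the whole expansion. -/
theorem moments_eq_of_res_eq {u u' : Fin N → ℂ} {A A' : Matrix (Fin N) (Fin N) ℂ}
    {v v' : Fin N → ℂ} (h : ∀ᶠ x in Bornology.cobounded ℂ, res u A v x = res u' A' v' x) (p : ℕ) :
    u ⬝ᵥ (A ^ p *ᵥ v) = u' ⬝ᵥ (A' ^ p *ᵥ v') := by
  induction p generalizing v v' with
  | zero =>
    simp only [pow_zero, Matrix.one_mulVec]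
    refine tendsto_nhds_unique (tendsto_mul_res u v A) ((tendsto_mul_res u' v' A').congr' ?_)
    filter_upwards [h] with x hx
    rw [hx]
  | succ p ih =>
    rw [pow_succ, pow_succ, ← Matrix.mulVec_mulVec, ← Matrix.mulVec_mulVec]
    refine ih ?_
    have h0 : u ⬝ᵥ v = u' ⬝ᵥ v' := by
      refine tendsto_nhds_unique (tendsto_mul_res u v A) ((tendsto_mul_res u' v' A').congr' ?_)
      filter_upwards [h] with x hx
      rw [hx]
    filter_upwards [h, eventually_det_ne_zero A, eventually_det_ne_zero A'] with x hx h1 h2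
    rw [res_mulVec _ _ _ h1, res_mulVec _ _ _ h2, hx, h0]

theorem hasDerivAt_res (u v : Fin N → ℂ) (A : Matrix (Fin N) (Fin N) ℂ) {x : ℂ}
    (hx : (x • (1 : Matrix (Fin N) (Fin N) ℂ) - A).det ≠ 0) :
    HasDerivAt (res u A v) (-res u A ((x • (1 : Matrix (Fin N) (Fin N) ℂ) - A)⁻¹ *ᵥ v) x) x := by
  rw [hasDerivAt_iff_tendsto_slope]
  have h1 := (continuousAt_res u ((x • (1 : Matrix (Fin N) (Fin N) ℂ) - A)⁻¹ *ᵥ v) A hx).neg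
  refine (h1.tendsto.mono_left nhdsWithin_le_nhds).congr' ?_
  have hne : ∀ᶠ y in 𝓝[≠] x, (y • (1 : Matrix (Fin N) (Fin N) ℂ) - A).det ≠ 0 :=
    ((continuous_resolvent_arg A).matrix_det.continuousAt.eventually_ne hx).filter_mono
      nhdsWithin_le_nhds
  filter_upwards [hne, self_mem_nhdsWithin] with y hy hyx
  have hyx' : y - x ≠ 0 := sub_ne_zero.2 hyx
  have h2 := Matrix.nonsing_inv_mul _ (isUnit_iff_ne_zero.2 hy)
  have h3 := Matrix.mul_nonsing_inv _ (isUnit_iff_ne_zero.2 hx)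
  set P := (y • (1 : Matrix (Fin N) (Fin N) ℂ) - A)⁻¹
  set Q := (x • (1 : Matrix (Fin N) (Fin N) ℂ) - A)⁻¹
  -- The resolvent identity; it makes the difference quotient itself a matrix coefficient that is
  -- continuous at `x`.
  have h4 : P - Q = -(y - x) • (P * Q) := by
    have h5 : (x • (1 : Matrix (Fin N) (Fin N) ℂ) - A) =
        (y • (1 : Matrix (Fin N) (Fin N) ℂ) - A) - (y - x) • 1 := by
      rw [sub_smul]; abel
    calc P - Q = P * ((x • (1 : Matrix (Fin N) (Fin N) ℂ) - A) * Q) -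
          (P * (y • (1 : Matrix (Fin N) (Fin N) ℂ) - A)) * Q := by rw [h2, h3, mul_one, one_mul]
      _ = _ := by
        rw [h5, sub_mul, mul_sub, mul_assoc, sub_sub_cancel_left, Matrix.smul_mul, one_mul,
          Matrix.mul_smul, neg_smul]
  rw [slope_def_field, eq_div_iff hyx']
  simp only [Pi.neg_apply, res]
  rw [← dotProduct_sub, ← Matrix.sub_mulVec, h4, Matrix.smul_mulVec, dotProduct_smul,
    smul_eq_mul, Matrix.mulVec_mulVec]
  ring

end LinearAlgebra

/-! ### Hermite polynomials of two variables -/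

section Hermite

/-- The `n`-th Taylor coefficient of `f` at `0`. -/
def tc (n : ℕ) (f : ℂ → ℂ) : ℂ := iteratedDeriv n f 0 / (n.factorial : ℂ)

theorem iteratedDeriv_id_mul_zero (n : ℕ) {f : ℂ → ℂ} (hf : ContDiff ℂ ⊤ f) :
    iteratedDeriv n (fun z => z * f z) 0 = n * iteratedDeriv (n - 1) f 0 := by
  induction n generalizing f with
  | zero => simp
  | succ n ih =>
    have hf' : ContDiff ℂ ⊤ (deriv f) := by
      have : ContDiff ℂ (⊤ + 1) f := hf
      exact (contDiff_succ_iff_deriv.1 this).2.2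
    have h1 : deriv (fun z => z * f z) = fun z => f z + z * deriv f z := by
      funext z
      have h2 : HasDerivAt (fun z => z * f z) (1 * f z + z * deriv f z) z :=
        (hasDerivAt_id z).mul (hf.differentiable (by simp) z).hasDerivAt
      rw [h2.deriv, one_mul]
    have hzf' : ContDiff ℂ ⊤ fun z => z * deriv f z := contDiff_id.mul hf'
    rw [iteratedDeriv_succ', h1, iteratedDeriv_fun_add (hf.contDiffAt.of_le le_top)
      (hzf'.contDiffAt.of_le le_top), ih hf']
    rcases n with _ | n
    · simp
    · simp only [Nat.add_sub_cancel, iteratedDeriv_succ' (n := n)]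
      push_cast
      ring

theorem tc_id_mul_succ (n : ℕ) {f : ℂ → ℂ} (hf : ContDiff ℂ ⊤ f) :
    tc (n + 1) (fun z => z * f z) = tc n f := by
  have : ((n.factorial : ℕ) : ℂ) ≠ 0 := Nat.cast_ne_zero.2 n.factorial_ne_zero
  have h2 : ((n + 1 : ℕ) : ℂ) ≠ 0 := Nat.cast_ne_zero.2 n.succ_ne_zero
  rw [tc, iteratedDeriv_id_mul_zero _ hf, tc, Nat.factorial_succ, Nat.add_sub_cancel]
  push_cast at h2 ⊢
  field_simp

theorem tc_id_mul_zero (f : ℂ → ℂ) : tc 0 (fun z => z * f z) = 0 := by simp [tc]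

theorem tc_const_mul (n : ℕ) (c : ℂ) (f : ℂ → ℂ) : tc n (fun z => c * f z) = c * tc n f := by
  rw [tc, iteratedDeriv_const_mul_field, tc, mul_div_assoc]

theorem tc_sum {ι : Type*} (n : ℕ) (s : Finset ι) {f : ι → ℂ → ℂ}
    (hf : ∀ i ∈ s, ContDiff ℂ ⊤ (f i)) :
    tc n (fun z => ∑ i ∈ s, f i z) = ∑ i ∈ s, tc n (f i) := by
  rw [tc, iteratedDeriv_fun_sum fun i hi => (hf i hi).contDiffAt.of_le le_top, Finset.sum_div]
  rfl

theorem tc_add (n : ℕ) {f g : ℂ → ℂ} (hf : ContDiff ℂ ⊤ f) (hg : ContDiff ℂ ⊤ g) :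
    tc n (fun z => f z + g z) = tc n f + tc n g := by
  rw [tc, iteratedDeriv_fun_add (hf.contDiffAt.of_le le_top) (hg.contDiffAt.of_le le_top),
    add_div, tc, tc]

theorem contDiff_psi0 (x y : ℂ) : ContDiff ℂ ⊤ (fun z => psi0 x y z) := by
  unfold psi0
  fun_prop

/-- The polynomials `κ_j / j!`, extended by zero to negative indices. -/
def He (y : ℂ) (j : ℤ) (x : ℂ) : ℂ := if 0 ≤ j then tc j.toNat (fun z => psi0 x y z) else 0

theorem He_natCast (y : ℂ) (n : ℕ) (x : ℂ) : He y n x = tc n (fun z => psi0 x y z) := by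
  simp [He]

theorem He_of_neg {y : ℂ} {j : ℤ} (hj : j < 0) (x : ℂ) : He y j x = 0 := by
  simp [He, not_le.2 hj]

theorem He_zero (y x : ℂ) : He y 0 x = 1 := by
  simp [He, tc, psi0]

theorem kappa_eq (m : ℕ) (x y : ℂ) : kappa m x y = (m.factorial : ℂ) * He y m x := by
  rw [He_natCast, tc, kappa, mul_div_cancel₀ _ (Nat.cast_ne_zero.2 m.factorial_ne_zero)]

theorem h_eq (n : ℕ) (x : ℂ) : h n x = He (-1 / 2) n x := by
  rw [He_natCast, h, tc]
  congr 3
  funext z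
  rw [psi0]
  congr 1
  ring

/-- Multiplication by `z^i` is a pure index shift because `He` is zero at negative indices. The same
convention makes the recurrence and the derivative rule hold for all integers. -/
theorem tc_pow_mul_psi0 (n i : ℕ) (x y : ℂ) :
    tc n (fun z => z ^ i * psi0 x y z) = He y ((n : ℤ) - i) x := by
  induction i generalizing n with
  | zero => simp [He_natCast]
  | succ i ih =>
    have h1 : (fun z => z ^ (i + 1) * psi0 x y z) = fun z => z * (z ^ i * psi0 x y z) := by
      funext z; ring
    rw [h1]
    rcases n with _ | n
    · rw [tc_id_mul_zero, He_of_neg]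
      push_cast
      omega
    · rw [tc_id_mul_succ, ih]
      · congr 1
        push_cast
        ring
      · exact (contDiff_id.pow i).mul (contDiff_psi0 x y)

/-- Compare Taylor coefficients in `∂_z ψ₀ = (x + 2yz) ψ₀`. -/
theorem He_succ (y : ℂ) (j : ℤ) (x : ℂ) :
    (j + 1 : ℂ) * He y (j + 1) x = x * He y j x + 2 * y * He y (j - 1) x := by
  rcases lt_trichotomy j (-1) with hj | hj | hj
  · rw [He_of_neg (by omega), He_of_neg (by omega), He_of_neg (by omega)]
    simp
  · subst hj
    rw [He_of_neg (j := -1) (by omega), He_of_neg (j := -1 - 1) (by omega)]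
    simp
  · obtain ⟨n, rfl⟩ := Int.eq_ofNat_of_zero_le (show 0 ≤ j by omega)
    have h1 : deriv (fun z => psi0 x y z) = fun z => x * psi0 x y z + 2 * y * (z * psi0 x y z) := by
      funext z
      have h2 : HasDerivAt (fun z => psi0 x y z)
          (Complex.exp (x * z + y * z ^ 2) * (x * 1 + y * (((2 : ℕ) : ℂ) * z ^ (2 - 1) * 1))) z :=
        (((hasDerivAt_id z).const_mul x).add (((hasDerivAt_id z).pow 2).const_mul y)).cexp
      rw [h2.deriv, psi0]
      push_cast
      ring
    have h3 : ((n : ℂ) + 1) * tc (n + 1) (fun z => psi0 x y z) =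
        tc n (deriv (fun z => psi0 x y z)) := by
      have : ((n.factorial : ℕ) : ℂ) ≠ 0 := Nat.cast_ne_zero.2 n.factorial_ne_zero
      have h2 : ((n + 1 : ℕ) : ℂ) ≠ 0 := Nat.cast_ne_zero.2 n.succ_ne_zero
      rw [tc, iteratedDeriv_succ', tc, Nat.factorial_succ]
      push_cast at h2 ⊢
      field_simp
    have h4 : He y ((n : ℤ) + 1) x = tc (n + 1) (fun z => psi0 x y z) := He_natCast y (n + 1) x
    have h5 := tc_pow_mul_psi0 n 1 x y
    simp only [pow_one, Nat.cast_one] at h5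
    rw [h4, Int.cast_natCast, h3, h1, tc_add, tc_const_mul, tc_const_mul, h5,
      He_natCast]
    · exact contDiff_const.mul (contDiff_psi0 x y)
    · exact contDiff_const.mul (contDiff_id.mul (contDiff_psi0 x y))

theorem He_induction {y : ℂ} {P : ℤ → (ℂ → ℂ) → Prop} (hneg : ∀ j < 0, P j fun _ => 0)
    (h0 : P 0 fun _ => 1)
    (hs : ∀ j : ℤ, 0 ≤ j → P j (He y j) → P (j - 1) (He y (j - 1)) →
      P (j + 1) (fun x => ((j : ℂ) + 1)⁻¹ * (x * He y j x + 2 * y * He y (j - 1) x))) (j : ℤ) :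
    P j (He y j) := by
  have key : ∀ n : ℕ, ∀ j : ℤ, j ≤ n → P j (He y j) := by
    intro n
    induction n with
    | zero =>
      intro j hj
      rcases lt_or_eq_of_le hj with hj | hj
      · have : He y j = fun _ => 0 := funext fun x => He_of_neg (by simpa using hj) x
        rw [this]
        exact hneg j (by simpa using hj)
      · have : He y j = fun _ => 1 := funext fun x => by simp [hj, He_zero]
        rw [this, hj]
        exact h0
    | succ n ih =>
      intro j hj
      rcases lt_or_eq_of_le hj with hj | hj
      · exact ih j (by push_cast at hj; omega)
      · have h1 := hs n (by omega) (ih n le_rfl) (ih (n - 1) (by omega))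
        have h2 : ((n : ℂ) + 1) ≠ 0 := Nat.cast_add_one_ne_zero n
        have h3 : He y j = fun x => (((n : ℤ) : ℂ) + 1)⁻¹ *
            (x * He y n x + 2 * y * He y ((n : ℤ) - 1) x) := by
          funext x
          rw [← He_succ, hj]
          push_cast
          field_simp
        rw [h3, hj]
        exact_mod_cast h1
  exact key j.toNat j (Int.self_le_toNat j)

theorem hasDerivAt_He (y : ℂ) (j : ℤ) (x : ℂ) : HasDerivAt (He y j) (He y (j - 1) x) x := by
  refine He_induction (y := y) (P := fun j f => HasDerivAt f (He y (j - 1) x) x) ?_ ?_ ?_ j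
  · intro j hj
    rw [He_of_neg (by omega)]
    exact hasDerivAt_const _ _
  · rw [He_of_neg (by omega)]
    exact hasDerivAt_const _ _
  · intro j hj h1 h2
    have h3 := (((hasDerivAt_id x).mul h1).add (h2.const_mul (2 * y))).const_mul ((j : ℂ) + 1)⁻¹
    refine h3.congr_deriv ?_
    have h4 := He_succ y (j - 1) x
    have h5 : (j : ℂ) + 1 ≠ 0 := by
      have : ((j + 1 : ℤ) : ℂ) ≠ 0 := Int.cast_ne_zero.2 (by omega)
      push_cast at this
      exact this
    push_cast at h4
    rw [sub_add_cancel, sub_add_cancel] at h4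
    rw [add_sub_cancel_right, inv_mul_eq_iff_eq_mul₀ h5]
    simp only [id]
    linear_combination -h4

theorem exists_polynomial_He (y : ℂ) (j : ℤ) :
    ∃ p : Polynomial ℂ, ∀ x, He y j x = p.eval x := by
  refine He_induction (y := y) (P := fun j f => ∃ p : Polynomial ℂ, ∀ x, f x = p.eval x) ?_ ?_ ?_ j
  · exact fun j _ => ⟨0, by simp⟩
  · exact ⟨1, by simp⟩
  · rintro j - ⟨p, hp⟩ ⟨q, hq⟩
    refine ⟨Polynomial.C ((j : ℂ) + 1)⁻¹ *
      (Polynomial.X * p + Polynomial.C (2 * y) * q), fun x => ?_⟩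
    simp [hp, hq]

theorem iteratedDeriv_He (y : ℂ) (i : ℕ) (j : ℤ) (x : ℂ) :
    iteratedDeriv i (He y j) x = He y (j - i) x := by
  induction i generalizing j with
  | zero => simp
  | succ i ih =>
    have : deriv (He y j) = He y (j - 1) := funext fun x => (hasDerivAt_He y j x).deriv
    rw [iteratedDeriv_succ', this, ih]
    congr 1
    push_cast
    ring

theorem He_zero_left (n : ℕ) (x : ℂ) : He 0 n x = x ^ n / (n.factorial : ℂ) := by
  induction n with
  | zero => simp [He_zero]
  | succ n ih =>
    have h1 := He_succ 0 n x
    have h2 : ((n : ℂ) + 1) ≠ 0 := Nat.cast_add_one_ne_zero n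
    rw [ih] at h1
    push_cast at h1 ⊢
    have h3 : ((n.factorial : ℕ) : ℂ) ≠ 0 := Nat.cast_ne_zero.2 n.factorial_ne_zero
    rw [Nat.factorial_succ]
    push_cast
    rw [eq_div_iff (by positivity)]
    field_simp at h1
    linear_combination h1

theorem iteratedDeriv_kappa (y : ℂ) (i m : ℕ) (x : ℂ) :
    iteratedDeriv i (fun x' => kappa m x' y) x = (m.factorial : ℂ) * He y ((m : ℤ) - i) x := by
  have : (fun x' => kappa m x' y) = fun x' => (m.factorial : ℂ) * He y m x' :=
    funext fun x' => kappa_eq m x' y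
  rw [this, iteratedDeriv_const_mul_field, iteratedDeriv_He]

theorem iteratedDeriv_psi0 (y z : ℂ) (i : ℕ) (x : ℂ) :
    iteratedDeriv i (fun x' => psi0 x' y z) x = z ^ i * psi0 x y z := by
  induction i generalizing x with
  | zero => simp
  | succ i ih =>
    have : iteratedDeriv i (fun x' => psi0 x' y z) = fun x => z ^ i * psi0 x y z := funext ih
    rw [iteratedDeriv_succ, this]
    have h1 : HasDerivAt (fun x => psi0 x y z) (Complex.exp (x * z + y * z ^ 2) * (1 * z)) x :=
      (((hasDerivAt_id x).mul_const z).add_const (y * z ^ 2)).cexp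
    rw [(h1.const_mul (z ^ i)).deriv, psi0]
    ring

end Hermite

/-! ### Wronskians -/

section Wronskian

variable {N : ℕ}

/-- Cofactor expansion along the last column. The coefficients do not depend on `f`, so Taylor
expansion in a parameter of `f` commutes with the Wronskian. -/
theorem wronskian_snoc (F : Fin N → ℂ → ℂ) (x : ℂ) :
    ∃ c : Fin (N + 1) → ℂ, ∀ f : ℂ → ℂ,
      wronskian (Fin.snoc (α := fun _ => ℂ → ℂ) F f) x = ∑ i, c i * iteratedDeriv i f x := by
  refine ⟨fun i => (-1) ^ ((i : ℕ) + N) *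
    (Matrix.of fun r j : Fin N => iteratedDeriv (i.succAbove r : ℕ) (F j) x).det, fun f => ?_⟩
  rw [wronskian, Matrix.det_succ_column _ (Fin.last N)]
  refine Finset.sum_congr rfl fun i _ => ?_
  have : ((Matrix.of fun i j : Fin (N + 1) => iteratedDeriv (i : ℕ)
      (Fin.snoc (α := fun _ => ℂ → ℂ) F f j) x).submatrix i.succAbove (Fin.last N).succAbove) =
      Matrix.of fun r j : Fin N => iteratedDeriv (i.succAbove r : ℕ) (F j) x := by
    ext r j
    simp [Fin.succAbove_last]
  rw [this]
  simp only [Fin.val_last, Matrix.of_apply, Fin.snoc_last]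
  ring

theorem wronskian_snoc_const_mul (c : Fin N → ℂ) (F : Fin N → ℂ → ℂ) (f : ℂ → ℂ) (x : ℂ) :
    wronskian (Fin.snoc (α := fun _ => ℂ → ℂ) (fun j x' => c j * F j x') f) x =
      (∏ j, c j) * wronskian (Fin.snoc (α := fun _ => ℂ → ℂ) F f) x := by
  have h := Matrix.det_mul_row (Fin.snoc (α := fun _ => ℂ) c 1)
    (Matrix.of fun i j : Fin (N + 1) => iteratedDeriv (i : ℕ)
      (Fin.snoc (α := fun _ => ℂ → ℂ) F f j) x)
  rw [Fin.prod_univ_castSucc] at h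
  simp only [Fin.snoc_castSucc, Fin.snoc_last, mul_one] at h
  rw [wronskian, wronskian, ← h]
  congr 1
  ext i j
  refine Fin.lastCases ?_ (fun j => ?_) j
  · simp
  · simp [iteratedDeriv_const_mul_field]

theorem wronskian_const_mul (c : Fin N → ℂ) (F : Fin N → ℂ → ℂ) (x : ℂ) :
    wronskian (fun j x' => c j * F j x') x = (∏ j, c j) * wronskian F x := by
  have h := Matrix.det_mul_row c (Matrix.of fun i j : Fin N => iteratedDeriv (i : ℕ) (F j) x)
  rw [wronskian, wronskian, ← h]
  congr 1
  ext i j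
  simp [iteratedDeriv_const_mul_field]

theorem kappaWr_eq_det (lam : Fin N → ℕ) (x y : ℂ) :
    kappaWr lam x y = (Matrix.of fun i j : Fin N =>
      ((expo lam j).factorial : ℂ) * He y ((expo lam j : ℤ) - (i : ℕ)) x).det := by
  rw [kappaWr, wronskian]
  simp only [iteratedDeriv_kappa]

theorem kappaWr_eq_hDen (lam : Fin N → ℕ) (x : ℂ) :
    kappaWr lam x (-1 / 2) = (∏ j, ((expo lam j).factorial : ℂ)) * hDen lam x := by
  rw [kappaWr, hDen, ← wronskian_const_mul]
  congr 1
  funext j x'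
  rw [kappa_eq, h_eq]

theorem kappaWr_ne_zero_iff (lam : Fin N → ℕ) (x : ℂ) :
    kappaWr lam x (-1 / 2) ≠ 0 ↔ hDen lam x ≠ 0 := by
  have : (∏ j, ((expo lam j).factorial : ℂ)) ≠ 0 :=
    Finset.prod_ne_zero_iff.2 fun j _ => Nat.cast_ne_zero.2 (Nat.factorial_ne_zero _)
  rw [kappaWr_eq_hDen, mul_ne_zero_iff, and_iff_right this]

/-- The numerator of `psiLam`. -/
def psiNum (lam : Fin N → ℕ) (x y z : ℂ) : ℂ :=
  wronskian (Fin.snoc (α := fun _ => ℂ → ℂ)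
      (fun i x' => kappa (expo lam i) x' y) (fun x' => psi0 x' y z)) x

/-- In the last slot `∂_x^i ψ₀ = z^i ψ₀`, whose `n`-th Taylor coefficient is `∂_x^i h_n`. The
factorials that distinguish `κ_m` from `h_m` cancel in the quotient. -/
theorem tc_psiNum (lam : Fin N → ℕ) (n : ℕ) (x : ℂ) :
    tc n (fun z => psiNum lam x (-1 / 2) z / kappaWr lam x (-1 / 2)) = hHat lam n x := by
  obtain ⟨c, hc⟩ := wronskian_snoc (fun (i : Fin N) x' => kappa (expo lam i) x' (-1 / 2)) x
  have h1 : (fun z => psiNum lam x (-1 / 2) z / kappaWr lam x (-1 / 2)) = fun z =>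
      (kappaWr lam x (-1 / 2))⁻¹ * ∑ i, c i * (z ^ (i : ℕ) * psi0 x (-1 / 2) z) := by
    funext z
    rw [psiNum, hc]
    simp only [iteratedDeriv_psi0]
    rw [div_eq_inv_mul]
  have hcd : ∀ i : Fin (N + 1), ContDiff ℂ ⊤ fun z => (z ^ (i : ℕ) * psi0 x (-1 / 2) z) :=
    fun i => (contDiff_id.pow _).mul (contDiff_psi0 x _)
  have h2 : ∑ i, c i * He (-1 / 2) ((n : ℤ) - (i : ℕ)) x = (∏ j, ((expo lam j).factorial : ℂ)) *
      wronskian (Fin.snoc (α := fun _ => ℂ → ℂ) (fun i => h (expo lam i)) (h n)) x := by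
    rw [← wronskian_snoc_const_mul]
    have h3 : (fun (j : Fin N) x' => ((expo lam j).factorial : ℂ) * h (expo lam j) x') =
        fun j x' => kappa (expo lam j) x' (-1 / 2) := by
      funext j x'
      rw [kappa_eq, h_eq]
    have h4 : h n = He (-1 / 2) n := funext (h_eq n)
    rw [h3, hc, h4]
    simp only [iteratedDeriv_He]
  have h0 : (∏ j, ((expo lam j).factorial : ℂ)) ≠ 0 :=
    Finset.prod_ne_zero_iff.2 fun j _ => Nat.cast_ne_zero.2 (Nat.factorial_ne_zero _)
  rw [h1, tc_const_mul, tc_sum _ _ fun i _ => contDiff_const.mul (hcd i)]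
  simp only [tc_const_mul, tc_pow_mul_psi0]
  rw [h2, hHat, K, kappaWr_eq_hDen, mul_inv, mul_assoc, div_eq_inv_mul]
  field_simp

theorem continuous_psiNum (lam : Fin N → ℕ) (x y : ℂ) : Continuous fun z => psiNum lam x y z := by
  obtain ⟨c, hc⟩ := wronskian_snoc (fun (i : Fin N) x' => kappa (expo lam i) x' y) x
  simp only [psiNum, hc, iteratedDeriv_psi0]
  have := (contDiff_psi0 x y).continuous
  fun_prop

theorem psiNum_eq (lam : Fin N → ℕ) (x y z : ℂ) (c : ℕ → ℂ) (hc : c N = 1)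
    (h0 : ∀ j : Fin N, ∑ i ∈ Finset.range (N + 1), c i * He y ((expo lam j : ℤ) - i) x = 0) :
    psiNum lam x y z =
      (∑ i ∈ Finset.range (N + 1), c i * z ^ i) * psi0 x y z * kappaWr lam x y := by
  rw [psiNum, wronskian, det_eq_of_row_combination _ (fun i : Fin (N + 1) => c i) (by simpa using hc)]
  · have : ((Matrix.of fun i j : Fin (N + 1) => iteratedDeriv (i : ℕ)
        (Fin.snoc (α := fun _ => ℂ → ℂ) (fun (i : Fin N) x' => kappa (expo lam i) x' y)
          (fun x' => psi0 x' y z) j) x).submatrix Fin.castSucc Fin.castSucc) =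
        Matrix.of fun i j : Fin N => iteratedDeriv (i : ℕ)
          ((fun (i : Fin N) x' => kappa (expo lam i) x' y) j) x := by
      ext i j
      simp
    rw [this, kappaWr, wronskian]
    congr 1
    rw [Finset.sum_range, Finset.sum_mul]
    refine Finset.sum_congr rfl fun i _ => ?_
    simp only [Matrix.of_apply, Fin.snoc_last, iteratedDeriv_psi0, mul_assoc]
  · intro j
    have h1 := h0 j
    rw [Finset.sum_range] at h1
    simp only [Matrix.of_apply, Fin.snoc_castSucc, iteratedDeriv_kappa]
    rw [← mul_zero ((expo lam j).factorial : ℂ), ← h1, Finset.mul_sum]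
    exact Finset.sum_congr rfl fun i _ => by ring

theorem expo_strictAnti {lam : Fin N → ℕ} (hanti : Antitone lam) : StrictAnti (expo lam) := by
  intro i j hij
  have := hanti hij.le
  have h1 := i.2
  have h2 := j.2
  have h3 : (i : ℕ) < j := hij
  simp only [expo]
  omega

/-- At `y = 0` the `κ_m` are the monomials `x^m`. Multiplying row `i` by `x^i` pulls `x^{m_j}` out
of column `j` and leaves falling factorials, whose determinant is the Vandermonde determinant of the
distinct exponents. -/
theorem kappaWr_zero_ne_zero {lam : Fin N → ℕ} (hanti : Antitone lam) {x : ℂ} (hx : x ≠ 0) :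
    kappaWr lam x 0 ≠ 0 := by
  have h1 : (Matrix.of fun i j : Fin N => x ^ (i : ℕ) * (Matrix.of fun i j : Fin N =>
      ((expo lam j).factorial : ℂ) * He 0 ((expo lam j : ℤ) - (i : ℕ)) x) i j) =
      Matrix.of fun i j : Fin N => x ^ (expo lam j) * (Matrix.of fun j i : Fin N =>
        (descPochhammer ℂ i).eval (expo lam j : ℂ))ᵀ i j := by
    ext i j
    simp only [Matrix.of_apply, Matrix.transpose_apply]
    rw [descPochhammer_eval_eq_descFactorial]
    rcases le_or_gt (i : ℕ) (expo lam j) with hij | hij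
    · have h2 : ((expo lam j : ℤ) - (i : ℕ)) = ((expo lam j - i : ℕ) : ℤ) := by omega
      have h3 : x ^ (expo lam j) = x ^ (i : ℕ) * x ^ (expo lam j - i) := by
        rw [← pow_add, Nat.add_sub_cancel' hij]
      have h4 := Nat.factorial_mul_descFactorial hij
      have h5 : (((expo lam j - i).factorial : ℕ) : ℂ) ≠ 0 :=
        Nat.cast_ne_zero.2 (Nat.factorial_ne_zero _)
      rw [h2, He_zero_left, h3, ← h4]
      push_cast
      field_simp
    · rw [He_of_neg (by omega), Nat.descFactorial_eq_zero_iff_lt.2 hij]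
      simp
  have h2 := congrArg Matrix.det h1
  rw [Matrix.det_mul_column, Matrix.det_mul_row, Matrix.det_transpose,
    ← Matrix.det_eval_matrixOfPolynomials_eq_det_vandermonde (fun j : Fin N => (expo lam j : ℂ))
      (fun i : Fin N => descPochhammer ℂ i) (fun i => descPochhammer_natDegree ℂ i)
      (fun i => monic_descPochhammer ℂ i), ← kappaWr_eq_det] at h2
  intro h3
  rw [h3, mul_zero] at h2
  have h4 : (Matrix.vandermonde fun j : Fin N => (expo lam j : ℂ)).det ≠ 0 :=
    Matrix.det_vandermonde_ne_zero_iff.2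
      (Nat.cast_injective.comp (expo_strictAnti hanti).injective)
  exact mul_ne_zero (Finset.prod_ne_zero_iff.2 fun j _ => pow_ne_zero _ hx) h4 h2.symm

end Wronskian

namespace CM

variable {N : ℕ}

/-! ### Moments of Calogero-Moser matrices -/

/-- The pairing `aᵀ W b` of a matrix with the vectors of `𝒳`. -/
def pair (𝒳 : CM N) (W : Matrix (Fin N) (Fin N) ℂ) : ℂ := 𝒳.a ⬝ᵥ (W *ᵥ 𝒳.b)

theorem pair_add (𝒳 : CM N) (V W : Matrix (Fin N) (Fin N) ℂ) :
    𝒳.pair (V + W) = 𝒳.pair V + 𝒳.pair W := by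
  rw [pair, Matrix.add_mulVec, dotProduct_add, pair, pair]

theorem pair_sub (𝒳 : CM N) (V W : Matrix (Fin N) (Fin N) ℂ) :
    𝒳.pair (V - W) = 𝒳.pair V - 𝒳.pair W := by
  rw [pair, Matrix.sub_mulVec, dotProduct_sub, pair, pair]

theorem pair_smul (𝒳 : CM N) (c : ℂ) (W : Matrix (Fin N) (Fin N) ℂ) :
    𝒳.pair (c • W) = c * 𝒳.pair W := by
  rw [pair, Matrix.smul_mulVec, dotProduct_smul, pair, smul_eq_mul]

theorem pair_sum (𝒳 : CM N) {ι : Type*} (s : Finset ι) (W : ι → Matrix (Fin N) (Fin N) ℂ) :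
    𝒳.pair (∑ i ∈ s, W i) = ∑ i ∈ s, 𝒳.pair (W i) := by
  simp only [pair, Matrix.sum_mulVec, dotProduct_sum]

theorem pair_zero (𝒳 : CM N) : 𝒳.pair 0 = 0 := by simp [pair]

theorem pair_mul_rank_one_mul (𝒳 : CM N) (V W : Matrix (Fin N) (Fin N) ℂ) :
    𝒳.pair (V * Matrix.vecMulVec 𝒳.b 𝒳.a * W) = 𝒳.pair V * 𝒳.pair W := by
  rw [pair, ← Matrix.mulVec_mulVec, ← Matrix.mulVec_mulVec, Matrix.vecMulVec_mulVec,
    Matrix.mulVec_smul, dotProduct_smul]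
  simp [pair]

theorem pair_mul_commutator_mul (𝒳 : CM N) (V W : Matrix (Fin N) (Fin N) ℂ) :
    𝒳.pair (V * (𝒳.X * 𝒳.Z) * W) = 𝒳.pair (V * (𝒳.Z * 𝒳.X) * W) + 𝒳.pair (V * W) +
      𝒳.pair V * 𝒳.pair W := by
  have h : 𝒳.X * 𝒳.Z = 𝒳.Z * 𝒳.X + 1 + Matrix.vecMulVec 𝒳.b 𝒳.a := by
    rw [← 𝒳.rank_one]; abel
  rw [h, mul_add, mul_add, add_mul, add_mul, mul_one, pair_add, pair_add, pair_mul_rank_one_mul]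

theorem pair_flat_transpose (𝒳 : CM N) (W : Matrix (Fin N) (Fin N) ℂ) :
    𝒳.flat.pair Wᵀ = 𝒳.pair W := by
  rw [pair, pair, flat, Matrix.mulVec_transpose, dotProduct_comm, ← Matrix.dotProduct_mulVec]

/-- All the moments `aᵀ X^p Z^q b` with `p ≠ q` vanish. -/
def Balanced (𝒳 : CM N) : Prop := ∀ p q : ℕ, p ≠ q → 𝒳.pair (𝒳.X ^ p * 𝒳.Z ^ q) = 0

theorem pair_flat_pow (𝒳 : CM N) (p q : ℕ) :
    𝒳.flat.pair (𝒳.flat.X ^ p * 𝒳.flat.Z ^ q) = 𝒳.pair (𝒳.X ^ q * 𝒳.Z ^ p) := by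
  rw [← pair_flat_transpose, Matrix.transpose_mul, Matrix.transpose_pow, Matrix.transpose_pow]
  rfl

theorem Balanced.flat {𝒳 : CM N} (h : 𝒳.Balanced) : 𝒳.flat.Balanced := fun p q hpq => by
  rw [pair_flat_pow, h q p hpq.symm]

/-- Multiply the rank one relation by `Z^n` and take traces; `Z^n [X, Z]` has trace zero. -/
theorem trace_pow (𝒳 : CM N) (n : ℕ) : (𝒳.Z ^ n).trace = -𝒳.pair (𝒳.Z ^ n) := by
  have h1 : (𝒳.Z ^ n * Matrix.vecMulVec 𝒳.b 𝒳.a).trace = 𝒳.pair (𝒳.Z ^ n) := by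
    rw [Matrix.mul_vecMulVec, Matrix.trace_vecMulVec, pair, dotProduct_comm]
  have h2 : (𝒳.Z ^ n * (𝒳.X * 𝒳.Z)).trace = (𝒳.Z ^ n * (𝒳.Z * 𝒳.X)).trace := by
    rw [← mul_assoc, Matrix.trace_mul_comm, ← mul_assoc, ← mul_assoc, ← pow_succ', pow_succ]
  rw [← h1, ← 𝒳.rank_one, mul_sub, mul_sub, Matrix.trace_sub, Matrix.trace_sub, h2, mul_one]
  ring

theorem Balanced.isNilpotent_Z {𝒳 : CM N} (h : 𝒳.Balanced) : IsNilpotent 𝒳.Z := by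
  refine isNilpotent_of_trace_pow_eq_zero fun n hn => ?_
  have := h 0 n (by omega)
  rw [pow_zero, one_mul] at this
  rw [trace_pow, this, neg_zero]

theorem Balanced.isNilpotent_X {𝒳 : CM N} (h : 𝒳.Balanced) : IsNilpotent 𝒳.X := by
  have := h.flat.isNilpotent_Z
  obtain ⟨k, hk⟩ := this
  refine ⟨k, Matrix.transpose_injective ?_⟩
  rw [Matrix.transpose_pow, Matrix.transpose_zero]
  exact hk

theorem Balanced.Z_pow {𝒳 : CM N} (h : 𝒳.Balanced) : 𝒳.Z ^ N = 0 :=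
  pow_eq_zero_of_isNilpotent h.isNilpotent_Z

theorem Balanced.X_pow {𝒳 : CM N} (h : 𝒳.Balanced) : 𝒳.X ^ N = 0 :=
  pow_eq_zero_of_isNilpotent h.isNilpotent_X

/-! ### Words in the two matrices -/

/-- The product of the matrices `X` (for `true`) and `Z` (for `false`) along a word. -/
def word (𝒳 : CM N) (l : List Bool) : Matrix (Fin N) (Fin N) ℂ :=
  (l.map fun c => if c then 𝒳.X else 𝒳.Z).prod

theorem word_append (𝒳 : CM N) (l l' : List Bool) : 𝒳.word (l ++ l') = 𝒳.word l * 𝒳.word l' := by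
  simp [word]

theorem word_singleton (𝒳 : CM N) (c : Bool) : 𝒳.word [c] = if c then 𝒳.X else 𝒳.Z := by
  simp [word]

theorem pair_word_swap (𝒳 : CM N) (u v : List Bool) :
    𝒳.pair (𝒳.word (u ++ (true :: false :: v))) =
      𝒳.pair (𝒳.word (u ++ (false :: true :: v))) + 𝒳.pair (𝒳.word (u ++ v)) +
        𝒳.pair (𝒳.word u) * 𝒳.pair (𝒳.word v) := by
  have h := pair_mul_commutator_mul 𝒳 (𝒳.word u) (𝒳.word v)
  have e1 : 𝒳.word (true :: false :: v) = 𝒳.X * 𝒳.Z * 𝒳.word v := by simp [word, mul_assoc]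
  have e2 : 𝒳.word (false :: true :: v) = 𝒳.Z * 𝒳.X * 𝒳.word v := by simp [word, mul_assoc]
  simp only [word_append, e1, e2]
  simpa only [mul_assoc] using h

/-- Exchanging two adjacent letters changes the pairing only by pairings of shorter words, for which
the equality is known by induction. So sorting the letters preserves the difference of the two
sides. -/
theorem pair_word_eq {𝒳 𝒴 : CM N}
    (h : ∀ p q : ℕ, 𝒳.pair (𝒳.X ^ p * 𝒳.Z ^ q) = 𝒴.pair (𝒴.X ^ p * 𝒴.Z ^ q)) (l : List Bool) :
    𝒳.pair (𝒳.word l) = 𝒴.pair (𝒴.word l) := by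
  suffices H : ∀ n : ℕ, ∀ l : List Bool, l.length = n →
      𝒳.pair (𝒳.word l) = 𝒴.pair (𝒴.word l) from H _ l rfl
  intro n
  induction n using Nat.strong_induction_on with
  | _ n ih =>
    -- The prefix `u` is quantified because the `cons` case of the permutation induction moves the
    -- common head letter into it.
    have hperm : ∀ l₁ l₂ : List Bool, l₁.Perm l₂ → ∀ u : List Bool, (u ++ l₁).length = n →
        𝒳.pair (𝒳.word (u ++ l₁)) - 𝒴.pair (𝒴.word (u ++ l₁)) =
          𝒳.pair (𝒳.word (u ++ l₂)) - 𝒴.pair (𝒴.word (u ++ l₂)) := by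
      intro l₁ l₂ hl
      induction hl with
      | nil => exact fun _ _ => rfl
      | cons x _ ihl =>
        intro u hu
        have := ihl (u ++ [x]) (by simpa using hu)
        simpa using this
      | swap x y v =>
        intro u hu
        simp only [List.length_append, List.length_cons] at hu
        have h1 := ih (u ++ v).length (by simp; omega) _ rfl
        have h2 := ih u.length (by omega) _ rfl
        have h3 := ih v.length (by omega) _ rfl
        have h4 := pair_word_swap 𝒳 u v
        have h5 := pair_word_swap 𝒴 u v
        cases x <;> cases y
        · rfl
        · rw [h4, h5, h1, h2, h3]; ring
        · rw [h4, h5, h1, h2, h3]; ring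
        · rfl
      | trans h₁₂ _ ih₁ ih₂ =>
        intro u hu
        rw [ih₁ u hu, ih₂ u (by simpa [h₁₂.length_eq] using hu)]
    intro l hl
    have h1 : l.Perm (List.replicate (l.count true) true ++ List.replicate (l.count false) false) :=
      (List.perm_replicate_append_replicate (by decide)).2 ⟨rfl, rfl, fun c _ => by cases c <;> simp⟩
    have h2 := hperm _ _ h1 [] (by simpa using hl)
    have h3 : ∀ 𝒲 : CM N, 𝒲.word (List.replicate (l.count true) true ++
        List.replicate (l.count false) false) = 𝒲.X ^ l.count true * 𝒲.Z ^ l.count false := by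
      intro 𝒲
      simp [word]
    simp only [List.nil_append, h3, h, sub_self] at h2
    exact sub_eq_zero.1 h2

theorem pair_word_mul_pow_eq {𝒳 𝒴 : CM N}
    (h : ∀ p q : ℕ, 𝒳.pair (𝒳.X ^ p * 𝒳.Z ^ q) = 𝒴.pair (𝒴.X ^ p * 𝒴.Z ^ q)) (n : ℕ)
    (u : List Bool) : 𝒳.pair (𝒳.word u * (𝒳.X + 𝒳.Z) ^ n) = 𝒴.pair (𝒴.word u * (𝒴.X + 𝒴.Z) ^ n) := by
  induction n generalizing u with
  | zero => simpa using pair_word_eq h u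
  | succ n ih =>
    have key : ∀ 𝒲 : CM N, 𝒲.pair (𝒲.word u * (𝒲.X + 𝒲.Z) ^ (n + 1)) =
        𝒲.pair (𝒲.word (u ++ [true]) * (𝒲.X + 𝒲.Z) ^ n) +
          𝒲.pair (𝒲.word (u ++ [false]) * (𝒲.X + 𝒲.Z) ^ n) := by
      intro 𝒲
      rw [word_append, word_append, word_singleton, word_singleton, ← pair_add, ← add_mul,
        ← mul_add, pow_succ', ← mul_assoc]
      rfl
    rw [key, key, ih, ih]

theorem pair_pow_mul_aeval_eq {𝒳 𝒴 : CM N}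
    (h : ∀ p q : ℕ, 𝒳.pair (𝒳.X ^ p * 𝒳.Z ^ q) = 𝒴.pair (𝒴.X ^ p * 𝒴.Z ^ q)) (k : ℕ)
    (r : Polynomial ℂ) :
    𝒳.pair (𝒳.X ^ k * Polynomial.aeval (𝒳.X + 𝒳.Z) r) =
      𝒴.pair (𝒴.X ^ k * Polynomial.aeval (𝒴.X + 𝒴.Z) r) := by
  induction r using Polynomial.induction_on' with
  | add p q hp hq => rw [map_add, map_add, mul_add, mul_add, pair_add, pair_add, hp, hq]
  | monomial n c =>
    have hw := pair_word_mul_pow_eq h n (List.replicate k true)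
    simp only [word, List.map_replicate, List.prod_replicate, if_true] at hw
    rw [Polynomial.aeval_monomial, Polynomial.aeval_monomial, ← Algebra.smul_def,
      ← Algebra.smul_def, Matrix.mul_smul, Matrix.mul_smul, pair_smul, pair_smul, hw]

end CM

/-- Divide the characteristic polynomial by `X - x` and apply Cayley–Hamilton. The polynomial that
represents the resolvent depends only on the characteristic polynomial, so it is the same for `M`
and its transpose. -/
theorem inv_sub_eq_aeval {N : ℕ} (M : Matrix (Fin N) (Fin N) ℂ) {x : ℂ}
    (hx : (x • (1 : Matrix (Fin N) (Fin N) ℂ) - M).det ≠ 0) :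
    (x • (1 : Matrix (Fin N) (Fin N) ℂ) - M)⁻¹ = Polynomial.aeval M
      (Polynomial.C (M.charpoly.eval x)⁻¹ * (M.charpoly /ₘ (Polynomial.X - Polynomial.C x))) := by
  have he : M.charpoly.eval x ≠ 0 := by
    rwa [Matrix.eval_charpoly, Matrix.scalar_apply, ← Matrix.smul_one_eq_diagonal]
  have h1 := congrArg (Polynomial.aeval M)
    (Polynomial.modByMonic_add_div M.charpoly (Polynomial.X - Polynomial.C x))
  rw [Matrix.aeval_self_charpoly, Polynomial.modByMonic_X_sub_C_eq_C_eval, map_add, map_mul,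
    map_sub, Polynomial.aeval_X, Polynomial.aeval_C, Polynomial.aeval_C,
    Algebra.algebraMap_eq_smul_one, Algebra.algebraMap_eq_smul_one] at h1
  refine Matrix.inv_eq_right_inv ?_
  rw [map_mul, Polynomial.aeval_C, Algebra.algebraMap_eq_smul_one, Matrix.smul_mul, one_mul,
    Matrix.mul_smul]
  have h2 : (x • (1 : Matrix (Fin N) (Fin N) ℂ) - M) *
      Polynomial.aeval M (M.charpoly /ₘ (Polynomial.X - Polynomial.C x)) =
      M.charpoly.eval x • (1 : Matrix (Fin N) (Fin N) ℂ) := by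
    rw [← neg_sub, neg_mul, eq_comm, ← add_eq_zero_iff_eq_neg]
    exact h1
  rw [h2, smul_smul, inv_mul_cancel₀ he, one_smul]

/-! ### Resolvent moments of `X + Z` -/

namespace CM

variable {N : ℕ}

theorem Xt_eq (𝒳 : CM N) (x y : ℂ) :
    𝒳.Xt x y = x • (1 : Matrix (Fin N) (Fin N) ℂ) - (𝒳.X - (2 * y) • 𝒳.Z) := by
  rw [Xt]; abel

theorem Xt_neg_half (𝒳 : CM N) (x : ℂ) :
    𝒳.Xt x (-1 / 2) = x • (1 : Matrix (Fin N) (Fin N) ℂ) - (𝒳.X + 𝒳.Z) := by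
  have : (2 * (-1 / 2) : ℂ) = -1 := by norm_num
  rw [Xt_eq, this, neg_one_smul, sub_neg_eq_add]

theorem Xt_flat_neg_half (𝒳 : CM N) (x : ℂ) : 𝒳.flat.Xt x (-1 / 2) = (𝒳.Xt x (-1 / 2))ᵀ := by
  rw [Xt_neg_half, Xt_neg_half, Matrix.transpose_sub, Matrix.transpose_smul, Matrix.transpose_one,
    Matrix.transpose_add, add_comm 𝒳.Xᵀ]
  rfl

/-- The resolvent moments `aᵀ X^p (x I - X - Z)⁻¹ Z^q b`. -/
def T (𝒳 : CM N) (p q : ℕ) (x : ℂ) : ℂ :=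
  𝒳.pair (𝒳.X ^ p * (𝒳.Xt x (-1 / 2))⁻¹ * 𝒳.Z ^ q)

theorem T_flat (𝒳 : CM N) (p q : ℕ) (x : ℂ) : 𝒳.flat.T p q x = 𝒳.T q p x := by
  rw [T, T, ← pair_flat_transpose, Matrix.transpose_mul, Matrix.transpose_mul, mul_assoc,
    Matrix.transpose_pow, Matrix.transpose_pow, Matrix.transpose_nonsing_inv, Xt_flat_neg_half]
  rfl

theorem tau_flat (𝒳 : CM N) (x : ℂ) : 𝒳.flat.tau x (-1 / 2) = 𝒳.tau x (-1 / 2) := by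
  rw [tau, Xt_flat_neg_half, Matrix.det_transpose, tau]

/-- The involution exchanges the moments `(p, q)` and `(q, p)`, which are equal for balanced data.
So `𝒳` and `𝒳.flat` pair equally with all words, hence with polynomials in `X + Z`, and the
resolvent is such a polynomial. -/
theorem Balanced.T_zero_right {𝒳 : CM N} (h : 𝒳.Balanced) (k : ℕ) {x : ℂ}
    (hx : 𝒳.tau x (-1 / 2) ≠ 0) : 𝒳.T k 0 x = 𝒳.T 0 k x := by
  have hm : ∀ p q : ℕ, 𝒳.pair (𝒳.X ^ p * 𝒳.Z ^ q) =
      𝒳.flat.pair (𝒳.flat.X ^ p * 𝒳.flat.Z ^ q) := by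
    intro p q
    rw [pair_flat_pow]
    rcases eq_or_ne p q with rfl | hpq
    · rfl
    · rw [h p q hpq, h q p hpq.symm]
  have hx' := hx
  rw [← tau_flat] at hx'
  rw [← T_flat 𝒳 k 0]
  simp only [T, pow_zero, mul_one]
  simp only [tau, Xt_neg_half] at hx hx' ⊢
  rw [inv_sub_eq_aeval _ hx, inv_sub_eq_aeval _ hx', pair_pow_mul_aeval_eq hm]
  have : (𝒳.flat.X + 𝒳.flat.Z) = (𝒳.X + 𝒳.Z)ᵀ := by
    rw [Matrix.transpose_add, add_comm]
    rfl
  rw [this, Matrix.charpoly_transpose]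

/-! ### The normalized wave function for nilpotent `Z` -/

theorem q_eq_pow {𝒳 : CM N} (h : IsNilpotent 𝒳.Z) (z : ℂ) : 𝒳.q z = z ^ N := by
  have h2 := sub_eq_zero.1 (Matrix.isNilpotent_charpoly_sub_pow_of_isNilpotent h).eq_zero
  rw [q, Zt, Matrix.smul_one_eq_diagonal, ← Matrix.scalar_apply, ← Matrix.eval_charpoly, h2]
  simp

theorem adjugate_Zt {𝒳 : CM N} (h : IsNilpotent 𝒳.Z) (z : ℂ) :
    (𝒳.Zt z).adjugate = ∑ q ∈ Finset.range N, z ^ (N - 1 - q) • 𝒳.Z ^ q := by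
  have hc1 : Continuous fun z => (𝒳.Zt z).adjugate :=
    (continuous_resolvent_arg 𝒳.Z).matrix_adjugate
  have hc2 : Continuous fun z : ℂ => ∑ q ∈ Finset.range N, z ^ (N - 1 - q) • 𝒳.Z ^ q :=
    continuous_finsetSum _ fun q _ => (continuous_id.pow _).smul continuous_const
  -- The determinant `z^N` can be cancelled only for `z ≠ 0`; the value at `0` follows by
  -- continuity.
  refine congrFun (hc1.ext_on (dense_compl_singleton (0 : ℂ)) hc2 fun z hz => ?_) z
  have hq : (𝒳.Zt z).det = z ^ N := q_eq_pow h z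
  refine adjugate_eq_of_mul_eq (by rw [hq]; exact pow_ne_zero _ hz) ?_
  rw [hq, Zt, sub_mul_geom_sum, pow_eq_zero_of_isNilpotent h, sub_zero]

theorem hatWave_of_isNilpotent {𝒳 : CM N} (h : IsNilpotent 𝒳.Z) (x y z : ℂ) :
    𝒳.hatWave x y z = (z ^ N + ∑ q ∈ Finset.range N,
      𝒳.pair ((𝒳.Xt x y)⁻¹ * 𝒳.Z ^ q) * z ^ (N - 1 - q)) * psi0 x y z := by
  rw [hatWave, q_eq_pow h, adjugate_Zt h, psi0, Matrix.mulVec_mulVec, Finset.mul_sum]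
  change (_ + 𝒳.pair _) * _ = _
  rw [pair_sum]
  simp only [Matrix.mul_smul, pair_smul]
  simp only [mul_comm]

theorem gHat_of_isNilpotent {𝒳 : CM N} (h : IsNilpotent 𝒳.Z) (n : ℕ) (x : ℂ) :
    𝒳.gHat n x = He (-1 / 2) ((n : ℤ) - N) x + ∑ q ∈ Finset.range N,
      𝒳.T 0 q x * He (-1 / 2) ((n : ℤ) - N + (q + 1)) x := by
  have h1 : 𝒳.gHat n x = tc n (fun z => 𝒳.hatWave x (-1 / 2) z) := rfl
  have hcd : ∀ i : ℕ, ContDiff ℂ ⊤ fun z => (z ^ i * psi0 x (-1 / 2) z) :=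
    fun i => (contDiff_id.pow _).mul (contDiff_psi0 x _)
  have h2 : (fun z => 𝒳.hatWave x (-1 / 2) z) = fun z => z ^ N * psi0 x (-1 / 2) z +
      ∑ q ∈ Finset.range N, 𝒳.T 0 q x * (z ^ (N - 1 - q) * psi0 x (-1 / 2) z) := by
    funext z
    rw [hatWave_of_isNilpotent h, add_mul, Finset.sum_mul]
    simp only [T, pow_zero, one_mul, mul_assoc]
  rw [h1, h2, tc_add _ (hcd N) (ContDiff.sum fun q _ => contDiff_const.mul (hcd _)),
    tc_sum _ _ fun q _ => contDiff_const.mul (hcd _), tc_pow_mul_psi0]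
  congr 1
  refine Finset.sum_congr rfl fun q hq => ?_
  have := Finset.mem_range.1 hq
  rw [tc_const_mul, tc_pow_mul_psi0]
  congr 2
  omega

theorem Balanced.fHat_eq {𝒳 : CM N} (h : 𝒳.Balanced) (n : ℕ) (x : ℂ) :
    𝒳.fHat n x = He (-1 / 2) ((n : ℤ) - N) x + ∑ p ∈ Finset.range N,
      𝒳.T p 0 x * He (-1 / 2) ((n : ℤ) - N + (p + 1)) x := by
  have h1 : 𝒳.fHat n x = 𝒳.flat.gHat n x := rfl
  rw [h1, gHat_of_isNilpotent h.flat.isNilpotent_Z]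
  simp only [T_flat]

theorem Balanced.fHat_eq_gHat {𝒳 : CM N} (h : 𝒳.Balanced) (n : ℕ) {x : ℂ}
    (hx : 𝒳.tau x (-1 / 2) ≠ 0) : 𝒳.fHat n x = 𝒳.gHat n x := by
  rw [h.fHat_eq, gHat_of_isNilpotent h.isNilpotent_Z]
  simp only [h.T_zero_right _ hx]

/-! ### The doubly normalized wave function -/

theorem det_X_smul_sub_map {A : Matrix (Fin N) (Fin N) ℂ} (h : IsNilpotent A)
    (k : Fin 2) :
    ((MvPolynomial.X k : MvPolynomial (Fin 2) ℂ) • 1 - A.map (MvPolynomial.C (σ := Fin 2))).det =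
      (MvPolynomial.X k : MvPolynomial (Fin 2) ℂ) ^ N := by
  have h2 := sub_eq_zero.1 (Matrix.isNilpotent_charpoly_sub_pow_of_isNilpotent h).eq_zero
  have h3 := Matrix.charpoly_map A (MvPolynomial.C : ℂ →+* MvPolynomial (Fin 2) ℂ)
  rw [Matrix.smul_one_eq_diagonal, ← Matrix.scalar_apply, ← Matrix.eval_charpoly, h3, h2]
  simp

theorem adjugate_X_smul_sub_map {A : Matrix (Fin N) (Fin N) ℂ} (h : IsNilpotent A)
    (k : Fin 2) :
    ((MvPolynomial.X k : MvPolynomial (Fin 2) ℂ) • 1 - A.map (MvPolynomial.C (σ := Fin 2))).adjugate =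
      ∑ p ∈ Finset.range N, (MvPolynomial.X k : MvPolynomial (Fin 2) ℂ) ^ (N - 1 - p) •
        (A ^ p).map MvPolynomial.C := by
  have hd := det_X_smul_sub_map h k
  have hp : ∀ p, (A.map (MvPolynomial.C : ℂ →+* MvPolynomial (Fin 2) ℂ)) ^ p =
      (A ^ p).map MvPolynomial.C := fun p =>
    (map_pow (MvPolynomial.C : ℂ →+* MvPolynomial (Fin 2) ℂ).mapMatrix A p).symm
  refine adjugate_eq_of_mul_eq (by rw [hd]; exact pow_ne_zero _ (MvPolynomial.X_ne_zero k)) ?_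
  rw [hd]
  have := sub_mul_geom_sum (A.map (MvPolynomial.C : ℂ →+* MvPolynomial (Fin 2) ℂ))
    (MvPolynomial.X k) N
  simp only [hp] at this
  rw [this, pow_eq_zero_of_isNilpotent h]
  simp

/-- Both adjugates are finite geometric sums, so the coefficients are moments; balance leaves only
the diagonal `p = q`. -/
theorem Balanced.normPoly_eq {𝒳 : CM N} (h : 𝒳.Balanced) :
    𝒳.normPoly = (MvPolynomial.X 0 * MvPolynomial.X 1) ^ N + ∑ p ∈ Finset.range N,
      MvPolynomial.C (𝒳.pair (𝒳.X ^ p * 𝒳.Z ^ p)) *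
        (MvPolynomial.X 0 * MvPolynomial.X 1) ^ (N - 1 - p) := by
  have hC : ∀ W : Matrix (Fin N) (Fin N) ℂ,
      (fun i => (MvPolynomial.C (𝒳.a i) : MvPolynomial (Fin 2) ℂ)) ⬝ᵥ
        (W.map MvPolynomial.C *ᵥ fun i => MvPolynomial.C (𝒳.b i)) = MvPolynomial.C (𝒳.pair W) := by
    intro W
    simp [pair, dotProduct, Matrix.mulVec, map_sum]
  have hmul : ∀ V W : Matrix (Fin N) (Fin N) ℂ,
      (V.map (MvPolynomial.C : ℂ →+* MvPolynomial (Fin 2) ℂ)) * W.map MvPolynomial.C =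
        (V * W).map MvPolynomial.C := fun V W =>
    (map_mul (MvPolynomial.C : ℂ →+* MvPolynomial (Fin 2) ℂ).mapMatrix V W).symm
  rw [normPoly]
  rw [det_X_smul_sub_map h.isNilpotent_X, det_X_smul_sub_map h.isNilpotent_Z,
    adjugate_X_smul_sub_map h.isNilpotent_X, adjugate_X_smul_sub_map h.isNilpotent_Z, mul_pow,
    Matrix.mulVec_mulVec, Finset.sum_mul_sum]
  congr 1
  simp only [Matrix.smul_mul, Matrix.mul_smul, hmul, Matrix.sum_mulVec, dotProduct_sum,
    Matrix.smul_mulVec, dotProduct_smul, hC, smul_eq_mul]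
  refine Finset.sum_congr rfl fun p hp => ?_
  rw [Finset.sum_eq_single_of_mem p hp]
  · ring
  · intro q _ hq
    rw [h p q hq.symm]
    simp

theorem coeff_X_mul_X_pow (k : ℕ) (s : Fin 2 →₀ ℕ) :
    MvPolynomial.coeff s ((MvPolynomial.X 0 * MvPolynomial.X 1 : MvPolynomial (Fin 2) ℂ) ^ k) =
      if s 0 = k ∧ s 1 = k then 1 else 0 := by
  have h1 : (MvPolynomial.X 0 * MvPolynomial.X 1 : MvPolynomial (Fin 2) ℂ) ^ k =
      MvPolynomial.monomial (Finsupp.single 0 k + Finsupp.single 1 k) 1 := by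
    rw [mul_pow, MvPolynomial.X_pow_eq_monomial, MvPolynomial.X_pow_eq_monomial,
      MvPolynomial.monomial_mul, one_mul]
  rw [h1, MvPolynomial.coeff_monomial]
  congr 1
  rw [Finsupp.ext_iff, Fin.forall_fin_two]
  simp [eq_comm]

theorem Balanced.B_eq {𝒳 : CM N} (h : 𝒳.Balanced) : 𝒳.B = {0} := by
  have hs : ∀ s : Fin 2 →₀ ℕ, MvPolynomial.coeff s 𝒳.normPoly =
      (if s 0 = N ∧ s 1 = N then 1 else 0) + ∑ p ∈ Finset.range N,
        𝒳.pair (𝒳.X ^ p * 𝒳.Z ^ p) * if s 0 = N - 1 - p ∧ s 1 = N - 1 - p then 1 else 0 := by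
    intro s
    rw [h.normPoly_eq, MvPolynomial.coeff_add, MvPolynomial.coeff_sum]
    simp only [MvPolynomial.coeff_C_mul, coeff_X_mul_X_pow]
  ext d
  constructor
  · rintro ⟨s, hc, rfl⟩
    by_contra hd
    have hne : s 0 ≠ s 1 := fun e => hd (by simp [e])
    refine hc ?_
    rw [hs, if_neg (fun e => hne (e.1.trans e.2.symm)), zero_add]
    refine Finset.sum_eq_zero fun p _ => ?_
    rw [if_neg (fun e => hne (e.1.trans e.2.symm)), mul_zero]
  -- The monomial `(xz)^N` has coefficient `1`, since all other terms have lower degree; this shows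
  -- that the set is not empty.
  · rintro rfl
    refine ⟨Finsupp.single 0 N + Finsupp.single 1 N, ?_, by simp⟩
    rw [hs, Finset.sum_eq_zero]
    · simp
    · intro p hp
      have := Finset.mem_range.1 hp
      rw [if_neg, mul_zero]
      rintro ⟨h0, -⟩
      simp at h0
      omega

end CM

/-! ### Cauchy matrices -/

section Cauchy

variable {R : Type}

/-- The Cauchy matrix `1 / (α_i + β_l + 1)`. -/
def cauchy (α β : R → ℕ) : Matrix R R ℂ :=
  Matrix.of fun l i => ((α i : ℂ) + β l + 1)⁻¹

theorem cauchy_mul (α β : R → ℕ) (l i : R) : ((α i : ℂ) + β l + 1) * cauchy α β l i = 1 := by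
  have h : (α i : ℂ) + β l + 1 ≠ 0 := by exact_mod_cast (Nat.succ_ne_zero (α i + β l))
  exact mul_inv_cancel₀ h

variable [Fintype R] [DecidableEq R]

/-- Clearing denominators in a kernel vector `v` gives a polynomial `P` of degree below `|R|` that
vanishes at the distinct points `β_l + 1`. So `P = 0`, and its value at `-α_i` is `v_i` times a
nonzero product. -/
theorem det_cauchy_ne_zero {α β : R → ℕ} (hα : Function.Injective α)
    (hβ : Function.Injective β) : (cauchy α β).det ≠ 0 := by
  intro h
  obtain ⟨v, hv, h0⟩ := Matrix.exists_mulVec_eq_zero_iff.2 h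
  set P : Polynomial ℂ := ∑ i, Polynomial.C (v i) *
    ∏ i' ∈ Finset.univ.erase i, (Polynomial.X + Polynomial.C (α i' : ℂ)) with hP
  have heval : ∀ t : ℂ, P.eval t = ∑ i, v i * ∏ i' ∈ Finset.univ.erase i, (t + α i') := by
    intro t
    simp [hP, Polynomial.eval_finsetSum, Polynomial.eval_prod]
  have hroot : ∀ l, P.eval ((β l : ℂ) + 1) = 0 := by
    intro l
    have h1 := congrFun h0 l
    simp only [Matrix.mulVec, dotProduct, Pi.zero_apply] at h1
    have h2 : P.eval ((β l : ℂ) + 1) =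
        (∏ i', ((β l : ℂ) + 1 + α i')) * ∑ i, cauchy α β l i * v i := by
      rw [heval, Finset.mul_sum]
      refine Finset.sum_congr rfl fun i _ => ?_
      rw [← Finset.mul_prod_erase _ _ (Finset.mem_univ i)]
      linear_combination (-(v i) * ∏ i' ∈ Finset.univ.erase i, ((β l : ℂ) + 1 + α i')) *
        cauchy_mul α β l i
    rw [h2, h1, mul_zero]
  have hR : Nonempty R := by
    by_contra hne
    rw [not_nonempty_iff] at hne
    exact hv (Subsingleton.elim _ _)
  have hdeg : P.natDegree < Fintype.card R := by
    have h1 : P.natDegree ≤ Fintype.card R - 1 := by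
      refine Polynomial.natDegree_sum_le_of_forall_le _ _ fun i _ => ?_
      refine (Polynomial.natDegree_C_mul_le _ _).trans ((Polynomial.natDegree_prod_le _ _).trans ?_)
      simp only [Polynomial.natDegree_X_add_C]
      simp
    have := Fintype.card_pos (α := R)
    omega
  have hP0 : P = 0 := Polynomial.eq_zero_of_natDegree_lt_card_of_eval_eq_zero P
    (f := fun l => (β l : ℂ) + 1)
    (fun l l' hl => hβ (Nat.cast_injective (R := ℂ) (add_right_cancel hl))) hroot hdeg
  refine hv (funext fun i => ?_)
  have h3 := heval (-(α i : ℂ))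
  rw [hP0, Polynomial.eval_zero, Finset.sum_eq_single i] at h3
  · refine (mul_eq_zero.1 h3.symm).resolve_right (Finset.prod_ne_zero_iff.2 fun i' hi' => ?_)
    intro h4
    have h5 : (α i' : ℂ) = α i := by linear_combination h4
    exact (Finset.ne_of_mem_erase hi') (hα (Nat.cast_injective h5))
  · intro i' _ hi'
    rw [Finset.prod_eq_zero (Finset.mem_erase.2 ⟨hi'.symm, Finset.mem_univ i⟩) (by ring), mul_zero]
  · simp

end Cauchy

/-! ### A graded model with prescribed hooks -/

section Model

variable {N : ℕ} {R : Type} {α β : R → ℕ}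
  (e : Fin N ≃ (Σ i : R, Fin (α i + 1)) ⊕ (Σ l : R, Fin (β l)))

/-- The coordinate of degree `j - α_i` in the `i`-th arm. -/
def arm (i : R) (j : ℕ) : (Fin N → ℂ) →ₗ[ℂ] ℂ :=
  if h : j < α i + 1 then LinearMap.proj (e.symm (Sum.inl ⟨i, ⟨j, h⟩⟩)) else 0

/-- The coordinate of degree `k + 1` in the `l`-th leg. -/
def leg (l : R) (k : ℕ) : (Fin N → ℂ) →ₗ[ℂ] ℂ :=
  if h : k < β l then LinearMap.proj (e.symm (Sum.inr ⟨l, ⟨k, h⟩⟩)) else 0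

/-- The element of a family indexed by arms and legs at a given index. -/
def glue {M : Type} (u w : R → ℕ → M) (n : Fin N) : M :=
  Sum.elim (fun p : (Σ i : R, Fin (α i + 1)) => u p.1 p.2)
    (fun p : (Σ l : R, Fin (β l)) => w p.1 p.2) (e n)

theorem arm_glue (u w : R → ℕ → ℂ) (i : R) (j : ℕ) :
    arm e i j (glue e u w) = if j < α i + 1 then u i j else 0 := by
  unfold arm
  split_ifs with h
  · simp [glue]
  · rfl

theorem leg_glue (u w : R → ℕ → ℂ) (l : R) (k : ℕ) :
    leg e l k (glue e u w) = if k < β l then w l k else 0 := by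
  unfold leg
  split_ifs with h
  · simp [glue]
  · rfl

theorem arm_of_lt {i : R} {j : ℕ} (h : α i < j) (v : Fin N → ℂ) : arm e i j v = 0 := by
  rw [arm, dif_neg (by omega), LinearMap.zero_apply]

theorem leg_of_le {l : R} {k : ℕ} (h : β l ≤ k) (v : Fin N → ℂ) : leg e l k v = 0 := by
  rw [leg, dif_neg (by omega), LinearMap.zero_apply]

theorem ext_arm_leg {v v' : Fin N → ℂ} (h1 : ∀ i j, j ≤ α i → arm e i j v = arm e i j v')
    (h2 : ∀ l k, k < β l → leg e l k v = leg e l k v') : v = v' := by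
  funext n
  obtain ⟨p, rfl⟩ := e.symm.surjective n
  rcases p with ⟨i, j, hj⟩ | ⟨l, k, hk⟩
  · have := h1 i j (Nat.lt_succ_iff.1 hj)
    simpa only [arm, dif_pos hj, LinearMap.proj_apply] using this
  · have := h2 l k hk
    simpa only [leg, dif_pos hk, LinearMap.proj_apply] using this

/-- The linear map with prescribed components. -/
def glueL (u w : R → ℕ → ((Fin N → ℂ) →ₗ[ℂ] ℂ)) : (Fin N → ℂ) →ₗ[ℂ] (Fin N → ℂ) :=
  LinearMap.pi (glue e u w)

theorem glueL_apply (u w : R → ℕ → ((Fin N → ℂ) →ₗ[ℂ] ℂ)) (v : Fin N → ℂ) :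
    glueL e u w v = glue e (fun i j => u i j v) (fun l k => w l k v) := by
  funext n
  simp only [glueL, LinearMap.pi_apply, glue]
  rcases e n with p | p <;> rfl

/-- The grading operator of the model. -/
def modelD : (Fin N → ℂ) →ₗ[ℂ] (Fin N → ℂ) :=
  glueL e (fun i j => ((j : ℂ) - α i) • arm e i j) (fun l k => ((k : ℂ) + 1) • leg e l k)

theorem arm_modelD (v : Fin N → ℂ) (i : R) (j : ℕ) :
    arm e i j (modelD e v) = ((j : ℂ) - α i) * arm e i j v := by
  rw [modelD, glueL_apply, arm_glue]
  split_ifs with h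
  · simp
  · rw [arm_of_lt e (by omega), mul_zero]

theorem leg_modelD (v : Fin N → ℂ) (l : R) (k : ℕ) :
    leg e l k (modelD e v) = ((k : ℂ) + 1) * leg e l k v := by
  rw [modelD, glueL_apply, leg_glue]
  split_ifs with h
  · simp
  · rw [leg_of_le e (by omega), mul_zero]

variable [Fintype R]

/-- The operator `Z` of the model. -/
def modelZ : (Fin N → ℂ) →ₗ[ℂ] (Fin N → ℂ) :=
  glueL e (fun i j => if j = 0 then 0 else arm e i (j - 1))
    (fun l k => if k = 0 then ∑ i, cauchy α β l i • arm e i (α i) else leg e l (k - 1))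

theorem arm_modelZ_succ (v : Fin N → ℂ) {i : R} {j : ℕ} (h : j + 1 ≤ α i) :
    arm e i (j + 1) (modelZ e v) = arm e i j v := by
  rw [modelZ, glueL_apply, arm_glue, if_pos (by omega), if_neg (by omega), Nat.add_sub_cancel]

theorem arm_modelZ_zero (v : Fin N → ℂ) (i : R) : arm e i 0 (modelZ e v) = 0 := by
  rw [modelZ, glueL_apply, arm_glue, if_pos (by omega), if_pos rfl, LinearMap.zero_apply]

theorem leg_modelZ_succ (v : Fin N → ℂ) {l : R} {k : ℕ} (h : k + 1 < β l) :
    leg e l (k + 1) (modelZ e v) = leg e l k v := by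
  rw [modelZ, glueL_apply, leg_glue, if_pos h, if_neg (by omega), Nat.add_sub_cancel]

theorem leg_modelZ_zero (v : Fin N → ℂ) {l : R} (h : 0 < β l) :
    leg e l 0 (modelZ e v) = ∑ i, cauchy α β l i * arm e i (α i) v := by
  rw [modelZ, glueL_apply, leg_glue, if_pos h, if_pos rfl]
  simp

/-- The covector of the model. -/
def modelA : (Fin N → ℂ) →ₗ[ℂ] ℂ := -∑ i, arm e i (α i)

theorem modelA_apply (v : Fin N → ℂ) : modelA e v = -∑ i, arm e i (α i) v := by
  simp [modelA]

theorem modelD_modelZ (v : Fin N → ℂ) :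
    modelD e (modelZ e v) = modelZ e (modelD e v) + modelZ e v := by
  refine ext_arm_leg e (fun i j hj => ?_) (fun l k hk => ?_)
  · rw [map_add, arm_modelD]
    rcases j with _ | j
    · rw [arm_modelZ_zero, arm_modelZ_zero]
      simp
    · rw [arm_modelZ_succ e _ hj, arm_modelZ_succ e _ hj, arm_modelD]
      push_cast
      ring
  · rw [map_add, leg_modelD]
    rcases k with _ | k
    · rw [leg_modelZ_zero e _ hk, leg_modelZ_zero e _ hk]
      simp [arm_modelD]
    · rw [leg_modelZ_succ e _ hk, leg_modelZ_succ e _ hk, leg_modelD]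
      push_cast
      ring

theorem modelA_modelD (v : Fin N → ℂ) : modelA e (modelD e v) = 0 := by
  simp [modelA_apply, arm_modelD]

variable [DecidableEq R]

/-- The operator `X` of the model. -/
def modelX : (Fin N → ℂ) →ₗ[ℂ] (Fin N → ℂ) :=
  glueL e (fun i j => ((j : ℂ) + 1) • arm e i (j + 1) +
      if j = α i then ∑ l, (-(β l : ℂ) * (cauchy α β)⁻¹ i l) • leg e l 0 else 0)
    (fun l k => ((k : ℂ) + 1 - β l) • leg e l (k + 1))

/-- The vector of the model. -/
def modelB : Fin N → ℂ :=
  glue e (fun i j => if j = α i then ∑ l, (cauchy α β)⁻¹ i l else 0) 0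

theorem arm_modelX_of_lt (v : Fin N → ℂ) {i : R} {j : ℕ} (h : j < α i) :
    arm e i j (modelX e v) = ((j : ℂ) + 1) * arm e i (j + 1) v := by
  rw [modelX, glueL_apply, arm_glue, if_pos (by omega), if_neg (by omega)]
  simp

theorem arm_modelX_self (v : Fin N → ℂ) (i : R) :
    arm e i (α i) (modelX e v) = ∑ l, -(β l : ℂ) * (cauchy α β)⁻¹ i l * leg e l 0 v := by
  rw [modelX, glueL_apply, arm_glue, if_pos (by omega), if_pos rfl, LinearMap.add_apply,
    LinearMap.smul_apply, arm_of_lt e (by omega)]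
  simp

theorem leg_modelX (v : Fin N → ℂ) {l : R} {k : ℕ} (h : k < β l) :
    leg e l k (modelX e v) = ((k : ℂ) + 1 - β l) * leg e l (k + 1) v := by
  rw [modelX, glueL_apply, leg_glue, if_pos h]
  simp

theorem arm_modelB (i : R) {j : ℕ} (h : j ≤ α i) :
    arm e i j (modelB e) = if j = α i then ∑ l, (cauchy α β)⁻¹ i l else 0 := by
  rw [modelB, arm_glue, if_pos (by omega)]

theorem leg_modelB (l : R) (k : ℕ) : leg e l k (modelB e) = 0 := by
  rw [modelB, leg_glue]
  simp

/-- `Z` runs along each arm up to degree `0` and then crosses into all legs through the Cauchy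
matrix; `X` runs back with integer weights. Along the chains these weights give `[X, Z] = 1`, so
only the arm ends can contribute to the rank one defect. -/
theorem model_commutator (hα : Function.Injective α) (hβ : Function.Injective β) (v : Fin N → ℂ) :
    modelX e (modelZ e v) - modelZ e (modelX e v) - v = modelA e v • modelB e := by
  have hC := Matrix.nonsing_inv_mul _ (isUnit_iff_ne_zero.2 (det_cauchy_ne_zero hα hβ))
  have hC' := Matrix.mul_nonsing_inv _ (isUnit_iff_ne_zero.2 (det_cauchy_ne_zero hα hβ))
  -- This is where the Cauchy form is needed: `(α + β + 1) C = 1` entrywise makes `C⁻¹ diag(β) C` a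
  -- diagonal matrix plus one of rank one.
  have key : ∀ i i', ∑ l, (β l : ℂ) * (cauchy α β)⁻¹ i l * cauchy α β l i' =
      (∑ l, (cauchy α β)⁻¹ i l) - if i = i' then (α i' : ℂ) + 1 else 0 := by
    intro i i'
    have h1 : ∑ l, (cauchy α β)⁻¹ i l * cauchy α β l i' = if i = i' then 1 else 0 := by
      rw [← Matrix.mul_apply, hC, Matrix.one_apply]
    have h2 : (if i = i' then (α i' : ℂ) + 1 else 0) =
        ∑ l, ((α i' : ℂ) + 1) * ((cauchy α β)⁻¹ i l * cauchy α β l i') := by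
      rw [← Finset.mul_sum, h1]
      split_ifs <;> simp
    rw [h2, ← Finset.sum_sub_distrib]
    refine Finset.sum_congr rfl fun l _ => ?_
    linear_combination (cauchy α β)⁻¹ i l * cauchy_mul α β l i'
  have key' : ∀ l l', ∑ i, cauchy α β l i * (cauchy α β)⁻¹ i l' = if l = l' then 1 else 0 := by
    intro l l'
    rw [← Matrix.mul_apply, hC', Matrix.one_apply]
  refine ext_arm_leg e (fun i j hj => ?_) (fun l k hk => ?_)
  · simp only [map_sub, map_smul, smul_eq_mul]
    rw [arm_modelB e i hj]
    rcases lt_or_eq_of_le hj with hj' | rfl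
    · rw [arm_modelX_of_lt e _ hj', arm_modelZ_succ e _ hj', if_neg hj'.ne]
      rcases j with _ | j
      · rw [arm_modelZ_zero]
        push_cast
        ring
      · rw [arm_modelZ_succ e _ hj, arm_modelX_of_lt e _ (by omega)]
        push_cast
        ring
    · have h1 : arm e i (α i) (modelZ e (modelX e v)) = α i * arm e i (α i) v := by
        rcases h : α i with _ | j
        · rw [arm_modelZ_zero]
          simp
        · rw [arm_modelZ_succ e _ h.ge, arm_modelX_of_lt e _ (by omega)]
          push_cast
          ring
      have h2 : arm e i (α i) (modelX e (modelZ e v)) = ∑ i', (∑ l, -((β l : ℂ) *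
          (cauchy α β)⁻¹ i l * cauchy α β l i')) * arm e i' (α i') v := by
        rw [arm_modelX_self]
        simp only [Finset.sum_mul]
        rw [Finset.sum_comm]
        refine Finset.sum_congr rfl fun l _ => ?_
        -- A leg of length zero has no coordinates, so the crossing formula for `Z` is unavailable;
        -- the factor `β_l` removes that term.
        rcases Nat.eq_zero_or_pos (β l) with h0 | h0
        · simp [h0]
        · rw [leg_modelZ_zero e _ h0, Finset.mul_sum]
          exact Finset.sum_congr rfl fun i' _ => by ring
      rw [h1, h2, if_pos rfl, modelA_apply]
      simp only [Finset.sum_neg_distrib, key, neg_sub, sub_mul, Finset.sum_sub_distrib,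
        ite_mul, zero_mul]
      rw [Finset.sum_ite_eq, if_pos (Finset.mem_univ _), ← Finset.mul_sum]
      ring
  · simp only [map_sub, map_smul, smul_eq_mul, leg_modelB, mul_zero]
    have h1 : leg e l k (modelX e (modelZ e v)) = ((k : ℂ) + 1 - β l) * leg e l k v := by
      rw [leg_modelX e _ hk]
      rcases lt_or_eq_of_le (Nat.succ_le_of_lt hk) with h | h
      · rw [leg_modelZ_succ e _ h]
      · have : (β l : ℂ) = k + 1 := by rw [← h]; push_cast; ring
        rw [this]
        ring
    rw [h1]
    rcases k with _ | k
    · have h3 : ∑ i, cauchy α β l i * arm e i (α i) (modelX e v) = -(β l : ℂ) * leg e l 0 v := by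
        simp only [arm_modelX_self, Finset.mul_sum]
        rw [Finset.sum_comm]
        have h4 : ∀ l', ∑ i, cauchy α β l i * (-(β l' : ℂ) * (cauchy α β)⁻¹ i l' * leg e l' 0 v) =
            if l = l' then -(β l' : ℂ) * leg e l' 0 v else 0 := by
          intro l'
          have : ∀ i, cauchy α β l i * (-(β l' : ℂ) * (cauchy α β)⁻¹ i l' * leg e l' 0 v) =
              (-(β l' : ℂ) * leg e l' 0 v) * (cauchy α β l i * (cauchy α β)⁻¹ i l') :=
            fun i => by ring
          simp only [this, ← Finset.mul_sum, key']
          split_ifs <;> simp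
        simp only [h4]
        rw [Finset.sum_ite_eq, if_pos (Finset.mem_univ _)]
      rw [leg_modelZ_zero e _ hk, h3]
      push_cast
      ring
    · rw [leg_modelZ_succ e _ hk, leg_modelX e _ (by omega)]
      push_cast
      ring

theorem modelD_modelX (v : Fin N → ℂ) :
    modelD e (modelX e v) = modelX e (modelD e v) - modelX e v := by
  refine ext_arm_leg e (fun i j hj => ?_) (fun l k hk => ?_)
  · rw [map_sub, arm_modelD]
    rcases lt_or_eq_of_le hj with hj' | rfl
    · rw [arm_modelX_of_lt e _ hj', arm_modelX_of_lt e _ hj', arm_modelD]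
      push_cast
      ring
    · rw [arm_modelX_self, arm_modelX_self, sub_self, zero_mul, eq_comm, sub_eq_zero]
      refine Finset.sum_congr rfl fun l _ => ?_
      rw [leg_modelD]
      push_cast
      ring
  · rw [map_sub, leg_modelD, leg_modelX e _ hk, leg_modelX e _ hk, leg_modelD]
    push_cast
    ring

theorem modelD_modelB : modelD e (modelB e) = 0 := by
  refine ext_arm_leg e (fun i j hj => ?_) (fun l k _ => ?_)
  · rw [arm_modelD, arm_modelB e i hj, map_zero]
    split_ifs with h
    · simp [h]
    · simp
  · rw [leg_modelD, leg_modelB, map_zero, mul_zero]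

/-- At the arm ends `b` is `C⁻¹` applied to the all-ones vector, so crossing by `C` yields ones at
the start of every leg, which `Z` then shifts. -/
theorem leg_modelZ_pow_modelB (hC : (cauchy α β).det ≠ 0) (n : ℕ) :
    (∀ i j, j ≤ α i → arm e i j ((modelZ e ^ (n + 1)) (modelB e)) = 0) ∧
      ∀ l k, k < β l → leg e l k ((modelZ e ^ (n + 1)) (modelB e)) = if k = n then 1 else 0 := by
  induction n with
  | zero =>
    rw [zero_add, pow_one]
    refine ⟨fun i j hj => ?_, fun l k hk => ?_⟩
    · rcases j with _ | j
      · rw [arm_modelZ_zero]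
      · rw [arm_modelZ_succ e _ hj, arm_modelB e i (by omega), if_neg (by omega)]
    · rcases k with _ | k
      · rw [leg_modelZ_zero e _ hk, if_pos rfl]
        have h1 : ∀ i, arm e i (α i) (modelB e) = ∑ l, (cauchy α β)⁻¹ i l := fun i => by
          rw [arm_modelB e i le_rfl, if_pos rfl]
        have hC' := Matrix.mul_nonsing_inv _ (isUnit_iff_ne_zero.2 hC)
        simp only [h1, Finset.mul_sum]
        rw [Finset.sum_comm]
        simp only [← Matrix.mul_apply, hC', Matrix.one_apply]
        simp
      · rw [leg_modelZ_succ e _ hk, leg_modelB, if_neg (by omega)]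
  | succ n ih =>
    rw [pow_succ', Module.End.mul_apply]
    refine ⟨fun i j hj => ?_, fun l k hk => ?_⟩
    · rcases j with _ | j
      · rw [arm_modelZ_zero]
      · rw [arm_modelZ_succ e _ hj, ih.1 i j (by omega)]
    · rcases k with _ | k
      · rw [leg_modelZ_zero e _ hk, Finset.sum_eq_zero, if_neg (by omega)]
        intro i _
        rw [ih.1 i _ le_rfl, mul_zero]
      · rw [leg_modelZ_succ e _ hk, ih.2 l k (by omega)]
        simp

/-- The witness is the first basis vector of the `i`-th arm, which `Z^{α_i}` carries to the end of
the arm. -/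
theorem exists_model_arm (i : R) : ∃ d : Fin N → ℂ, modelD e d = -(α i : ℂ) • d ∧
    modelX e d = 0 ∧ modelA e ((modelZ e ^ α i) d) = -1 := by
  set d : Fin N → ℂ := glue e (fun i' j => if i' = i ∧ j = 0 then 1 else 0) 0 with hd
  have harm : ∀ i' j, j ≤ α i' → arm e i' j d = if i' = i ∧ j = 0 then 1 else 0 := by
    intro i' j hj
    rw [hd, arm_glue, if_pos (by omega)]
  have hleg : ∀ l k, leg e l k d = 0 := by
    intro l k
    rw [hd, leg_glue]
    simp
  refine ⟨d, ?_, ?_, ?_⟩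
  · refine ext_arm_leg e (fun i' j hj => ?_) (fun l k _ => ?_)
    · rw [arm_modelD, map_smul, smul_eq_mul, harm _ _ hj]
      split_ifs with h
      · obtain ⟨rfl, rfl⟩ := h
        simp
      · simp
    · rw [leg_modelD, map_smul, hleg]
      simp
  · refine ext_arm_leg e (fun i' j hj => ?_) (fun l k hk => ?_)
    · rw [map_zero]
      rcases lt_or_eq_of_le hj with hj' | rfl
      · rw [arm_modelX_of_lt e _ hj', harm _ _ (by omega), if_neg (by omega), mul_zero]
      · rw [arm_modelX_self]
        simp [hleg]
    · rw [leg_modelX e _ hk, hleg, mul_zero, map_zero]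
  · have hZ : ∀ n, n ≤ α i → ∀ i' j, j ≤ α i' →
        arm e i' j ((modelZ e ^ n) d) = if i' = i ∧ j = n then 1 else 0 := by
      intro n
      induction n with
      | zero => exact fun _ i' j hj => harm i' j hj
      | succ n ih =>
        intro hn i' j hj
        rw [pow_succ', Module.End.mul_apply]
        rcases j with _ | j
        · rw [arm_modelZ_zero, if_neg (by omega)]
        · rw [arm_modelZ_succ e _ hj, ih (by omega) i' j (by omega)]
          simp
    rw [modelA_apply, Finset.sum_eq_single i]
    · rw [hZ _ le_rfl _ _ le_rfl, if_pos ⟨rfl, rfl⟩]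
    · intro i' _ hi'
      rw [hZ _ le_rfl _ _ le_rfl, if_neg (fun h => hi' h.1)]
    · simp

/-- The witness lies in degree `k + 1`. On that coordinate of the `l`-th leg `X` has weight `k -
β_l` (for `k = 0`, `-β_l` times `C⁻¹`), so the entries `(β_l - k)⁻¹` are forced. -/
theorem exists_model_leg (hα : Function.Injective α) (hβ : Function.Injective β) {k : ℕ}
    (hk : ∀ l, β l ≠ k) : ∃ d : Fin N → ℂ,
    modelD e d = ((k : ℂ) + 1) • d ∧ modelX e d = -(modelZ e ^ k) (modelB e) := by
  set d : Fin N → ℂ := glue e 0 (fun l t => if t = k then ((β l : ℂ) - k)⁻¹ else 0) with hd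
  have harm : ∀ i j, arm e i j d = 0 := by
    intro i j
    rw [hd, arm_glue]
    simp
  have hleg : ∀ l t, t < β l → leg e l t d = if t = k then ((β l : ℂ) - k)⁻¹ else 0 := by
    intro l t ht
    rw [hd, leg_glue, if_pos ht]
  have hne : ∀ l, (β l : ℂ) - k ≠ 0 := fun l h => hk l (Nat.cast_injective (sub_eq_zero.1 h))
  refine ⟨d, ?_, ?_⟩
  · refine ext_arm_leg e (fun i j _ => ?_) (fun l t ht => ?_)
    · rw [arm_modelD, map_smul, harm, mul_zero, smul_zero]
    · rw [leg_modelD, map_smul, hleg _ _ ht, smul_eq_mul]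
      split_ifs with h
      · rw [h]
      · simp
  · rcases k with _ | k
    · refine ext_arm_leg e (fun i j hj => ?_) (fun l t ht => ?_)
      · rw [pow_zero, Module.End.one_apply, map_neg, arm_modelB e i hj]
        rcases lt_or_eq_of_le hj with hj' | rfl
        · rw [arm_modelX_of_lt e _ hj', harm, if_neg hj'.ne, mul_zero, neg_zero]
        · rw [arm_modelX_self, if_pos rfl, ← Finset.sum_neg_distrib]
          refine Finset.sum_congr rfl fun l _ => ?_
          have h1 := hne l
          rw [hleg l 0 (Nat.pos_of_ne_zero (hk l)), if_pos rfl]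
          simp only [Nat.cast_zero, sub_zero] at h1 ⊢
          field_simp
      · rw [pow_zero, Module.End.one_apply, map_neg, leg_modelB, leg_modelX e _ ht]
        rcases lt_or_ge (t + 1) (β l) with h | h
        · rw [hleg _ _ h, if_neg (by omega), mul_zero, neg_zero]
        · rw [leg_of_le e h, mul_zero, neg_zero]
    · obtain ⟨h1, h2⟩ := leg_modelZ_pow_modelB e (det_cauchy_ne_zero hα hβ) k
      refine ext_arm_leg e (fun i j hj => ?_) (fun l t ht => ?_)
      · rw [map_neg, h1 i j hj, neg_zero]
        rcases lt_or_eq_of_le hj with hj' | rfl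
        · rw [arm_modelX_of_lt e _ hj', harm, mul_zero]
        · rw [arm_modelX_self]
          refine Finset.sum_eq_zero fun l _ => ?_
          rcases Nat.eq_zero_or_pos (β l) with h0 | h0
          · simp [h0]
          · rw [hleg _ _ h0, if_neg (by omega), mul_zero]
      · rw [map_neg, h2 l t ht, leg_modelX e _ ht]
        have h3 := hne l
        rcases lt_or_ge (t + 1) (β l) with h | h
        · rw [hleg _ _ h]
          split_ifs with h4 h5 h5
          · rw [← h4] at h3 ⊢
            push_cast at h3 ⊢
            rw [← neg_sub, neg_mul, mul_inv_cancel₀ h3]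
          · omega
          · omega
          · simp
        -- A leg of length exactly the excluded value would end at the coordinate where the right
        -- side is nonzero and which `X` cannot reach.
        · have := hk l
          rw [leg_of_le e h, mul_zero, if_neg (by omega), neg_zero]

end Model

/-! ### The combinatorics of hooks -/

section Hooks

variable {N : ℕ} {lam : Fin N → ℕ}

/-- Frobenius coordinates: the exponents `m ≥ N` give `α = m - N`, and the numbers `c < N` that are
not exponents give `β = N - 1 - c`. There are `N` exponents in all, so the two families have equal
size. -/
theorem exists_hooks (hanti : Antitone lam) (hsum : ∑ i, lam i = N) :
    ∃ (r : ℕ) (α β : Fin r → ℕ), Function.Injective α ∧ Function.Injective β ∧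
      Nonempty (Fin N ≃ (Σ i : Fin r, Fin (α i + 1)) ⊕ (Σ l : Fin r, Fin (β l))) ∧
      ∀ i : Fin N, (∃ l, expo lam i = N + α l) ∨
        ∃ k, expo lam i + k + 1 = N ∧ ∀ l, β l ≠ k := by
  have hinj := (expo_strictAnti hanti).injective
  set A : Finset (Fin N) := Finset.univ.filter fun i => N ≤ expo lam i with hA
  set L : Finset (Fin N) := Finset.univ.filter fun i => ¬ N ≤ expo lam i with hL
  set C : Finset ℕ := Finset.range N \ L.image (expo lam) with hC
  have hLsub : L.image (expo lam) ⊆ Finset.range N := by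
    intro m hm
    obtain ⟨i, hi, rfl⟩ := Finset.mem_image.1 hm
    simpa [hL] using hi
  have hcardAL : A.card + L.card = N := by
    rw [hA, hL, Finset.card_filter_add_card_filter_not, Finset.card_univ, Fintype.card_fin]
  have hcardC : C.card = A.card := by
    have h1 := Finset.card_sdiff_add_card_eq_card hLsub
    rw [Finset.card_image_of_injective _ hinj, Finset.card_range] at h1
    rw [hC]
    omega
  let eA : Fin A.card ≃ A := A.equivFin.symm
  let eC : Fin A.card ≃ C := (C.equivFinOfCardEq hcardC).symm
  have hCmem : ∀ l, ((eC l : ℕ)) < N ∧ (eC l : ℕ) ∉ L.image (expo lam) := fun l => by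
    have := Finset.mem_sdiff.1 (eC l).2
    exact ⟨Finset.mem_range.1 this.1, this.2⟩
  have hAmem : ∀ l, N ≤ expo lam (eA l) := fun l => (Finset.mem_filter.1 (eA l).2).2
  refine ⟨A.card, fun l => expo lam (eA l) - N, fun l => N - 1 - eC l, ?_, ?_, ?_, ?_⟩
  · intro l l' h
    have h1 := hAmem l
    have h2 := hAmem l'
    have h3 : expo lam (eA l) = expo lam (eA l') := by simp only at h; omega
    exact eA.injective (Subtype.ext (hinj h3))
  · intro l l' h
    have h1 := (hCmem l).1
    have h2 := (hCmem l').1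
    have h3 : (eC l : ℕ) = eC l' := by simp only at h; omega
    exact eC.injective (Subtype.ext h3)
  · refine ⟨(Fintype.equivFinOfCardEq ?_).symm⟩
    simp only [Fintype.card_sum, Fintype.card_sigma, Fintype.card_fin]
    have h1 : ∑ l, (expo lam (eA l) - N + 1) = ∑ i ∈ A, (expo lam i - N + 1) := by
      rw [eA.sum_comp (fun i : A => expo lam i - N + 1),
        Finset.sum_coe_sort A fun i => expo lam i - N + 1]
    have h2 : ∑ l, (N - 1 - (eC l : ℕ)) = ∑ c ∈ C, (N - 1 - c) := by
      rw [eC.sum_comp (fun c : C => N - 1 - (c : ℕ)), Finset.sum_coe_sort C fun c => N - 1 - c]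
    have h3 : ∑ c ∈ C, (N - 1 - c) + ∑ i ∈ L, (N - 1 - expo lam i) =
        ∑ c ∈ Finset.range N, c := by
      rw [← Finset.sum_image (f := fun c => N - 1 - c) hinj.injOn, hC,
        Finset.sum_sdiff hLsub, Finset.sum_range_reflect (fun c => c)]
    -- Passing from gaps to small exponents by `h3`, the dimension becomes `∑ (m_i - N) + ∑_{c<N} c
    -- + N` over all exponents, and `∑ λ_i = N` makes this `N`.
    have h4 : (∑ i ∈ A, ((expo lam i : ℤ) - N)) + ∑ i ∈ L, ((expo lam i : ℤ) - N) =
        ∑ i : Fin N, ((lam i : ℤ) - ((i : ℕ) + 1)) := by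
      rw [hA, hL, Finset.sum_filter_add_sum_filter_not]
      refine Finset.sum_congr rfl fun i _ => ?_
      have := i.2
      rw [expo]
      omega
    have h5 : ∑ i : Fin N, ((lam i : ℤ) - ((i : ℕ) + 1)) =
        N - ((∑ c ∈ Finset.range N, c : ℕ) : ℤ) - N := by
      have h0 : ∑ i, (lam i : ℤ) = N := by exact_mod_cast hsum
      rw [Finset.sum_sub_distrib, Finset.sum_add_distrib, Finset.sum_range, h0]
      simp
    have h6 : ((∑ i ∈ A, (expo lam i - N + 1) : ℕ) : ℤ) =
        ∑ i ∈ A, ((expo lam i : ℤ) - N) + A.card := by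
      rw [Finset.card_eq_sum_ones]
      push_cast
      rw [← Finset.sum_add_distrib]
      refine Finset.sum_congr rfl fun i hi => ?_
      have : N ≤ expo lam i := by simpa [hA] using hi
      omega
    have h7 : ((∑ i ∈ L, (N - 1 - expo lam i) : ℕ) : ℤ) =
        -∑ i ∈ L, ((expo lam i : ℤ) - N) - L.card := by
      rw [Finset.card_eq_sum_ones]
      push_cast
      rw [← Finset.sum_neg_distrib, ← Finset.sum_sub_distrib]
      refine Finset.sum_congr rfl fun i hi => ?_
      have : ¬ N ≤ expo lam i := by simpa [hL] using hi
      omega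
    rw [h1, h2]
    omega
  · intro i
    by_cases hi : N ≤ expo lam i
    · refine Or.inl ⟨eA.symm ⟨i, by simpa [hA] using hi⟩, ?_⟩
      simp only [Equiv.apply_symm_apply]
      omega
    · refine Or.inr ⟨N - 1 - expo lam i, by omega, fun l hl => ?_⟩
      have h1 := hCmem l
      refine h1.2 (Finset.mem_image.2 ⟨i, by simpa [hL] using hi, ?_⟩)
      simp only at hl
      omega

end Hooks

namespace CM

variable {N : ℕ}

/-! ### Graded Calogero-Moser matrices -/

/-- `D` is a grading of `𝒳`, in which `X` has degree `-1`, `Z` degree `1`, and the two vectors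
degree `0`. -/
structure IsGrading (𝒳 : CM N) (D : Matrix (Fin N) (Fin N) ℂ) : Prop where
  mul_X : D * 𝒳.X = 𝒳.X * D - 𝒳.X
  mul_Z : D * 𝒳.Z = 𝒳.Z * D + 𝒳.Z
  mulVec_b : D *ᵥ 𝒳.b = 0
  vecMul_a : 𝒳.a ᵥ* D = 0

/-- A vector of degree `-s` from which the orbit under `Z` is determined by the relations. -/
structure IsGenerator (𝒳 : CM N) (D : Matrix (Fin N) (Fin N) ℂ) (s : ℤ) (d : Fin N → ℂ) :
    Prop where
  degree : D *ᵥ d = -(s : ℂ) • d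
  mulVec_X : 𝒳.X *ᵥ d = -(if s < 0 then 𝒳.Z ^ (-s - 1).toNat *ᵥ 𝒳.b else 0)
  dot_a : 0 ≤ s → 𝒳.a ⬝ᵥ (𝒳.Z ^ s.toNat *ᵥ d) = -1

theorem IsGrading.mul_Z_pow {𝒳 : CM N} {D : Matrix (Fin N) (Fin N) ℂ} (h : 𝒳.IsGrading D)
    (q : ℕ) : D * 𝒳.Z ^ q = 𝒳.Z ^ q * D + (q : ℂ) • 𝒳.Z ^ q := by
  induction q with
  | zero => simp
  | succ q ih =>
    rw [pow_succ, ← mul_assoc, ih, add_mul, mul_assoc, h.mul_Z, mul_add, Matrix.smul_mul,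
      ← mul_assoc]
    push_cast
    rw [add_smul, one_smul]
    abel

theorem IsGrading.mul_X_pow {𝒳 : CM N} {D : Matrix (Fin N) (Fin N) ℂ} (h : 𝒳.IsGrading D)
    (q : ℕ) : D * 𝒳.X ^ q = 𝒳.X ^ q * D - (q : ℂ) • 𝒳.X ^ q := by
  induction q with
  | zero => simp
  | succ q ih =>
    rw [pow_succ, ← mul_assoc, ih, sub_mul, mul_assoc, h.mul_X, mul_sub, Matrix.smul_mul,
      ← mul_assoc]
    push_cast
    rw [add_smul, one_smul]
    abel

/-- `X^p Z^q b` is homogeneous of degree `q - p`, and `a` sees only degree `0`. -/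
theorem IsGrading.balanced {𝒳 : CM N} {D : Matrix (Fin N) (Fin N) ℂ} (h : 𝒳.IsGrading D) :
    𝒳.Balanced := by
  intro p q hpq
  have h1 : D * (𝒳.X ^ p * 𝒳.Z ^ q) =
      (𝒳.X ^ p * 𝒳.Z ^ q) * D + ((q : ℂ) - p) • (𝒳.X ^ p * 𝒳.Z ^ q) := by
    rw [← mul_assoc, h.mul_X_pow, sub_mul, mul_assoc, h.mul_Z_pow, mul_add, Matrix.mul_smul,
      Matrix.smul_mul, sub_smul, mul_assoc]
    abel
  have h2 : 𝒳.pair (D * (𝒳.X ^ p * 𝒳.Z ^ q)) = 0 := by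
    rw [pair, ← Matrix.mulVec_mulVec, Matrix.dotProduct_mulVec, h.vecMul_a, zero_dotProduct]
  have h3 : 𝒳.pair ((𝒳.X ^ p * 𝒳.Z ^ q) * D) = 0 := by
    rw [pair, ← Matrix.mulVec_mulVec, h.mulVec_b, Matrix.mulVec_zero, dotProduct_zero]
  rw [h1, pair_add, h3, zero_add, pair_smul] at h2
  refine (mul_eq_zero.1 h2).resolve_left (sub_ne_zero.2 fun h4 => hpq ?_)
  exact (Nat.cast_injective h4).symm

/-! ### Orbits of the generators and the linear system they solve -/

section Generator

variable {𝒳 : CM N} {D : Matrix (Fin N) (Fin N) ℂ} {s : ℤ} {d : Fin N → ℂ}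

theorem IsGenerator.dot_a_Z_pow (h : 𝒳.IsGrading D) (hd : 𝒳.IsGenerator D s d) (j : ℕ) :
    𝒳.a ⬝ᵥ (𝒳.Z ^ j *ᵥ d) = if (j : ℤ) = s then -1 else 0 := by
  split_ifs with hj
  · have := hd.dot_a (by omega)
    rwa [← hj, Int.toNat_natCast] at this
  · have h1 : 𝒳.a ⬝ᵥ ((D * 𝒳.Z ^ j) *ᵥ d) = 0 := by
      rw [← Matrix.mulVec_mulVec, Matrix.dotProduct_mulVec, h.vecMul_a, zero_dotProduct]
    rw [h.mul_Z_pow, Matrix.add_mulVec, ← Matrix.mulVec_mulVec, hd.degree, Matrix.mulVec_smul,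
      Matrix.smul_mulVec, ← add_smul, dotProduct_smul, smul_eq_mul] at h1
    refine (mul_eq_zero.1 h1).resolve_left fun h2 => hj ?_
    have : (j : ℂ) = s := by linear_combination h2
    exact_mod_cast this

/-- Move `X` through one factor `Z` at a time. By degree, the rank one term contributes only at `j =
s`, where it creates `b`; further factors `Z` then act on it. For `s < 0` the `b`-term is present
from the start. -/
theorem IsGenerator.mulVec_X_Z_pow (h : 𝒳.IsGrading D) (hd : 𝒳.IsGenerator D s d) (j : ℕ) :
    𝒳.X *ᵥ (𝒳.Z ^ j *ᵥ d) = (j : ℂ) • (𝒳.Z ^ (j - 1) *ᵥ d) -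
      if s + 1 ≤ j then 𝒳.Z ^ (j - s - 1).toNat *ᵥ 𝒳.b else 0 := by
  induction j with
  | zero =>
    rw [pow_zero, Matrix.one_mulVec, hd.mulVec_X]
    simp only [Nat.cast_zero, zero_smul, zero_sub]
    congr 2
  | succ j ih =>
    have h1 : 𝒳.X * 𝒳.Z = 𝒳.Z * 𝒳.X + 1 + Matrix.vecMulVec 𝒳.b 𝒳.a := by
      rw [← 𝒳.rank_one]; abel
    have h2 : 𝒳.X *ᵥ (𝒳.Z ^ (j + 1) *ᵥ d) = 𝒳.Z *ᵥ (𝒳.X *ᵥ (𝒳.Z ^ j *ᵥ d)) + 𝒳.Z ^ j *ᵥ d +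
        (if (j : ℤ) = s then (-1 : ℂ) else 0) • 𝒳.b := by
      rw [pow_succ', ← Matrix.mulVec_mulVec, Matrix.mulVec_mulVec _ 𝒳.X 𝒳.Z, h1,
        Matrix.add_mulVec, Matrix.add_mulVec, Matrix.one_mulVec, Matrix.vecMulVec_mulVec,
        hd.dot_a_Z_pow h, ← Matrix.mulVec_mulVec]
      simp
    have h3 : 𝒳.Z *ᵥ ((j : ℂ) • (𝒳.Z ^ (j - 1) *ᵥ d)) = (j : ℂ) • (𝒳.Z ^ j *ᵥ d) := by
      rcases j with _ | j
      · simp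
      · rw [Matrix.mulVec_smul, Nat.add_sub_cancel, Matrix.mulVec_mulVec, ← pow_succ']
    rw [h2, ih, Matrix.mulVec_sub, h3, Nat.add_sub_cancel]
    push_cast
    rw [add_smul, one_smul]
    rcases lt_trichotomy (j : ℤ) s with hj | hj | hj
    · rw [if_neg (by omega), if_neg (by omega), if_neg (by omega)]
      simp
    · rw [if_neg (by omega), if_pos hj, if_pos (by omega)]
      have : ((j : ℤ) + 1 - s - 1).toNat = 0 := by omega
      rw [this]
      simp [sub_eq_add_neg]
    · rw [if_pos (by omega), if_neg (by omega), if_pos (by omega)]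
      have : ((j : ℤ) + 1 - s - 1).toNat = ((j : ℤ) - s - 1).toNat + 1 := by omega
      rw [this, Matrix.mulVec_mulVec, ← pow_succ']
      simp
      abel

/-- The recurrence `He_succ` makes the sum telescope: apart from the `b`-terms, only two boundary
terms with high powers of `Z` survive. -/
theorem IsGenerator.Xt_mulVec_sum (h : 𝒳.IsGrading D) (hd : 𝒳.IsGenerator D s d) (x y : ℂ)
    (L : ℕ) :
    𝒳.Xt x y *ᵥ (∑ j ∈ Finset.range L, He y j x • (𝒳.Z ^ j *ᵥ d)) =
      ((L : ℂ) * He y L x) • (𝒳.Z ^ (L - 1) *ᵥ d) + (2 * y * He y ((L : ℤ) - 1) x) • (𝒳.Z ^ L *ᵥ d)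
        + ∑ j ∈ Finset.range L, He y j x •
          if s + 1 ≤ j then 𝒳.Z ^ (j - s - 1).toNat *ᵥ 𝒳.b else 0 := by
  induction L with
  | zero => simp [He_of_neg]
  | succ L ih =>
    rw [Finset.sum_range_succ, Finset.sum_range_succ, Matrix.mulVec_add, ih, Matrix.mulVec_smul,
      Xt, Matrix.sub_mulVec, Matrix.add_mulVec, Matrix.smul_mulVec, Matrix.smul_mulVec,
      Matrix.one_mulVec, hd.mulVec_X_Z_pow h, Matrix.mulVec_mulVec, ← pow_succ',
      Nat.add_sub_cancel]
    have h1 := He_succ y L x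
    push_cast at h1 ⊢
    rw [h1, add_sub_cancel_right]
    module

theorem IsGenerator.Xt_mulVec {m : ℕ} (h : 𝒳.IsGrading D)
    (hd : 𝒳.IsGenerator D ((m : ℤ) - N) d) (x y : ℂ) :
    ∃ v, 𝒳.Xt x y *ᵥ v = ∑ r ∈ Finset.range N,
        He y ((m : ℤ) - r) x • (𝒳.Z ^ (N - 1 - r) *ᵥ 𝒳.b) ∧
      𝒳.a ⬝ᵥ v = -He y ((m : ℤ) - N) x := by
  have hZ : ∀ k, N ≤ k → 𝒳.Z ^ k = 0 := fun k hk => by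
    rw [← Nat.sub_add_cancel hk, pow_add, h.balanced.Z_pow, mul_zero]
  -- The cut-off is so large that the boundary terms contain `Z^{m+N}` and `Z^{m+N+1}`, which
  -- vanish, while every index that contributes stays in range.
  refine ⟨∑ j ∈ Finset.range (m + N + 1), He y j x • (𝒳.Z ^ j *ᵥ d), ?_, ?_⟩
  · rw [hd.Xt_mulVec_sum h, hZ (m + N + 1 - 1) (by omega), hZ (m + N + 1) (by omega),
      Matrix.zero_mulVec, smul_zero, smul_zero, zero_add, zero_add]
    have h1 : ∀ r ∈ Finset.range N, He y ((m : ℤ) - r) x • (𝒳.Z ^ (N - 1 - r) *ᵥ 𝒳.b) =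
        if r ≤ m then He y ((m : ℤ) - r) x • (𝒳.Z ^ (N - 1 - r) *ᵥ 𝒳.b) else 0 := by
      intro r _
      split_ifs with hr
      · rfl
      · rw [He_of_neg (by omega), zero_smul]
    have h2 : ∀ j ∈ Finset.range (m + N + 1), (He y j x • if (m : ℤ) - N + 1 ≤ j then
          𝒳.Z ^ ((j : ℤ) - ((m : ℤ) - N) - 1).toNat *ᵥ 𝒳.b else 0) =
        if m + 1 ≤ j + N ∧ j ≤ m then He y j x • (𝒳.Z ^ (j + N - m - 1) *ᵥ 𝒳.b) else 0 := by
      intro j _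
      by_cases hj : m + 1 ≤ j + N
      · rw [if_pos (by omega)]
        have : ((j : ℤ) - ((m : ℤ) - N) - 1).toNat = j + N - m - 1 := by omega
        rw [this]
        by_cases hj' : j ≤ m
        · rw [if_pos ⟨hj, hj'⟩]
        · rw [if_neg (fun H => hj' H.2), hZ _ (by omega), Matrix.zero_mulVec, smul_zero]
      · rw [if_neg (by omega), if_neg (fun H => hj H.1), smul_zero]
    rw [Finset.sum_congr rfl h1, Finset.sum_congr rfl h2, ← Finset.sum_filter,
      ← Finset.sum_filter]
    refine Finset.sum_nbij' (fun j => m - j) (fun r => m - r) ?_ ?_ ?_ ?_ ?_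
    · intro j hj
      simp only [Finset.mem_filter, Finset.mem_range] at hj ⊢
      omega
    · intro j hj
      simp only [Finset.mem_filter, Finset.mem_range] at hj ⊢
      omega
    · intro j hj
      simp only [Finset.mem_filter, Finset.mem_range] at hj
      omega
    · intro j hj
      simp only [Finset.mem_filter, Finset.mem_range] at hj
      omega
    · intro j hj
      simp only [Finset.mem_filter, Finset.mem_range] at hj
      have e1 : (m : ℤ) - ((m - j : ℕ) : ℤ) = j := by omega
      have e2 : N - 1 - (m - j) = j + N - m - 1 := by omega
      rw [e1, e2]
  · rw [dotProduct_sum]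
    simp only [dotProduct_smul, hd.dot_a_Z_pow h, smul_eq_mul, mul_ite, mul_zero]
    rcases le_or_gt N m with hm | hm
    · rw [Finset.sum_eq_single (m - N)]
      · have : (((m - N : ℕ)) : ℤ) = (m : ℤ) - N := by omega
        rw [if_pos this, this]
        ring
      · intro j _ hj
        rw [if_neg (by omega)]
      · intro hj
        simp only [Finset.mem_range] at hj
        omega
    · rw [He_of_neg (by omega), neg_zero]
      refine Finset.sum_eq_zero fun j _ => ?_
      rw [if_neg (by omega)]

end Generator

/-- The coefficients of `ψ_𝒳(x, y, z) z^N / ψ₀` for nilpotent `Z`. -/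
def waveCoeff (𝒳 : CM N) (x y : ℂ) (i : ℕ) : ℂ :=
  if i = N then 1 else 𝒳.pair ((𝒳.Xt x y)⁻¹ * 𝒳.Z ^ (N - 1 - i))

theorem hatWave_eq_waveCoeff {𝒳 : CM N} (h : IsNilpotent 𝒳.Z) (x y z : ℂ) :
    𝒳.hatWave x y z = (∑ i ∈ Finset.range (N + 1), 𝒳.waveCoeff x y i * z ^ i) * psi0 x y z := by
  rw [hatWave_of_isNilpotent h, Finset.sum_range_succ, ← Finset.sum_range_reflect, add_comm]
  congr 2
  · refine Finset.sum_congr rfl fun i hi => ?_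
    have := Finset.mem_range.1 hi
    rw [waveCoeff, if_neg (by omega)]
    congr 4
    omega
  · simp [waveCoeff]

variable {lam : Fin N → ℕ} {𝒳 : CM N} {D : Matrix (Fin N) (Fin N) ℂ}

/-- Apply the row vector `aᵀ (x + 2yZ - X)⁻¹` to `IsGenerator.Xt_mulVec`. The outcome says that the
monic operator with these coefficients annihilates `κ_m`. -/
theorem sum_waveCoeff_mul_He {m : ℕ} {d : Fin N → ℂ} (h : 𝒳.IsGrading D)
    (hd : 𝒳.IsGenerator D ((m : ℤ) - N) d) {x y : ℂ} (hx : 𝒳.tau x y ≠ 0) :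
    ∑ i ∈ Finset.range (N + 1), 𝒳.waveCoeff x y i * He y ((m : ℤ) - i) x = 0 := by
  obtain ⟨v, hv, hav⟩ := hd.Xt_mulVec h x y
  have h1 : v = (𝒳.Xt x y)⁻¹ *ᵥ (𝒳.Xt x y *ᵥ v) := by
    rw [Matrix.mulVec_mulVec, Matrix.nonsing_inv_mul _ (isUnit_iff_ne_zero.2 hx),
      Matrix.one_mulVec]
  rw [h1, hv, Matrix.mulVec_sum, dotProduct_sum] at hav
  have h2 : ∑ i ∈ Finset.range N, 𝒳.waveCoeff x y i * He y ((m : ℤ) - i) x =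
      -He y ((m : ℤ) - N) x := by
    rw [← hav]
    refine Finset.sum_congr rfl fun i hi => ?_
    rw [waveCoeff, if_neg (Finset.mem_range.1 hi).ne, pair, Matrix.mulVec_smul, dotProduct_smul,
      Matrix.mulVec_mulVec, smul_eq_mul, mul_comm]
  rw [Finset.sum_range_succ, h2, waveCoeff, if_pos rfl, one_mul, neg_add_cancel]

theorem isDataOf_of_isGenerator (h : 𝒳.IsGrading D)
    (hd : ∀ i, ∃ d, 𝒳.IsGenerator D ((expo lam i : ℤ) - N) d) : IsDataOf lam 𝒳 := by
  intro x y z hx hq hW hz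
  have hZ := h.balanced.isNilpotent_Z
  have h1 := psiNum_eq lam x y z (𝒳.waveCoeff x y) (by simp [waveCoeff]) fun j => by
    obtain ⟨d, hd⟩ := hd j
    exact sum_waveCoeff_mul_He h hd hx
  rw [← hatWave_eq_waveCoeff hZ, hatWave_eq _ _ _ _ hq, q_eq_pow hZ] at h1
  change _ = psiNum lam x y z / _
  rw [h1]
  field_simp

/-- A left null vector `p` of `x + 2yZ - X`, paired with the linear systems of all generators,
satisfies a homogeneous system with the Wronskian matrix, so `p` annihilates every `Z^k b`. The rank
one term then disappears from the commutation relation. -/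
theorem tau_ne_zero_of_isGenerator (h : 𝒳.IsGrading D)
    (hd : ∀ i, ∃ d, 𝒳.IsGenerator D ((expo lam i : ℤ) - N) d) {x y : ℂ}
    (hW : kappaWr lam x y ≠ 0) : 𝒳.tau x y ≠ 0 := by
  intro hx
  obtain ⟨p, hp, hp0⟩ := Matrix.exists_vecMul_eq_zero_iff.2 hx
  have h1 : ∀ r < N, p ⬝ᵥ (𝒳.Z ^ (N - 1 - r) *ᵥ 𝒳.b) = 0 := by
    have h2 : (fun r : Fin N => p ⬝ᵥ (𝒳.Z ^ (N - 1 - (r : ℕ)) *ᵥ 𝒳.b)) = 0 := by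
      rw [kappaWr_eq_det] at hW
      refine Matrix.eq_zero_of_vecMul_eq_zero hW (funext fun j => ?_)
      obtain ⟨d, hd⟩ := hd j
      obtain ⟨v, hv, -⟩ := hd.Xt_mulVec h x y
      have h3 := congrArg (fun w => p ⬝ᵥ w) hv
      simp only [dotProduct_sum, dotProduct_smul] at h3
      rw [Matrix.dotProduct_mulVec, hp0, zero_dotProduct] at h3
      rw [Finset.sum_range] at h3
      simp only [Matrix.vecMul, dotProduct, Matrix.of_apply, Pi.zero_apply]
      rw [← mul_zero ((expo lam j).factorial : ℂ), h3, Finset.mul_sum]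
      refine Finset.sum_congr rfl fun r _ => ?_
      simp only [smul_eq_mul, dotProduct]
      ring
    exact fun r hr => congrFun h2 ⟨r, hr⟩
  have h2 : ∀ k, p ⬝ᵥ (𝒳.Z ^ k *ᵥ 𝒳.b) = 0 := by
    intro k
    rcases lt_or_ge k N with hk | hk
    · have := h1 (N - 1 - k) (by omega)
      rwa [show N - 1 - (N - 1 - k) = k by omega] at this
    · rw [← Nat.sub_add_cancel hk, pow_add, h.balanced.Z_pow, mul_zero, Matrix.zero_mulVec,
        dotProduct_zero]
  have hX : p ᵥ* 𝒳.X = x • p + (2 * y) • (p ᵥ* 𝒳.Z) := by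
    rw [Xt, Matrix.vecMul_sub, Matrix.vecMul_add, Matrix.vecMul_smul, Matrix.vecMul_smul,
      Matrix.vecMul_one, sub_eq_zero] at hp0
    exact hp0.symm
  have h3 : ∀ k : ℕ, p ᵥ* (𝒳.Z ^ k * 𝒳.X) = x • (p ᵥ* 𝒳.Z ^ k) +
      (2 * y) • (p ᵥ* 𝒳.Z ^ (k + 1)) - (k : ℂ) • (p ᵥ* 𝒳.Z ^ (k - 1)) := by
    intro k
    induction k with
    | zero => simp [hX]
    | succ k ih =>
      have h4 : 𝒳.Z * 𝒳.X = 𝒳.X * 𝒳.Z - 1 - Matrix.vecMulVec 𝒳.b 𝒳.a := by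
        rw [← 𝒳.rank_one]; abel
      have h5 : (k : ℂ) • (p ᵥ* 𝒳.Z ^ (k - 1) ᵥ* 𝒳.Z) = (k : ℂ) • (p ᵥ* 𝒳.Z ^ k) := by
        rcases k with _ | k
        · simp
        · rw [Matrix.vecMul_vecMul, Nat.add_sub_cancel, ← pow_succ]
      have h6 : p ᵥ* (𝒳.Z ^ k * Matrix.vecMulVec 𝒳.b 𝒳.a) = 0 := by
        rw [Matrix.mul_vecMulVec, Matrix.vecMul_vecMulVec, h2, zero_smul]
      rw [pow_succ, mul_assoc, h4, mul_sub, mul_sub, mul_one, Matrix.vecMul_sub,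
        Matrix.vecMul_sub, h6, ← mul_assoc, ← Matrix.vecMul_vecMul, ih, Matrix.sub_vecMul,
        Matrix.add_vecMul, Matrix.smul_vecMul, Matrix.smul_vecMul, Matrix.smul_vecMul, h5,
        Matrix.vecMul_vecMul, Matrix.vecMul_vecMul, ← pow_succ, ← pow_succ, Nat.add_sub_cancel]
      push_cast
      module
  -- Descent from `Z^N = 0`: if `p Z^{k+1} = 0`, then `h3` at `k + 1` reduces to `(k + 1) p Z^k =
  -- 0`.
  have h4 : ∀ n k : ℕ, n + k = N → p ᵥ* 𝒳.Z ^ k = 0 := by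
    intro n
    induction n with
    | zero =>
      intro k hk
      rw [show k = N by omega, h.balanced.Z_pow, Matrix.vecMul_zero]
    | succ n ih =>
      intro k hk
      have h5 := ih (k + 1) (by omega)
      have h6 := h3 (k + 1)
      rw [← Matrix.vecMul_vecMul, h5, pow_succ 𝒳.Z (k + 1), ← Matrix.vecMul_vecMul, h5,
        Matrix.zero_vecMul, Matrix.zero_vecMul, smul_zero, smul_zero, add_zero, zero_sub,
        Nat.add_sub_cancel, eq_comm, neg_eq_zero] at h6
      exact (smul_eq_zero.1 h6).resolve_left (Nat.cast_ne_zero.2 k.succ_ne_zero)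
  have h5 := h4 N 0 (by omega)
  rw [pow_zero, Matrix.vecMul_one] at h5
  exact hp h5

end CM

theorem exists_graded {N : ℕ} {lam : Fin N → ℕ} (hanti : Antitone lam) (hsum : ∑ i, lam i = N) :
    ∃ (𝒳 : CM N) (D : Matrix (Fin N) (Fin N) ℂ), 𝒳.IsGrading D ∧
      ∀ i, ∃ d, 𝒳.IsGenerator D ((expo lam i : ℤ) - N) d := by
  obtain ⟨r, α, β, hα, hβ, ⟨e⟩, hcov⟩ := exists_hooks hanti hsum
  have hA : ∀ v, (fun n => modelA e fun j => if n = j then 1 else 0) ⬝ᵥ v = modelA e v := by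
    intro v
    rw [LinearMap.pi_apply_eq_sum_univ (modelA e) v, dotProduct]
    exact Finset.sum_congr rfl fun n _ => mul_comm _ _
  have hext : ∀ P Q : Matrix (Fin N) (Fin N) ℂ, (∀ v, P *ᵥ v = Q *ᵥ v) → P = Q := fun P Q hPQ =>
    Matrix.toLin'.injective (LinearMap.ext fun v => by simpa using hPQ v)
  let 𝒳 : CM N :=
    { X := LinearMap.toMatrix' (modelX e)
      Z := LinearMap.toMatrix' (modelZ e)
      a := fun n => modelA e fun j => if n = j then 1 else 0
      b := modelB e
      rank_one := by
        refine hext _ _ fun v => ?_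
        simp only [Matrix.sub_mulVec, ← Matrix.mulVec_mulVec, LinearMap.toMatrix'_mulVec,
          Matrix.one_mulVec, Matrix.vecMulVec_mulVec, hA, op_smul_eq_smul]
        exact model_commutator e hα hβ v }
  have hX : ∀ v, 𝒳.X *ᵥ v = modelX e v := LinearMap.toMatrix'_mulVec _
  have hZ : ∀ v, 𝒳.Z *ᵥ v = modelZ e v := LinearMap.toMatrix'_mulVec _
  have hZp : ∀ (n : ℕ) v, 𝒳.Z ^ n *ᵥ v = (modelZ e ^ n) v := by
    intro n
    induction n with
    | zero => simp
    | succ n ih =>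
      intro v
      rw [pow_succ', ← Matrix.mulVec_mulVec, ih, hZ, pow_succ', Module.End.mul_apply]
  have hD : ∀ v, LinearMap.toMatrix' (modelD e) *ᵥ v = modelD e v := LinearMap.toMatrix'_mulVec _
  refine ⟨𝒳, LinearMap.toMatrix' (modelD e), ⟨?_, ?_, ?_, ?_⟩, fun i => ?_⟩
  · refine hext _ _ fun v => ?_
    simp only [Matrix.sub_mulVec, ← Matrix.mulVec_mulVec, hX, hD]
    exact modelD_modelX e v
  · refine hext _ _ fun v => ?_
    simp only [Matrix.add_mulVec, ← Matrix.mulVec_mulVec, hZ, hD]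
    exact modelD_modelZ e v
  · rw [hD]
    exact modelD_modelB e
  · refine dotProduct_eq _ _ fun v => ?_
    rw [← Matrix.dotProduct_mulVec, hD, zero_dotProduct]
    exact (hA _).trans (modelA_modelD e v)
  · rcases hcov i with ⟨l, hl⟩ | ⟨k, hk, hkβ⟩
    · obtain ⟨d, h1, h2, h3⟩ := exists_model_arm e l
      have hs : (expo lam i : ℤ) - N = α l := by omega
      refine ⟨d, ⟨?_, ?_, fun _ => ?_⟩⟩
      · rw [hD, h1, hs]
        simp
      · rw [hX, h2, if_neg (by omega), neg_zero]
      · rw [hs, Int.toNat_natCast, hZp]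
        exact (hA _).trans h3
    · obtain ⟨d, h1, h2⟩ := exists_model_leg e hα hβ hkβ
      have hs : (expo lam i : ℤ) - N = -((k : ℤ) + 1) := by omega
      refine ⟨d, ⟨?_, ?_, fun h => ?_⟩⟩
      · rw [hD, h1, hs]
        push_cast
        rw [neg_neg]
      · rw [hX, h2, if_pos (by omega), hs, hZp]
        congr 3
        omega
      · omega

/-! ### Calogero-Moser data attached to a partition -/

section Data

variable {N : ℕ} {lam : Fin N → ℕ}

theorem CM.Xt_zero (𝒳 : CM N) (x : ℂ) :
    𝒳.Xt x 0 = x • (1 : Matrix (Fin N) (Fin N) ℂ) - 𝒳.X := by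
  rw [CM.Xt_eq, mul_zero, zero_smul, sub_zero]

theorem CM.wave_zero (𝒳 : CM N) (x z : ℂ) :
    𝒳.wave x 0 z =
      (1 + res 𝒳.a 𝒳.X ((𝒳.Zt z)⁻¹ *ᵥ 𝒳.b) x) * Complex.exp (x * z + 0 * z ^ 2) := by
  rw [CM.wave, CM.Xt_zero, res]

/-- At `y = 0` the wave function determines `aᵀ (x - X)⁻¹ (z - Z)⁻¹ b`. Expand at infinity in `x`
for fixed large `z`, then in `z`. -/
theorem IsDataOf.pair_eq (hanti : Antitone lam) {𝒳 𝒴 : CM N} (h : IsDataOf lam 𝒳)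
    (h' : IsDataOf lam 𝒴) (p q : ℕ) :
    𝒳.pair (𝒳.X ^ p * 𝒳.Z ^ q) = 𝒴.pair (𝒴.X ^ p * 𝒴.Z ^ q) := by
  have key : ∀ᶠ z in Bornology.cobounded ℂ, res (𝒳.a ᵥ* 𝒳.X ^ p) 𝒳.Z 𝒳.b z =
      res (𝒴.a ᵥ* 𝒴.X ^ p) 𝒴.Z 𝒴.b z := by
    filter_upwards [eventually_cobounded_ne_zero, eventually_det_ne_zero 𝒳.Z,
      eventually_det_ne_zero 𝒴.Z] with z hz h1 h2
    rw [res, res, ← Matrix.dotProduct_mulVec, ← Matrix.dotProduct_mulVec]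
    refine moments_eq_of_res_eq ?_ p
    filter_upwards [eventually_cobounded_ne_zero, eventually_det_ne_zero 𝒳.X,
      eventually_det_ne_zero 𝒴.X] with x hx h3 h4
    have hW := kappaWr_zero_ne_zero hanti hx
    have h5 := h x 0 z (by rwa [CM.tau, CM.Xt_zero]) h1 hW hz
    have h6 := h' x 0 z (by rwa [CM.tau, CM.Xt_zero]) h2 hW hz
    rw [← h6, CM.wave_zero, CM.wave_zero] at h5
    exact add_left_cancel (mul_right_cancel₀ (Complex.exp_ne_zero _) h5)
  have := moments_eq_of_res_eq key q
  rwa [← Matrix.dotProduct_mulVec, ← Matrix.dotProduct_mulVec, Matrix.mulVec_mulVec,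
    Matrix.mulVec_mulVec] at this

theorem IsDataOf.balanced (hanti : Antitone lam) (hsum : ∑ i, lam i = N) {𝒳 : CM N}
    (h : IsDataOf lam 𝒳) : 𝒳.Balanced := by
  obtain ⟨𝒴, D, hg, hd⟩ := exists_graded hanti hsum
  intro p q hpq
  rw [h.pair_eq hanti (CM.isDataOf_of_isGenerator hg hd), hg.balanced p q hpq]

theorem IsDataOf.gHat_eq {𝒳 : CM N} (h : IsDataOf lam 𝒳) (hb : 𝒳.Balanced) (n : ℕ) {x : ℂ}
    (hx : 𝒳.tau x (-1 / 2) ≠ 0) (hx' : hDen lam x ≠ 0) : 𝒳.gHat n x = hHat lam n x := by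
  have hW := (kappaWr_ne_zero_iff lam x).2 hx'
  have h1 : (fun z => 𝒳.hatWave x (-1 / 2) z) =
      fun z => psiNum lam x (-1 / 2) z / kappaWr lam x (-1 / 2) := by
    -- The hypothesis says nothing at `z = 0`, the point of expansion; continuity of both sides
    -- fills it in.
    refine (𝒳.differentiable_hatWave x (-1 / 2)).continuous.ext_on (dense_compl_singleton (0 : ℂ))
      ((continuous_psiNum lam x (-1 / 2)).div_const _) fun z hz => ?_
    have hz' : z ≠ 0 := hz
    have hq : 𝒳.q z ≠ 0 := by
      rw [CM.q_eq_pow hb.isNilpotent_Z]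
      exact pow_ne_zero _ hz'
    have h2 : 𝒳.wave x (-1 / 2) z =
        psiNum lam x (-1 / 2) z / (z ^ N * kappaWr lam x (-1 / 2)) := h x _ z hx hq hW hz'
    simp only
    rw [CM.hatWave_eq _ _ _ _ hq, h2, CM.q_eq_pow hb.isNilpotent_Z]
    field_simp
  rw [← tc_psiNum, ← h1]
  rfl

end Data

/-! ### Integrals along paths -/

section Paths

/-- The right end of the real axis. -/
def endR : Filter ℂ := comap Complex.re atTop ⊓ comap Complex.im (𝓝 0)

/-- The left end of the real axis. -/
def endL : Filter ℂ := comap Complex.re atBot ⊓ comap Complex.im (𝓝 0)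

theorem tendsto_re_endR : Tendsto Complex.re endR atTop := tendsto_comap.mono_left inf_le_left

theorem tendsto_re_endL : Tendsto Complex.re endL atBot := tendsto_comap.mono_left inf_le_left

theorem tendsto_im_endR : Tendsto Complex.im endR (𝓝 0) := tendsto_comap.mono_left inf_le_right

theorem tendsto_im_endL : Tendsto Complex.im endL (𝓝 0) := tendsto_comap.mono_left inf_le_right

theorem endR_le_cobounded : endR ≤ Bornology.cobounded ℂ := by
  have h : Tendsto (fun x : ℂ => x) endR (Bornology.cobounded ℂ) :=
    tendsto_norm_atTop_iff_cobounded.1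
      (tendsto_atTop_mono (fun x => (le_abs_self _).trans (Complex.abs_re_le_norm x))
        tendsto_re_endR)
  exact h

theorem endL_le_cobounded : endL ≤ Bornology.cobounded ℂ := by
  have h : Tendsto (fun x : ℂ => x) endL (Bornology.cobounded ℂ) :=
    tendsto_norm_atTop_iff_cobounded.1
      (tendsto_atTop_mono (fun x => (neg_le_abs _).trans (Complex.abs_re_le_norm x))
        (tendsto_neg_atBot_atTop.comp tendsto_re_endL))
  exact h

theorem eventually_abs_le_one {l : Filter ℂ} (h : Tendsto Complex.im l (𝓝 0)) :
    ∀ᶠ x in l, |x.im| ≤ 1 := by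
  have := h.abs
  rw [abs_zero] at this
  exact this.eventually_le_const one_pos

theorem IsHermitePath.tendsto_endR {S : Set ℂ} {γ : ℝ → ℂ} (h : IsHermitePath S γ) :
    Tendsto γ atTop endR :=
  tendsto_inf.2 ⟨tendsto_comap_iff.2 h.re_atTop, tendsto_comap_iff.2 h.im_atTop⟩

theorem IsHermitePath.tendsto_endL {S : Set ℂ} {γ : ℝ → ℂ} (h : IsHermitePath S γ) :
    Tendsto γ atBot endL :=
  tendsto_inf.2 ⟨tendsto_comap_iff.2 h.re_atBot, tendsto_comap_iff.2 h.im_atBot⟩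

/-- `f` has a primitive outside `S` with limits at both ends of the real axis that differ
by `v`. -/
def HasEndPrimitive (S : Set ℂ) (f : ℂ → ℂ) (v : ℂ) : Prop :=
  ∃ (Φ : ℂ → ℂ) (p q : ℂ), (∀ x ∉ S, HasDerivAt Φ (f x) x) ∧ Tendsto Φ endR (𝓝 p) ∧
    Tendsto Φ endL (𝓝 q) ∧ p - q = v

variable {S : Set ℂ} {f g : ℂ → ℂ} {v w : ℂ}

theorem HasEndPrimitive.congr (h : HasEndPrimitive S f v) (hfg : ∀ x ∉ S, f x = g x) :
    HasEndPrimitive S g v := by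
  obtain ⟨Φ, p, q, h1, h2, h3, h4⟩ := h
  exact ⟨Φ, p, q, fun x hx => hfg x hx ▸ h1 x hx, h2, h3, h4⟩

theorem HasEndPrimitive.add (hf : HasEndPrimitive S f v) (hg : HasEndPrimitive S g w) :
    HasEndPrimitive S (fun x => f x + g x) (v + w) := by
  obtain ⟨Φ, p, q, h1, h2, h3, h4⟩ := hf
  obtain ⟨Ψ, p', q', k1, k2, k3, k4⟩ := hg
  refine ⟨fun x => Φ x + Ψ x, p + p', q + q', fun x hx => (h1 x hx).add (k1 x hx), h2.add k2,
    h3.add k3, ?_⟩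
  rw [← h4, ← k4]
  ring

theorem HasEndPrimitive.const_mul (hf : HasEndPrimitive S f v) (c : ℂ) :
    HasEndPrimitive S (fun x => c * f x) (c * v) := by
  obtain ⟨Φ, p, q, h1, h2, h3, h4⟩ := hf
  refine ⟨fun x => c * Φ x, c * p, c * q, fun x hx => (h1 x hx).const_mul c, h2.const_mul c,
    h3.const_mul c, ?_⟩
  rw [← h4]
  ring

theorem hasEndPrimitive_zero : HasEndPrimitive S (fun _ => 0) 0 :=
  ⟨fun _ => 0, 0, 0, fun x _ => hasDerivAt_const x 0, tendsto_const_nhds, tendsto_const_nhds,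
    sub_self 0⟩

theorem HasEndPrimitive.sum {ι : Type*} (s : Finset ι) {f : ι → ℂ → ℂ} {v : ι → ℂ}
    (h : ∀ i ∈ s, HasEndPrimitive S (f i) (v i)) :
    HasEndPrimitive S (fun x => ∑ i ∈ s, f i x) (∑ i ∈ s, v i) := by
  classical
  induction s using Finset.induction_on with
  | empty => simpa using hasEndPrimitive_zero
  | insert a s ha ih =>
    have h1 := (h a (Finset.mem_insert_self a s)).add
      (ih fun i hi => h i (Finset.mem_insert_of_mem hi))
    simpa only [Finset.sum_insert ha] using h1

theorem HasEndPrimitive.tendsto_integral (h : HasEndPrimitive S f v) (hf : ContinuousOn f Sᶜ)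
    {γ : ℝ → ℂ} (hγ : IsHermitePath S γ) :
    Tendsto (fun p : ℝ × ℝ => ∫ t in p.1..p.2, f (γ t) * deriv γ t) (atBot ×ˢ atTop) (𝓝 v) := by
  obtain ⟨Φ, p, q, h1, h2, h3, h4⟩ := h
  have hdγ : ∀ t, HasDerivAt γ (deriv γ t) t := fun t =>
    (hγ.contDiff.differentiable (by simp) t).hasDerivAt
  have hc : Continuous fun t => f (γ t) * deriv γ t :=
    (hf.comp_continuous hγ.contDiff.continuous hγ.avoids).mul
      (hγ.contDiff.continuous_deriv le_rfl)
  have h5 : ∀ r : ℝ × ℝ, Φ (γ r.2) - Φ (γ r.1) = ∫ t in r.1..r.2, f (γ t) * deriv γ t := by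
    intro r
    refine (intervalIntegral.integral_eq_sub_of_hasDerivAt (f := fun t => Φ (γ t)) (fun t _ => ?_)
      (hc.intervalIntegrable _ _)).symm
    exact (h1 (γ t) (hγ.avoids t)).comp t (hdγ t)
  rw [← h4]
  refine Tendsto.congr h5 (Tendsto.sub ?_ ?_)
  · exact (h2.comp hγ.tendsto_endR).comp tendsto_snd
  · exact (h3.comp hγ.tendsto_endL).comp tendsto_fst

end Paths

/-! ### Gaussian integrals -/

section Gauss

/-- The Gaussian weight. -/
def gauss (x : ℂ) : ℂ := Complex.exp (-x ^ 2 / 2)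

theorem hasDerivAt_gauss (x : ℂ) : HasDerivAt gauss (-x * gauss x) x := by
  have h : HasDerivAt gauss (Complex.exp (-x ^ 2 / 2) * (-(((2 : ℕ) : ℂ) * x ^ (2 - 1)) / 2)) x :=
    ((hasDerivAt_pow 2 x).neg.div_const 2).cexp
  refine h.congr_deriv ?_
  rw [gauss]
  push_cast
  ring

/-- The exponent is `(Im x)² - |x|²/2`, at most `1 - |x|²/2`, and `|x|²/2 ≥ |x| - 1/2`. -/
theorem norm_gauss_le {x : ℂ} (hx : |x.im| ≤ 1) :
    ‖gauss x‖ ≤ Real.exp (3 / 2) * Real.exp (-‖x‖) := by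
  rw [gauss, Complex.norm_exp, ← Real.exp_add]
  refine Real.exp_le_exp.2 ?_
  have h1 : (-x ^ 2 / 2).re = (x.im ^ 2 - x.re ^ 2) / 2 := by
    have : (-x ^ 2 / 2) = ((-x ^ 2) / ((2 : ℝ) : ℂ)) := by norm_num
    rw [this, Complex.div_ofReal_re]
    simp [pow_two]
  have h2 : ‖x‖ ^ 2 = x.re ^ 2 + x.im ^ 2 := by
    rw [Complex.sq_norm, Complex.normSq_apply]
    ring
  have h3 : x.im ^ 2 ≤ 1 := by
    rw [← sq_abs]
    nlinarith [abs_nonneg x.im]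
  rw [h1]
  nlinarith [sq_nonneg (‖x‖ - 1)]

theorem tendsto_polynomial_mul_gauss {l : Filter ℂ} (hl : l ≤ Bornology.cobounded ℂ)
    (him : Tendsto Complex.im l (𝓝 0)) (p : Polynomial ℂ) :
    Tendsto (fun x => p.eval x * gauss x) l (𝓝 0) := by
  induction p using Polynomial.induction_on' with
  | add p q hp hq =>
    simpa only [Polynomial.eval_add, add_mul, add_zero] using hp.add hq
  | monomial n c =>
    have h1 : Tendsto (fun x : ℂ => ‖c‖ * Real.exp (3 / 2) * (‖x‖ ^ n * Real.exp (-‖x‖))) l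
        (𝓝 0) := by
      have := ((Real.tendsto_pow_mul_exp_neg_atTop_nhds_zero n).comp
        (tendsto_norm_cobounded_atTop (E := ℂ))).mono_left hl
      simpa using this.const_mul (‖c‖ * Real.exp (3 / 2))
    refine squeeze_zero_norm' ?_ h1
    filter_upwards [eventually_abs_le_one him] with x hx
    rw [Polynomial.eval_monomial, norm_mul, norm_mul, norm_pow]
    have := mul_le_mul_of_nonneg_left (norm_gauss_le hx)
      (mul_nonneg (norm_nonneg c) (pow_nonneg (norm_nonneg x) n))
    linarith

theorem exists_bound_polynomial_mul_gauss (p : Polynomial ℂ) :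
    ∃ C : ℝ, ∀ x : ℂ, |x.im| ≤ 1 → ‖p.eval x * gauss x‖ ≤ C := by
  induction p using Polynomial.induction_on' with
  | add p q hp hq =>
    obtain ⟨C, hC⟩ := hp
    obtain ⟨C', hC'⟩ := hq
    refine ⟨C + C', fun x hx => ?_⟩
    rw [Polynomial.eval_add, add_mul]
    exact (norm_add_le _ _).trans (add_le_add (hC x hx) (hC' x hx))
  | monomial n c =>
    refine ⟨‖c‖ * (n.factorial : ℝ) * Real.exp (3 / 2), fun x hx => ?_⟩
    rw [Polynomial.eval_monomial, norm_mul, norm_mul, norm_pow]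
    have h1 : ‖x‖ ^ n * Real.exp (-‖x‖) ≤ n.factorial := by
      have h2 := Real.pow_div_factorial_le_exp ‖x‖ (norm_nonneg x) n
      rw [div_le_iff₀ (by positivity)] at h2
      rw [Real.exp_neg, ← div_eq_mul_inv, div_le_iff₀ (Real.exp_pos _)]
      linarith
    calc ‖c‖ * ‖x‖ ^ n * ‖gauss x‖
        ≤ ‖c‖ * ‖x‖ ^ n * (Real.exp (3 / 2) * Real.exp (-‖x‖)) :=
          mul_le_mul_of_nonneg_left (norm_gauss_le hx) (by positivity)
      _ = ‖c‖ * Real.exp (3 / 2) * (‖x‖ ^ n * Real.exp (-‖x‖)) := by ring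
      _ ≤ ‖c‖ * Real.exp (3 / 2) * n.factorial :=
          mul_le_mul_of_nonneg_left h1 (by positivity)
      _ = _ := by ring

theorem integrable_polynomial_mul_gauss (p : Polynomial ℂ) :
    MeasureTheory.Integrable fun x : ℝ => p.eval (x : ℂ) * gauss (x : ℂ) := by
  induction p using Polynomial.induction_on' with
  | add p q hp hq =>
    refine (hp.add hq).congr (Eventually.of_forall fun x => ?_)
    simp only [Pi.add_apply, Polynomial.eval_add, add_mul]
  | monomial n c =>
    have h1 := integrable_rpow_mul_exp_neg_mul_sq (b := 1 / 2) (by norm_num) (s := n)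
      (by have : (0 : ℝ) ≤ n := Nat.cast_nonneg n
          linarith)
    have h2 := (h1.ofReal (𝕜 := ℂ)).const_mul c
    refine h2.congr (Eventually.of_forall fun x => ?_)
    simp only [Polynomial.eval_monomial, gauss, Real.rpow_natCast]
    have : (-(x : ℂ) ^ 2 / 2) = ((-(1 / 2) * x ^ 2 : ℝ) : ℂ) := by
      push_cast
      ring
    rw [this, mul_assoc, ← Complex.ofReal_exp, ← Complex.ofReal_pow, ← Complex.ofReal_mul]
    rfl

/-- Integrate from `0` horizontally, then vertically. The horizontal part converges by integrability
on the real line; the vertical part has bounded integrand and length `|Im z| → 0`. -/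
theorem exists_hasEndPrimitive_polynomial_mul_gauss (S : Set ℂ) (p : Polynomial ℂ) :
    ∃ v, HasEndPrimitive S (fun x => p.eval x * gauss x) v := by
  set f : ℂ → ℂ := fun x => p.eval x * gauss x with hf
  have hd : Differentiable ℂ f := fun x =>
    p.differentiableAt.mul (hasDerivAt_gauss x).differentiableAt
  obtain ⟨C, hC⟩ := exists_bound_polynomial_mul_gauss p
  have hI := integrable_polynomial_mul_gauss p
  have hvert : ∀ l : Filter ℂ, Tendsto Complex.im l (𝓝 0) →
      Tendsto (fun z : ℂ => Complex.I • ∫ y in (0 : ℝ)..z.im, f (z.re + y * Complex.I)) l (𝓝 0) := by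
    intro l hl
    have h1 : Tendsto (fun z : ℂ => C * |z.im - 0|) l (𝓝 0) := by
      simpa using hl.abs.const_mul C
    refine squeeze_zero_norm' ?_ h1
    filter_upwards [eventually_abs_le_one hl] with z hz
    rw [norm_smul, Complex.norm_I, one_mul]
    refine intervalIntegral.norm_integral_le_of_norm_le_const fun y hy => hC _ ?_
    have h2 : ((z.re : ℂ) + y * Complex.I).im = y := by simp
    rw [h2]
    rcases Set.mem_uIoc.1 hy with h3 | h3
    · exact (abs_le_abs h3.2 (by linarith)).trans hz
    · rw [abs_le] at hz ⊢
      constructor <;> linarith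
  have hw : ∀ z, Complex.wedgeIntegral 0 z f = (∫ x in (0 : ℝ)..z.re, f x) +
      Complex.I • ∫ y in (0 : ℝ)..z.im, f (z.re + y * Complex.I) := by
    intro z
    simp [Complex.wedgeIntegral]
  refine ⟨_, fun z => Complex.wedgeIntegral 0 z f, (∫ x in Set.Ioi (0 : ℝ), f x) + 0,
    -(∫ x in Set.Iic (0 : ℝ), f x) + 0, fun z _ => ?_, ?_, ?_, rfl⟩
  · exact (hd.differentiableOn.isConservativeOn).hasDerivAt_wedgeIntegral
      (r := ‖z‖ + 1) hd.continuous.continuousOn (by simp)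
  · simp only [hw]
    exact ((MeasureTheory.intervalIntegral_tendsto_integral_Ioi 0 hI.integrableOn
      tendsto_id).comp tendsto_re_endR).add (hvert _ tendsto_im_endR)
  · simp only [hw]
    refine Tendsto.add ?_ (hvert _ tendsto_im_endL)
    have := ((MeasureTheory.intervalIntegral_tendsto_integral_Iic 0 hI.integrableOn
      tendsto_id).comp tendsto_re_endL).neg
    exact this.congr fun z => (intervalIntegral.integral_symm _ _).symm

/-- Sturm–Liouville argument: `(He_i He_{j-1} - He_{i-1} He_j) exp (-x²/2)` has derivative `(i - j)
He_i He_j exp (-x²/2)`. Negative indices are covered too. -/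
theorem hasEndPrimitive_He_mul_He (S : Set ℂ) {i j : ℤ} (hij : i ≠ j) :
    HasEndPrimitive S (fun x => He (-1 / 2) i x * He (-1 / 2) j x * gauss x) 0 := by
  obtain ⟨p₀, hp₀⟩ := exists_polynomial_He (-1 / 2) i
  obtain ⟨p₁, hp₁⟩ := exists_polynomial_He (-1 / 2) (i - 1)
  obtain ⟨q₀, hq₀⟩ := exists_polynomial_He (-1 / 2) j
  obtain ⟨q₁, hq₁⟩ := exists_polynomial_He (-1 / 2) (j - 1)
  have hne : (j : ℂ) - i ≠ 0 := sub_ne_zero.2 fun h => hij (Int.cast_injective h).symm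
  have hΦ : ∀ x, (p₀ * q₁ - p₁ * q₀).eval x * gauss x =
      (He (-1 / 2) i x * He (-1 / 2) (j - 1) x - He (-1 / 2) (i - 1) x * He (-1 / 2) j x) *
        gauss x := fun x => by
    rw [hp₀, hp₁, hq₀, hq₁, Polynomial.eval_sub, Polynomial.eval_mul, Polynomial.eval_mul]
  have h1 : HasEndPrimitive S
      (fun x => ((i : ℂ) - j) * (He (-1 / 2) i x * He (-1 / 2) j x * gauss x)) 0 := by
    refine ⟨_, 0, 0, fun x _ => ?_,
      (tendsto_polynomial_mul_gauss endR_le_cobounded tendsto_im_endR (p₀ * q₁ - p₁ * q₀)),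
      (tendsto_polynomial_mul_gauss endL_le_cobounded tendsto_im_endL (p₀ * q₁ - p₁ * q₀)),
      sub_self 0⟩
    simp only [hΦ]
    have hd := (((hasDerivAt_He (-1 / 2) i x).mul (hasDerivAt_He (-1 / 2) (j - 1) x)).sub
      ((hasDerivAt_He (-1 / 2) (i - 1) x).mul (hasDerivAt_He (-1 / 2) j x))).mul
        (hasDerivAt_gauss x)
    refine hd.congr_deriv ?_
    have e1 := He_succ (-1 / 2) (i - 1) x
    have e2 := He_succ (-1 / 2) (j - 1) x
    push_cast at e1 e2
    rw [sub_add_cancel, sub_add_cancel] at e1 e2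
    simp only [Pi.sub_apply, Pi.mul_apply]
    linear_combination (-gauss x * He (-1 / 2) j x) * e1 + gauss x * He (-1 / 2) i x * e2
  have h2 := h1.const_mul ((i : ℂ) - j)⁻¹
  rw [mul_zero] at h2
  refine h2.congr fun x _ => ?_
  have hne' : (i : ℂ) - j ≠ 0 := by
    rw [← neg_sub]
    exact neg_ne_zero.2 hne
  rw [inv_mul_cancel_left₀ hne']

end Gauss

/-! ### Orthogonality -/

namespace CM

variable {N : ℕ} {𝒳 : CM N}

theorem T_eq_res (𝒳 : CM N) (p q : ℕ) :
    𝒳.T p q = res (𝒳.a ᵥ* 𝒳.X ^ p) (𝒳.X + 𝒳.Z) (𝒳.Z ^ q *ᵥ 𝒳.b) := by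
  funext x
  rw [T, pair, res, ← Matrix.mulVec_mulVec, ← Matrix.mulVec_mulVec, Matrix.dotProduct_mulVec,
    Xt_neg_half]

/-- The derivative of `T p q`. -/
def T' (𝒳 : CM N) (p q : ℕ) (x : ℂ) : ℂ :=
  -𝒳.pair (𝒳.X ^ p * ((𝒳.Xt x (-1 / 2))⁻¹ * (𝒳.Xt x (-1 / 2))⁻¹) * 𝒳.Z ^ q)

theorem hasDerivAt_T (p q : ℕ) {x : ℂ} (hx : 𝒳.tau x (-1 / 2) ≠ 0) :
    HasDerivAt (𝒳.T p q) (𝒳.T' p q x) x := by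
  rw [tau, Xt_neg_half] at hx
  rw [T_eq_res]
  refine (hasDerivAt_res _ _ _ hx).congr_deriv ?_
  rw [T', pair, res, Xt_neg_half]
  simp only [← Matrix.mulVec_mulVec]
  rw [Matrix.dotProduct_mulVec 𝒳.a]

theorem tendsto_T (p q : ℕ) : Tendsto (𝒳.T p q) (Bornology.cobounded ℂ) (𝓝 0) := by
  rw [T_eq_res]
  exact tendsto_res _ _ _

/-- The product is the pairing of `X^p W⁻¹ (b aᵀ) W⁻¹ Z^q` with `W = x - X - Z`. Since `[X, Z] = [W,
X]`, the middle part is `X W⁻¹ - W⁻¹ X - W⁻²`, and `-W⁻²` is the derivative of the resolvent. -/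
theorem T_mul_T (p q : ℕ) {x : ℂ} (hx : 𝒳.tau x (-1 / 2) ≠ 0) :
    𝒳.T p 0 x * 𝒳.T 0 q x = 𝒳.T (p + 1) q x + 𝒳.T p (q + 1) x - x * 𝒳.T p q x + 𝒳.T' p q x +
      𝒳.pair (𝒳.X ^ p * 𝒳.Z ^ q) := by
  have hu := isUnit_iff_ne_zero.2 hx
  have h1 := Matrix.nonsing_inv_mul _ hu
  have h2 := Matrix.mul_nonsing_inv _ hu
  have hZ : 𝒳.Z = x • (1 : Matrix (Fin N) (Fin N) ℂ) - 𝒳.X - 𝒳.Xt x (-1 / 2) := by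
    rw [Xt_neg_half]; abel
  simp only [T, T', pow_zero, mul_one, one_mul]
  set W := 𝒳.Xt x (-1 / 2)
  have h3 : W⁻¹ * 𝒳.X = x • W⁻¹ - W⁻¹ * 𝒳.Z - 1 := by
    have : 𝒳.X = x • (1 : Matrix (Fin N) (Fin N) ℂ) - 𝒳.Z - W := by rw [hZ]; abel
    nth_rewrite 1 [this]
    rw [mul_sub, mul_sub, h1, Matrix.mul_smul, mul_one]
  have h4 : W⁻¹ * Matrix.vecMulVec 𝒳.b 𝒳.a * W⁻¹ =
      𝒳.X * W⁻¹ - W⁻¹ * 𝒳.X - W⁻¹ * W⁻¹ := by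
    have h5 : 𝒳.X * 𝒳.Z - 𝒳.Z * 𝒳.X = W * 𝒳.X - 𝒳.X * W := by
      rw [hZ]
      simp only [mul_sub, sub_mul, Matrix.mul_smul, Matrix.smul_mul, mul_one, one_mul]
      abel
    calc W⁻¹ * Matrix.vecMulVec 𝒳.b 𝒳.a * W⁻¹
        = (W⁻¹ * W) * 𝒳.X * W⁻¹ - W⁻¹ * 𝒳.X * (W * W⁻¹) - W⁻¹ * W⁻¹ := by
          rw [← 𝒳.rank_one, h5]
          simp only [mul_sub, sub_mul, mul_one, mul_assoc]
      _ = _ := by rw [h1, h2, one_mul, mul_one]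
  have h6 : 𝒳.X ^ p * W⁻¹ * Matrix.vecMulVec 𝒳.b 𝒳.a * (W⁻¹ * 𝒳.Z ^ q) =
      𝒳.X ^ (p + 1) * W⁻¹ * 𝒳.Z ^ q + 𝒳.X ^ p * W⁻¹ * 𝒳.Z ^ (q + 1) - x • (𝒳.X ^ p * W⁻¹ * 𝒳.Z ^ q)
        - 𝒳.X ^ p * (W⁻¹ * W⁻¹) * 𝒳.Z ^ q + 𝒳.X ^ p * 𝒳.Z ^ q := by
    calc 𝒳.X ^ p * W⁻¹ * Matrix.vecMulVec 𝒳.b 𝒳.a * (W⁻¹ * 𝒳.Z ^ q)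
        = 𝒳.X ^ p * (W⁻¹ * Matrix.vecMulVec 𝒳.b 𝒳.a * W⁻¹) * 𝒳.Z ^ q := by
          simp only [mul_assoc]
      _ = _ := by
          rw [h4, h3, pow_succ, pow_succ' 𝒳.Z]
          simp only [mul_sub, sub_mul, Matrix.mul_smul, Matrix.smul_mul, mul_one, mul_assoc]
          abel
  rw [← pair_mul_rank_one_mul, h6, pair_add, pair_sub, pair_sub, pair_add, pair_smul]
  ring

theorem Balanced.T_top_left (h : 𝒳.Balanced) (q : ℕ) (x : ℂ) : 𝒳.T N q x = 0 := by
  rw [T, h.X_pow, zero_mul, zero_mul, pair_zero]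

theorem Balanced.T_top_right (h : 𝒳.Balanced) (p : ℕ) (x : ℂ) : 𝒳.T p N x = 0 := by
  rw [T, h.Z_pow, mul_zero, pair_zero]

end CM

/-! ### Summation by parts -/

theorem sum_shift_eq {N : ℕ} (t H : ℕ → ℂ) (ht : t N = 0) :
    t 0 * H 0 + ∑ p ∈ Finset.range N, t (p + 1) * H (p + 1) =
      ∑ p ∈ Finset.range N, t p * H p := by
  have h1 := Finset.sum_range_succ (fun p => t p * H p) N
  rw [Finset.sum_range_succ', ht, zero_mul, add_zero] at h1
  rw [← h1, add_comm]

/-- Shifting the indices of `t (p + 1) q` and `t p (q + 1)` back onto `H` and `G` leaves boundary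
terms at index `0`, which cancel the cross terms of the product. With `H' (p + 1) = H p` and
likewise for `G`, the last double sum is a derivative divided by the Gaussian weight. -/
theorem mul_sum_expansion {N : ℕ} (x : ℂ) (t t' φ : ℕ → ℕ → ℂ) (H G : ℕ → ℂ)
    (h1 : ∀ q, t N q = 0) (h2 : ∀ p, t p N = 0)
    (h3 : ∀ p q, t p 0 * t 0 q = t (p + 1) q + t p (q + 1) - x * t p q + t' p q + φ p q) :
    (H 0 + ∑ p ∈ Finset.range N, t p 0 * H (p + 1)) *
        (G 0 + ∑ q ∈ Finset.range N, t 0 q * G (q + 1)) =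
      (H 0 * G 0 + ∑ p ∈ Finset.range N, ∑ q ∈ Finset.range N, φ p q * (H (p + 1) * G (q + 1))) +
        ∑ p ∈ Finset.range N, ∑ q ∈ Finset.range N,
          (t p q * (H p * G (q + 1) + H (p + 1) * G q - x * (H (p + 1) * G (q + 1))) +
            t' p q * (H (p + 1) * G (q + 1))) := by
  have e1 : ∑ p ∈ Finset.range N, ∑ q ∈ Finset.range N, t (p + 1) q * (H (p + 1) * G (q + 1)) =
      ∑ p ∈ Finset.range N, ∑ q ∈ Finset.range N, t p q * (H p * G (q + 1)) -
        ∑ q ∈ Finset.range N, t 0 q * (H 0 * G (q + 1)) := by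
    rw [Finset.sum_comm, Finset.sum_comm (f := fun p q => t p q * (H p * G (q + 1))),
      ← Finset.sum_sub_distrib]
    refine Finset.sum_congr rfl fun q _ => ?_
    have := sum_shift_eq (fun p => t p q) (fun p => H p * G (q + 1)) (h1 q)
    linear_combination this
  have e2 : ∑ p ∈ Finset.range N, ∑ q ∈ Finset.range N, t p (q + 1) * (H (p + 1) * G (q + 1)) =
      ∑ p ∈ Finset.range N, ∑ q ∈ Finset.range N, t p q * (H (p + 1) * G q) -
        ∑ p ∈ Finset.range N, t p 0 * (H (p + 1) * G 0) := by
    rw [← Finset.sum_sub_distrib]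
    refine Finset.sum_congr rfl fun p _ => ?_
    have := sum_shift_eq (fun q => t p q) (fun q => H (p + 1) * G q) (h2 p)
    linear_combination this
  have e3 : (∑ p ∈ Finset.range N, t p 0 * H (p + 1)) * (∑ q ∈ Finset.range N, t 0 q * G (q + 1)) =
      ∑ p ∈ Finset.range N, ∑ q ∈ Finset.range N, t (p + 1) q * (H (p + 1) * G (q + 1)) +
      ∑ p ∈ Finset.range N, ∑ q ∈ Finset.range N, t p (q + 1) * (H (p + 1) * G (q + 1)) +
      ∑ p ∈ Finset.range N, ∑ q ∈ Finset.range N,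
        ((t' p q + φ p q - x * t p q) * (H (p + 1) * G (q + 1))) := by
    rw [Finset.sum_mul_sum]
    simp only [← Finset.sum_add_distrib]
    refine Finset.sum_congr rfl fun p _ => Finset.sum_congr rfl fun q _ => ?_
    linear_combination (H (p + 1) * G (q + 1)) * h3 p q
  have e4 : ∑ p ∈ Finset.range N, ∑ q ∈ Finset.range N,
        ((t' p q + φ p q - x * t p q) * (H (p + 1) * G (q + 1))) +
      ∑ p ∈ Finset.range N, ∑ q ∈ Finset.range N, t p q * (H p * G (q + 1)) +
      ∑ p ∈ Finset.range N, ∑ q ∈ Finset.range N, t p q * (H (p + 1) * G q) =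
      ∑ p ∈ Finset.range N, ∑ q ∈ Finset.range N, φ p q * (H (p + 1) * G (q + 1)) +
        ∑ p ∈ Finset.range N, ∑ q ∈ Finset.range N,
          (t p q * (H p * G (q + 1) + H (p + 1) * G q - x * (H (p + 1) * G (q + 1))) +
            t' p q * (H (p + 1) * G (q + 1))) := by
    simp only [← Finset.sum_add_distrib]
    refine Finset.sum_congr rfl fun p _ => Finset.sum_congr rfl fun q _ => ?_
    ring
  have e5 : H 0 * ∑ q ∈ Finset.range N, t 0 q * G (q + 1) =
      ∑ q ∈ Finset.range N, t 0 q * (H 0 * G (q + 1)) := by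
    rw [Finset.mul_sum]
    exact Finset.sum_congr rfl fun q _ => by ring
  have e6 : (∑ p ∈ Finset.range N, t p 0 * H (p + 1)) * G 0 =
      ∑ p ∈ Finset.range N, t p 0 * (H (p + 1) * G 0) := by
    rw [Finset.sum_mul]
    exact Finset.sum_congr rfl fun q _ => by ring
  linear_combination e1 + e2 + e3 + e4 + e5 + e6

namespace CM

variable {N : ℕ} {𝒳 : CM N} {S : Set ℂ}

/-- The integrand is the derivative of `T p q * He_i * He_j * gauss`, which decays at both ends. -/
theorem hasEndPrimitive_T_mul (hS : ∀ x ∉ S, 𝒳.tau x (-1 / 2) ≠ 0) (p q : ℕ) (i j : ℤ) :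
    HasEndPrimitive S (fun x => (𝒳.T p q x * (He (-1 / 2) (i - 1) x * He (-1 / 2) j x +
      He (-1 / 2) i x * He (-1 / 2) (j - 1) x - x * (He (-1 / 2) i x * He (-1 / 2) j x)) +
        𝒳.T' p q x * (He (-1 / 2) i x * He (-1 / 2) j x)) * gauss x) 0 := by
  obtain ⟨P, hP⟩ := exists_polynomial_He (-1 / 2) i
  obtain ⟨Q, hQ⟩ := exists_polynomial_He (-1 / 2) j
  have hlim : ∀ l : Filter ℂ, l ≤ Bornology.cobounded ℂ → Tendsto Complex.im l (𝓝 0) →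
      Tendsto (fun x => 𝒳.T p q x * (He (-1 / 2) i x * He (-1 / 2) j x * gauss x)) l (𝓝 0) := by
    intro l h1 h2
    have := ((tendsto_T (𝒳 := 𝒳) p q).mono_left h1).mul
      (tendsto_polynomial_mul_gauss h1 h2 (P * Q))
    simpa only [mul_zero, Polynomial.eval_mul, ← hP, ← hQ] using this
  refine ⟨_, 0, 0, fun x hx => ?_, hlim _ endR_le_cobounded tendsto_im_endR,
    hlim _ endL_le_cobounded tendsto_im_endL, sub_self 0⟩
  have h1 := (hasDerivAt_T p q (hS x hx)).mul (((hasDerivAt_He (-1 / 2) i x).mul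
    (hasDerivAt_He (-1 / 2) j x)).mul (hasDerivAt_gauss x))
  refine h1.congr_deriv ?_
  simp only [Pi.mul_apply]
  ring

/-- Balance enters through the constants `φ p q`: only `p = q` survives, so both Hermite indices are
shifted by the same amount and stay distinct when `m ≠ n`. -/
theorem Balanced.exists_hasEndPrimitive (h : 𝒳.Balanced) (hS : ∀ x ∉ S, 𝒳.tau x (-1 / 2) ≠ 0)
    (m n : ℕ) : ∃ v, HasEndPrimitive S (fun x => 𝒳.fHat m x * 𝒳.gHat n x * gauss x) v ∧
      (m ≠ n → v = 0) := by
  have hterm : ∀ k : ℕ, ∃ v, HasEndPrimitive S (fun x => He (-1 / 2) ((m : ℤ) - N + k) x *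
      He (-1 / 2) ((n : ℤ) - N + k) x * gauss x) v ∧ (m ≠ n → v = 0) := by
    intro k
    by_cases hmn : m = n
    · obtain ⟨P, hP⟩ := exists_polynomial_He (-1 / 2) ((m : ℤ) - N + k)
      obtain ⟨Q, hQ⟩ := exists_polynomial_He (-1 / 2) ((n : ℤ) - N + k)
      obtain ⟨v, hv⟩ := exists_hasEndPrimitive_polynomial_mul_gauss S (P * Q)
      exact ⟨v, by simpa only [Polynomial.eval_mul, ← hP, ← hQ] using hv, fun h' => absurd hmn h'⟩
    · exact ⟨0, hasEndPrimitive_He_mul_He S (by omega), fun _ => rfl⟩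
  choose v hv hv0 using hterm
  have h1 := ((hv 0).add (HasEndPrimitive.sum (Finset.range N) fun p _ =>
    (hv (p + 1)).const_mul (𝒳.pair (𝒳.X ^ p * 𝒳.Z ^ p)))).add
    (HasEndPrimitive.sum (Finset.range N) fun p _ => HasEndPrimitive.sum (Finset.range N)
      fun q _ => hasEndPrimitive_T_mul hS p q ((m : ℤ) - N + (p + 1)) ((n : ℤ) - N + (q + 1)))
  refine ⟨_, h1.congr fun x hx => ?_, fun hmn => by simp [hv0 _ hmn]⟩
  have h2 := mul_sum_expansion x (fun p q => 𝒳.T p q x) (fun p q => 𝒳.T' p q x)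
    (fun p q => 𝒳.pair (𝒳.X ^ p * 𝒳.Z ^ q)) (fun k => He (-1 / 2) ((m : ℤ) - N + k) x)
    (fun k => He (-1 / 2) ((n : ℤ) - N + k) x) (fun q => h.T_top_left q x)
    (fun p => h.T_top_right p x) (fun p q => T_mul_T p q (hS x hx))
  have h3 : ∀ p ∈ Finset.range N, ∑ q ∈ Finset.range N, 𝒳.pair (𝒳.X ^ p * 𝒳.Z ^ q) *
      (He (-1 / 2) ((m : ℤ) - N + (p + 1 : ℕ)) x * He (-1 / 2) ((n : ℤ) - N + (q + 1 : ℕ)) x) =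
      𝒳.pair (𝒳.X ^ p * 𝒳.Z ^ p) * (He (-1 / 2) ((m : ℤ) - N + (p + 1 : ℕ)) x *
        He (-1 / 2) ((n : ℤ) - N + (p + 1 : ℕ)) x) := by
    intro p hp
    rw [Finset.sum_eq_single_of_mem p hp]
    intro q _ hq
    rw [h p q hq.symm, zero_mul]
  rw [Finset.sum_congr rfl h3] at h2
  have h4 : ∀ (a : ℤ), a + 1 - 1 = a := fun a => by ring
  rw [h.fHat_eq, gHat_of_isNilpotent h.isNilpotent_Z]
  simp only [Nat.cast_zero, add_zero, Nat.cast_add, Nat.cast_one] at h2 ⊢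
  rw [h2, add_mul, add_mul, Finset.sum_mul, Finset.sum_mul]
  simp only [Finset.sum_mul, ← add_assoc, h4]
  congr 2
  refine Finset.sum_congr rfl fun p _ => ?_
  ring

theorem Balanced.continuousOn_fHat (h : 𝒳.Balanced) (hS : ∀ x ∉ S, 𝒳.tau x (-1 / 2) ≠ 0)
    (n : ℕ) : ContinuousOn (𝒳.fHat n) Sᶜ := by
  have h1 : 𝒳.fHat n = fun x => He (-1 / 2) ((n : ℤ) - N) x + ∑ p ∈ Finset.range N,
      𝒳.T p 0 x * He (-1 / 2) ((n : ℤ) - N + (p + 1)) x := funext fun x => h.fHat_eq n x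
  rw [h1]
  intro x hx
  refine ContinuousAt.continuousWithinAt ((hasDerivAt_He _ _ x).continuousAt.add ?_)
  exact tendsto_finsetSum _ fun p _ =>
    (hasDerivAt_T p 0 (hS x hx)).continuousAt.mul (hasDerivAt_He _ _ x).continuousAt

end CM

end XHermite

end

/-! ### The main theorem -/

theorem mainTheorem6 (N : ℕ) (lam : Fin N → ℕ) (hanti : Antitone lam)
    (hsum : ∑ i, lam i = N) :
    (∃ 𝒳 : XHermite.CM N, XHermite.IsDataOf lam 𝒳) ∧
    (∀ 𝒳 : XHermite.CM N, XHermite.IsDataOf lam 𝒳 →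
      (∀ (n : ℕ) (x : ℂ), 𝒳.tau x (-1 / 2) ≠ 0 → XHermite.hDen lam x ≠ 0 →
        𝒳.fHat n x = 𝒳.gHat n x ∧ 𝒳.gHat n x = XHermite.hHat lam n x) ∧
      𝒳.B = {0}) ∧
    (∃ ν : ℕ → ℂ, ∀ m n : ℕ,
      XHermite.HasHermiteProduct {x | XHermite.hDen lam x = 0}
        (XHermite.hHat lam m) (XHermite.hHat lam n) (if m = n then ν n else 0)) := by
  open XHermite in
  obtain ⟨𝒳, D, hg, hd⟩ := exists_graded hanti hsum
  have hdata := CM.isDataOf_of_isGenerator hg hd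
  refine ⟨⟨𝒳, hdata⟩, fun 𝒴 h𝒴 => ?_, ?_⟩
  · have hb := h𝒴.balanced hanti hsum
    exact ⟨fun n x hx hx' => ⟨hb.fHat_eq_gHat n hx, h𝒴.gHat_eq hb n hx hx'⟩, hb.B_eq⟩
  · have hb := hg.balanced
    set S : Set ℂ := {x | hDen lam x = 0}
    have hS : ∀ x ∉ S, 𝒳.tau x (-1 / 2) ≠ 0 := fun x hx =>
      CM.tau_ne_zero_of_isGenerator hg hd ((kappaWr_ne_zero_iff lam x).2 hx)
    have hgh : ∀ n, ∀ x ∉ S, 𝒳.gHat n x = hHat lam n x := fun n x hx =>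
      hdata.gHat_eq hb n (hS x hx) hx
    have hfh : ∀ n, ∀ x ∉ S, 𝒳.fHat n x = hHat lam n x := fun n x hx =>
      (hb.fHat_eq_gHat n (hS x hx)).trans (hgh n x hx)
    choose v hv hv0 using fun m n => hb.exists_hasEndPrimitive hS m n
    refine ⟨fun n => v n n, fun m n γ hγ => ?_⟩
    have hval : (if m = n then v n n else 0) = v m n := by
      split_ifs with h
      · rw [h]
      · exact (hv0 m n h).symm
    have hc : ∀ n, ContinuousOn (hHat lam n) Sᶜ := fun n =>
      (hb.continuousOn_fHat hS n).congr fun x hx => (hfh n x hx).symm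
    have hgc : Continuous gauss :=
      continuous_iff_continuousAt.2 fun x => (hasDerivAt_gauss x).continuousAt
    rw [hval]
    -- One factor is read as `f̂_m` and the other as `ĝ_n`, because `T_mul_T` applies only to this
    -- mixed product.
    exact (HasEndPrimitive.congr (g := fun x => hHat lam m x * hHat lam n x * gauss x) (hv m n)
      fun x hx => by rw [hfh m x hx, hgh n x hx]).tendsto_integral
      (((hc m).mul (hc n)).mul hgc.continuousOn) hγ
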